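/- Let $1\le k\le m\le n$. Put $d^c=\frac{\partial-\bar\partial}{4i}$, so that $dd^cu=\frac i2\sum_{j,l} u_{j\bar l}\,dz_j\wedge d\bar z_l$, and $\beta=dd^c|z|^2$. A $C^2$ function $v$ on an open set $D\subset\mathbb C^n$ is called $m$-subharmonic ($m$-sh) if $(dd^cv)^j\wedge\beta^{n-j}\ge 0$ for $j=1,\dots,m$. A function $u\in L^1_{loc}(D)$ is $m$-sh if it is upper semicontinuous and, for all $m$-sh functions $v_1,\dots,v_{m-1}\in C^2(D)$, the current $\varphi\mapsto\int_D u\,dd^cv_1\wedge\dots\wedge dd^cv_{m-1}\wedge\beta^{n-m}\wedge dd^c\varphi$ is positive. For continuous $m$-sh functions $u_1,\dots,u_k$ and $k\le q\le m$, the currents $dd^cu_1\wedge\dots\wedge dd^cu_k\wedge\beta^{n-q}$ are defined recursively by $$[dd^cu_1\wedge\dots\wedge dd^cu_k\wedge\beta^{n-q}](\psi)=\int u_k\,dd^cu_1\wedge\dots\wedge dd^cu_{k-1}\wedge\beta^{n-q}\wedge dd^c\psi$$ for smooth compactly supported forms $\psi$ of degree $2(q-k)$, where at each step the current of the previous step has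 order zero and so can be applied to forms with continuous coefficients. In addition $du_1\wedge d^cu_1\wedge S:=\frac12dd^c(u_1^2)\wedge S-u_1\,dd^cu_1\wedge S$ with $S=dd^cu_2\wedge\dots\wedge dd^cu_k\wedge\beta^{n-m}$. **Theorem 1.** Let $u_1,\dots,u_k$ be continuous $m$-sh functions on the unit ball $B=\{|z|<1\}$ of $\mathbb C^n$. Then $dd^cu_1\wedge\dots\wedge dd^cu_k\wedge\beta^{n-k}$ and $dd^cu_2\wedge\dots\wedge dd^cu_k\wedge\beta^{n-k+1}$ are well defined Radon measures on $B$, and for every $r<1$ $$\int_0^r dt\int_{|z|^2\le t}dd^cu_1\wedge\dots\wedge dd^cu_k\wedge\beta^{n-k}\le\Bigl(\sup_Bu_1-\inf_Bu_1\Bigr)\int_{|z|^2\le r}dd^cu_2\wedge\dots\wedge dd^cu_k\wedge\beta^{n-k+1}$$ (where $\infty\cdot 0=0$ if $u_1$ is unbounded). **Corollary.** Let $D\subset\mathbb C^n$ be open, $M\in\mathbb R$, and let $L_M$ be the class of continuous $m$-sh functions $u$ on $D$ with $|u|\le M$. For $u_1,\dots,u_k\in L_M$ the currents $$dd^cu_1\wedge\dots\wedge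 dd^cu_k\wedge\beta^{n-m}\quad\text{and}\quad du_1\wedge d^cu_1\wedge dd^cu_2\wedge\dots\wedge dd^cu_k\wedge\beta^{n-m}$$ are well defined and positive, and both families are weakly bounded: for each smooth compactly supported test form $\psi$ of degree $2(m-k)$ on $D$ there is a constant $C$ such that the values on $\psi$ of all these currents, for all $u_1,\dots,u_k\in L_M$, are at most $C$ in absolute value. -/

import Mathlib

open MeasureTheory Set Metric
open scoped ContDiff

noncomputable section

namespace HessianCurrents

/-- The complex Euclidean space `ℂⁿ`. -/
abbrev Cn (n : ℕ) : Type := EuclideanSpace ℂ (Fin n)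

/-- Real-valued (real-)alternating `d`-covectors on `ℂⁿ`, with the operator norm. -/
abbrev Covec (n d : ℕ) : Type := Cn n [⋀^Fin d]→L[ℝ] ℝ

/-- Differential forms of degree `d` (with real values) on `ℂⁿ`. -/
abbrev Form (n d : ℕ) : Type := Cn n → Covec n d

/-! ### Exterior algebra -/

/-- The wedge product (normalised by shuffles, so that `(dx ∧ dy)(e₁, e₂) = 1`). -/
def wedge {n a b : ℕ} (α : Cn n [⋀^Fin a]→ₗ[ℝ] ℝ) (η : Cn n [⋀^Fin b]→ₗ[ℝ] ℝ) :
    Cn n [⋀^Fin (a + b)]→ₗ[ℝ] ℝ :=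
  ((LinearMap.mul' ℝ ℝ).compAlternatingMap (α.domCoprod η)).domDomCongr finSumFinEquiv

/-- The wedge product `α₁ ∧ ⋯ ∧ αⱼ` of `2`-covectors. -/
def wedgeProd {n : ℕ} : (j : ℕ) → (Fin j → Cn n [⋀^Fin 2]→ₗ[ℝ] ℝ) →
    Cn n [⋀^Fin (2 * j)]→ₗ[ℝ] ℝ
  | 0, _ => AlternatingMap.constOfIsEmpty ℝ (Cn n) (Fin 0) 1
  | j + 1, α => wedge (wedgeProd j (Fin.init α)) (α (Fin.last j))

/-- The standard positively oriented real frame `e₁, i e₁, e₂, i e₂, …` of `ℂⁿ`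
(extended by zero beyond the index `2 n`). -/
def frame (n j : ℕ) : Cn n :=
  if h : j / 2 < n then EuclideanSpace.single ⟨j / 2, h⟩ (if j % 2 = 0 then 1 else Complex.I)
  else 0

/-- For `N = 2 n`: the coefficient of a top degree covector with respect to the Lebesgue volume
form `dx₁ ∧ dy₁ ∧ ⋯ ∧ dxₙ ∧ dyₙ`. -/
def topCoeff {n N : ℕ} (ψ : Cn n [⋀^Fin N]→ₗ[ℝ] ℝ) : ℝ :=
  ψ fun i => frame n i

/-! ### The operators `dᶜ`, `ddᶜ` and the form `β` -/

/-- Multiplication by `i` as a real linear map. -/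
def mulI (n : ℕ) : Cn n →L[ℝ] Cn n :=
  Complex.I • ContinuousLinearMap.id ℝ (Cn n)

/-- `dᶜ = (∂ - ∂̄) / (4 i)`. The pullback `J^*` under multiplication by `i` multiplies forms of
type `(a, b)` by `i ^ (a - b)`, so `(J^*)⁻¹ ∘ d ∘ J^* = -i ∂ + i ∂̄ = (∂ - ∂̄) / i`. -/
def dc {n d : ℕ} (ψ : Form n d) : Form n (d + 1) := fun z =>
  (1 / 4 : ℝ) • (extDeriv (fun y => (ψ y).compContinuousLinearMap (mulI n)) z).compContinuousLinearMap
    (-mulI n)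

/-- `ddᶜ` on forms. -/
def ddc {n d : ℕ} (ψ : Form n d) : Form n (d + 2) := extDeriv (dc ψ)

/-- A function as a form of degree zero. -/
def zeroForm {n : ℕ} (f : Cn n → ℝ) : Form n 0 := fun z =>
  ContinuousAlternatingMap.constOfIsEmpty ℝ (Cn n) (Fin 0) (f z)

/-- The `2`-covector `ddᶜ f` at the point `z`. -/
def ddcFun {n : ℕ} (f : Cn n → ℝ) (z : Cn n) : Cn n [⋀^Fin 2]→ₗ[ℝ] ℝ :=
  (ddc (zeroForm f) z).toAlternatingMap

/-- `β ^ q`, where `β = ddᶜ |z|²`. -/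
def betaPow {n : ℕ} (q : ℕ) (z : Cn n) : Cn n [⋀^Fin (2 * q)]→ₗ[ℝ] ℝ :=
  wedgeProd q fun _ => ddcFun (fun w : Cn n => ‖w‖ ^ 2) z

/-! ### `m`-subharmonic functions -/

/-- `C²` functions on `D` that are `m`-subharmonic: `(ddᶜ v)ʲ ∧ β^(n-j) ≥ 0` for `1 ≤ j ≤ m`. -/
def IsC2MSubharmonic {n : ℕ} (m : ℕ) (D : Set (Cn n)) (v : Cn n → ℝ) : Prop :=
  ContDiffOn ℝ 2 v D ∧ ∀ j : ℕ, 1 ≤ j → j ≤ m → ∀ z ∈ D,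
    0 ≤ topCoeff (wedge (wedgeProd j fun _ => ddcFun v z) (betaPow (n - j) z))

/-- Real-valued `m`-subharmonic functions on `D` (`1 ≤ m ≤ n`): upper semicontinuous, locally
integrable, and the current `ddᶜ u ∧ ddᶜ v₁ ∧ ⋯ ∧ ddᶜ v_(m-1) ∧ β^(n-m)` is positive for all
`m`-subharmonic `C²` functions `v₁, …, v_(m-1)` on `D`. -/
def IsMSubharmonic {n : ℕ} (m : ℕ) (D : Set (Cn n)) (u : Cn n → ℝ) : Prop :=
  UpperSemicontinuousOn u D ∧ LocallyIntegrableOn u D ∧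
    ∀ v : Fin (m - 1) → Cn n → ℝ, (∀ i, IsC2MSubharmonic m D (v i)) →
      ∀ φ : Cn n → ℝ, ContDiff ℝ ∞ φ → HasCompactSupport φ → tsupport φ ⊆ D → (∀ z, 0 ≤ φ z) →
        0 ≤ ∫ z in D, u z * topCoeff
          (wedge (wedge (wedgeProd (m - 1) fun i => ddcFun (v i) z) (betaPow (n - m) z))
            (ddcFun φ z))

/-- The class `sh_m(D) ∩ C(D)`. -/
def IsContMSubharmonic {n : ℕ} (m : ℕ) (D : Set (Cn n)) (u : Cn n → ℝ) : Prop :=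
  IsMSubharmonic m D u ∧ ContinuousOn u D

/-! ### Currents -/

/-- Smooth forms with compact support in `D`. -/
def IsTestForm {n d : ℕ} (D : Set (Cn n)) (ψ : Form n d) : Prop :=
  ContDiff ℝ ∞ ψ ∧ HasCompactSupport ψ ∧ tsupport ψ ⊆ D

/-- Continuous forms with compact support in `D`. -/
def IsContTestForm {n d : ℕ} (D : Set (Cn n)) (ψ : Form n d) : Prop :=
  Continuous ψ ∧ HasCompactSupport ψ ∧ tsupport ψ ⊆ D

/-- `T` is a current of order zero on `D`, acting on forms of degree `d`: a linear functional on
the continuous forms with compact support in `D`, continuous for uniform convergence with supports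
in a fixed compact subset of `D`. (The values of `T` on other forms are irrelevant.) -/
structure IsOrderZeroCurrent {n d : ℕ} (D : Set (Cn n)) (T : Form n d → ℝ) : Prop where
  map_add : ∀ ψ η, IsContTestForm D ψ → IsContTestForm D η → T (ψ + η) = T ψ + T η
  map_smul : ∀ (c : ℝ) ψ, IsContTestForm D ψ → T (c • ψ) = c * T ψ
  bound : ∀ K : Set (Cn n), IsCompact K → K ⊆ D → ∃ C : ℝ, ∀ ψ, IsContTestForm D ψ →
    tsupport ψ ⊆ K → ∀ b : ℝ, (∀ z, ‖ψ z‖ ≤ b) → |T ψ| ≤ C * b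

/-- The real `2`-covector `(i / 2) α ∧ ᾱ = Re α ∧ Im α`, for a complex linear form `α`. -/
def elemPos {n : ℕ} (α : Cn n →ₗ[ℂ] ℂ) : Cn n [⋀^Fin 2]→ₗ[ℝ] ℝ :=
  wedge (AlternatingMap.ofSubsingleton ℝ (Cn n) ℝ (0 : Fin 1) (Complex.reLm ∘ₗ α.restrictScalars ℝ))
    (AlternatingMap.ofSubsingleton ℝ (Cn n) ℝ (0 : Fin 1) (Complex.imLm ∘ₗ α.restrictScalars ℝ))

/-- Positivity of a current acting on forms of degree `2 p`: it is nonnegative on the test forms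
`φ (i/2) α₁ ∧ ᾱ₁ ∧ ⋯ ∧ (i/2) αₚ ∧ ᾱₚ`, for test functions `φ ≥ 0` and complex linear forms `αⱼ`. -/
def IsPositiveCurrent {n p : ℕ} (D : Set (Cn n)) (T : Form n (2 * p) → ℝ) : Prop :=
  ∀ (α : Fin p → Cn n →ₗ[ℂ] ℂ) (φ : Cn n → ℝ) (ψ : Form n (2 * p)), IsTestForm D ψ →
    (∀ z, 0 ≤ φ z) →
    (∀ z, (ψ z).toAlternatingMap = φ z • wedgeProd p fun j => elemPos (α j)) → 0 ≤ T ψ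

/-- `T = ddᶜ v ∧ S`, for a continuous function `v` and a closed current `S` of order zero:
`T` has order zero and `T ψ = S (v ddᶜ ψ)` for all smooth `ψ` with compact support. -/
def IsDdcWedge {n d : ℕ} (D : Set (Cn n)) (v : Cn n → ℝ) (S : Form n (d + 2) → ℝ)
    (T : Form n d → ℝ) : Prop :=
  IsOrderZeroCurrent D T ∧ ∀ ψ, IsTestForm D ψ → T ψ = S fun z => v z • ddc ψ z

/-- `IsHessianCurrent D k u p T`: with `q = k + p`, the functional `T` on forms of degree `2 p` is
the current `ddᶜ u₁ ∧ ⋯ ∧ ddᶜ u_k ∧ β^(n-q)` on `D`, defined recursively: the case `k = 0` is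
integration of `β^(n-q) ∧ ψ`, and the functions are added in the order `u₁, u₂, …, u_k`. -/
def IsHessianCurrent {n : ℕ} (D : Set (Cn n)) : (k : ℕ) → (Fin k → Cn n → ℝ) → (p : ℕ) →
    (Form n (2 * p) → ℝ) → Prop
  | 0, _, p, T => IsOrderZeroCurrent D T ∧ ∀ ψ, IsContTestForm D ψ →
      T ψ = ∫ z in D, topCoeff (wedge (betaPow (n - p) z) (ψ z).toAlternatingMap)
  | k + 1, u, p, T => ∃ S : Form n (2 * (p + 1)) → ℝ,
      IsHessianCurrent D k (Fin.init u) (p + 1) S ∧ IsDdcWedge D (u (Fin.last k)) S T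

/-- `G = du₁ ∧ dᶜu₁ ∧ ddᶜ u₂ ∧ ⋯ ∧ ddᶜ u_(k+1) ∧ β^(n-q)` with `q = k + 1 + p`, as a functional on
test forms of degree `2 p`; here `du ∧ dᶜu ∧ S = (1/2) ddᶜ(u²) ∧ S - u ddᶜ u ∧ S`, where
`S = ddᶜ u₂ ∧ ⋯ ∧ ddᶜ u_(k+1) ∧ β^(n-q)`. -/
def IsGradientHessianCurrent {n : ℕ} (D : Set (Cn n)) (k : ℕ) (u : Fin (k + 1) → Cn n → ℝ)
    (p : ℕ) (G : Form n (2 * p) → ℝ) : Prop :=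
  ∃ (S : Form n (2 * (p + 1)) → ℝ) (T : Form n (2 * p) → ℝ),
    IsHessianCurrent D k (Fin.tail u) (p + 1) S ∧ IsDdcWedge D (u 0) S T ∧
    ∀ ψ, IsTestForm D ψ →
      G ψ = (1 / 2) * S (fun z => (u 0 z) ^ 2 • ddc ψ z) - T (fun z => u 0 z • ψ z)

/-- `μ` is (on the Borel subsets of `D`) the Radon measure on `D` given by the top degree current
`ddᶜ u₁ ∧ ⋯ ∧ ddᶜ u_k ∧ β^(n-k)`. -/
def IsHessianMeasure {n : ℕ} (D : Set (Cn n)) (k : ℕ) (u : Fin k → Cn n → ℝ)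
    (μ : Measure (Cn n)) : Prop :=
  (∀ K : Set (Cn n), IsCompact K → K ⊆ D → μ K < ⊤) ∧
  ∃ T : Form n (2 * 0) → ℝ, IsHessianCurrent D k u 0 T ∧
    ∀ φ : Cn n → ℝ, Continuous φ → HasCompactSupport φ → tsupport φ ⊆ D →
      T (zeroForm φ) = ∫ z, φ z ∂μ

/-- The class `L_M` of continuous `m`-subharmonic functions on `D` with `|u| ≤ M`. -/
def IsBoundedContMSubharmonic {n : ℕ} (m : ℕ) (D : Set (Cn n)) (M : ℝ) (u : Cn n → ℝ) : Prop :=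
  IsContMSubharmonic m D u ∧ ∀ z ∈ D, |u z| ≤ M

end HessianCurrents

end

noncomputable section

namespace HessianCurrents

/-! ### Polynomials without roots in the upper half plane -/

section RootHomotopy

open Polynomial

/-! Everything rests on one algebraic fact. If the (1,1)-forms `a₁, …, a_k` lie in the cone `gam n
m` of `m`-positive forms and `k ≤ m`, then `a₁ ∧ ⋯ ∧ a_k ∧ β^(n-k) ≥ 0`. Elements of even degree are
central in the exterior algebra, so powers of (1,1)-forms live in a commutative ring. There the top
coefficient of `x ^ n` is a positive multiple of the product of the eigenvalues of `x`. This
polynomial is hyperbolic in the direction `β`, and so are its derivatives `x ↦ τ(x^m β^(n-m))`.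
Gårding's inequality (`prod_pos_of_mem_hyperbolicityCone`, `mixed_nonneg`) gives the positivity. The
cone is also cut out by the linear inequalities `τ(c^(m-1) β^(n-m) a) ≥ 0` with `c` in the cone
(`mem_closedCone_of_dual`).

Every constant form `c` in the cone is `ddᶜ` of a quadratic function, so quadratic competitors in
the definition of `m`-sh, together with this duality, show that mollifications of a continuous
`m`-sh function have Hessians in the cone (`exists_smooth_approx`). Continuous potentials are thus
local uniform limits of smooth ones.

For smooth potentials, `ddᶜ` moves freely between factors under the integral (`integral_hess_symm`).
Moving it onto a cutoff function bounds the masses by induction on the number of factors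
(`exists_mass_le`, Chern–Levine–Nirenberg). The mass controls all coefficients: the forms are
invariant under `z ↦ e^{iθ} z`, and polarisation then reduces general covectors to elementary
positive ones (`exists_bound_words`). Uniform bounds and convergence on smooth test forms yield
currents of order zero, and any current satisfying the recursive definition is the limit of the
smooth ones (`hessianCurrent_exists_and_tendsto`). Positivity and weak bounds pass to the limit. The
gradient current is the limit of `dw ∧ dᶜw ∧ ⋯`, in which `dw ∧ dᶜw` is an elementary positive form
up to a factor.

For the integral inequality, put `f = χ(r - |z|²)` with `χ` convex and nondecreasing. Then `∫ f ddᶜw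
∧ S = ∫ (w - c) ddᶜf ∧ S`, and `ddᶜf` is `-χ' β` plus a positive form. For `w ≤ c` only the first
term can contribute positively, and it is at most `sup (c - w) ∫ χ' β ∧ S` (`integral_cutoff_le`).
Letting `χ(s)` tend to `max(s, 0)` and using Tonelli for `∫₀^r μ{|z|² ≤ t} dt` gives the theorem. -/

lemma im_pow_card_le_norm_prod {u : ℂ} (hu : 0 ≤ u.im) (s : Multiset ℂ) (hs : ∀ r ∈ s, r.im < 0) :
    u.im ^ s.card ≤ ‖(s.map (u - ·)).prod‖ := by
  induction s using Multiset.induction_on with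
  | empty => simp
  | cons r s ih =>
    have h1 : u.im ≤ ‖u - r‖ := by
      have h2 := Complex.abs_im_le_norm (u - r)
      have h3 := hs r (Multiset.mem_cons_self r s)
      rw [Complex.sub_im] at h2
      have := le_abs_self (u.im - r.im)
      linarith
    have h4 := ih fun q hq => hs q (Multiset.mem_cons_of_mem hq)
    simp only [Multiset.card_cons, Multiset.map_cons, Multiset.prod_cons, norm_mul, pow_succ]
    rw [mul_comm]
    exact mul_le_mul h1 h4 (pow_nonneg hu _) (norm_nonneg _)

/-- Along a continuous family of polynomials with constant leading coefficient and without real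
roots, the roots cannot leave the lower half plane. -/
theorem im_neg_of_root_homotopy (Q : ℝ → ℂ[X]) (d : ℕ) (k : ℂ) (hk : k ≠ 0)
    (hdeg : ∀ β, (Q β).natDegree ≤ d) (hlead : ∀ β, (Q β).coeff d = k)
    (hcont : ∀ j, Continuous fun β => (Q β).coeff j)
    (hreal : ∀ β ∈ Icc (0 : ℝ) 1, ∀ u : ℝ, (Q β).eval (u : ℂ) ≠ 0)
    (h0 : ∀ u, (Q 0).eval u = 0 → u.im < 0) (u : ℂ) (hu : (Q 1).eval u = 0) : u.im < 0 := by
  have hnat : ∀ β, (Q β).natDegree = d := fun β =>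
    le_antisymm (hdeg β) (le_natDegree_of_ne_zero (by rw [hlead]; exact hk))
  have hlc : ∀ β, (Q β).leadingCoeff = k := fun β => by
    rw [leadingCoeff, hnat, hlead]
  have heval : Continuous fun q : ℝ × ℂ => (Q q.1).eval q.2 := by
    have : (fun q : ℝ × ℂ => (Q q.1).eval q.2) =
        fun q => ∑ j ∈ Finset.range (d + 1), (Q q.1).coeff j * q.2 ^ j := by
      funext q
      rw [eval_eq_sum_range, hnat]
    rw [this]
    exact continuous_finsetSum _ fun j _ => ((hcont j).comp continuous_fst).mul
      (continuous_snd.pow j)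
  -- Having all roots in the open lower half plane is not visibly closed in `β`. This lower bound is
  -- closed and, by `im_pow_card_le_norm_prod`, follows from it. The competing condition, a root in
  -- the closed upper half plane, is closed by compactness of the set of roots.
  set t : Set ℝ := {β | ∀ u : ℂ, 0 ≤ u.im → ‖k‖ * u.im ^ d ≤ ‖(Q β).eval u‖} with ht
  have htc : IsClosed t := by
    have : t = ⋂ (u : ℂ) (_ : 0 ≤ u.im), {β | ‖k‖ * u.im ^ d ≤ ‖(Q β).eval u‖} := by
      ext β; simp [ht]
    rw [this]
    refine isClosed_iInter fun u => isClosed_iInter fun _ => isClosed_le continuous_const ?_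
    exact (heval.comp (continuous_id.prodMk continuous_const)).norm
  -- Cauchy's root bound is uniform in `β` because the leading coefficient is constant.
  obtain ⟨B, hB⟩ : ∃ B : ℝ, ∀ β ∈ Icc (0 : ℝ) 1, ∀ u, (Q β).eval u = 0 → ‖u‖ ≤ B := by
    obtain ⟨A, hA⟩ := (isCompact_Icc (a := (0 : ℝ)) (b := 1)).exists_bound_of_continuousOn
      (f := fun β => ∑ j ∈ Finset.range d, ‖(Q β).coeff j‖)
      (continuous_finsetSum _ fun j _ => (hcont j).norm).continuousOn
    refine ⟨A / ‖k‖ + 1, fun β hβ u hu => ?_⟩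
    have hQ : Q β ≠ 0 := fun h => hk (by rw [← hlead β, h, coeff_zero])
    have h1 := (IsRoot.norm_lt_cauchyBound (p := Q β) (a := u) hQ hu).le
    have hA' := hA β hβ
    have hA0 : ∀ j < d, ‖(Q β).coeff j‖ ≤ A := fun j hj => by
      refine le_trans ?_ ((le_abs_self _).trans hA')
      exact Finset.single_le_sum (f := fun j => ‖(Q β).coeff j‖) (fun _ _ => norm_nonneg _)
        (Finset.mem_range.2 hj)
    have hAn : 0 ≤ A := (norm_nonneg _).trans hA'
    have h4 : Finset.sup (Finset.range d) (fun x => ‖(Q β).coeff x‖₊) ≤ ⟨A, hAn⟩ := by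
      refine Finset.sup_le fun j hj => ?_
      exact_mod_cast hA0 j (Finset.mem_range.1 hj)
    have h5 : ((Finset.sup (Finset.range d) (fun x => ‖(Q β).coeff x‖₊) : NNReal) : ℝ) ≤ A := h4
    refine (show ‖u‖ ≤ ((cauchyBound (Q β) : NNReal) : ℝ) from h1).trans ?_
    rw [cauchyBound, hlc, hnat]
    push_cast
    have h6 := div_le_div_of_nonneg_right h5 (norm_nonneg k)
    simpa using h6
  set t' : Set ℝ := Prod.fst '' ({q : ℝ × ℂ | (Q q.1).eval q.2 = 0 ∧ 0 ≤ q.2.im} ∩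
    (Icc (0 : ℝ) 1 ×ˢ closedBall (0 : ℂ) B)) with ht'
  have ht'c : IsClosed t' := by
    refine IsCompact.isClosed (IsCompact.image ?_ continuous_fst)
    refine IsCompact.inter_left (isCompact_Icc.prod (isCompact_closedBall _ _)) ?_
    exact (isClosed_eq heval continuous_const).inter
      (isClosed_le continuous_const (Complex.continuous_im.comp continuous_snd))
  by_contra hneg
  push Not at hneg
  have hcov : Icc (0 : ℝ) 1 ⊆ t ∪ t' := by
    intro β hβ
    by_cases h : ∃ u, (Q β).eval u = 0 ∧ 0 ≤ u.im
    · obtain ⟨v, hv, hv'⟩ := h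
      exact Or.inr ⟨(β, v), ⟨⟨hv, hv'⟩, hβ, by simpa using hB β hβ v hv⟩, rfl⟩
    · push Not at h
      refine Or.inl fun v hv => ?_
      have hs := IsAlgClosed.splits (Q β)
      have hQ : Q β ≠ 0 := fun h => hk (by rw [← hlead β, h, coeff_zero])
      rw [hs.eval_eq_prod_roots, hlc, norm_mul]
      have := im_pow_card_le_norm_prod hv (Q β).roots fun r hr => h r ((mem_roots hQ).1 hr)
      rw [← hs.natDegree_eq_card_roots, hnat] at this
      gcongr
  have h0' : (0 : ℝ) ∈ t := by
    rcases hcov (by simp : (0 : ℝ) ∈ Icc (0 : ℝ) 1) with h | ⟨q, ⟨⟨hq1, hq2⟩, _⟩, hq4⟩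
    · exact h
    · rw [hq4] at hq1
      exact absurd (h0 _ hq1) (not_lt.2 hq2)
  have h1' : (1 : ℝ) ∈ t' :=
    ⟨(1, u), ⟨⟨hu, hneg⟩, by simp, by simpa using hB 1 (by simp) u hu⟩, rfl⟩
  -- By connectedness the two closed sets meet. There a root with `Im ≥ 0` satisfies `‖k‖ (Im)^d ≤
  -- 0`, so it is real, which `hreal` forbids.
  obtain ⟨β, hβ, hβt, ⟨q, ⟨⟨hq1, hq2⟩, hq3⟩, hq4⟩⟩ :=
    isPreconnected_closed_iff.1 (isPreconnected_Icc (a := (0 : ℝ)) (b := 1)) t t' htc ht'c hcov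
      ⟨0, by simp, h0'⟩ ⟨1, by simp, h1'⟩
  rw [hq4] at hq1
  have h2 := hβt q.2 hq2
  rw [hq1, norm_zero] at h2
  have hk' : 0 < ‖k‖ := norm_pos_iff.2 hk
  have h3 : q.2.im ^ d ≤ 0 := by
    by_contra h
    push Not at h
    nlinarith [mul_pos hk' h]
  have h4 : q.2.im = 0 := by
    by_contra h
    exact absurd (pow_pos (lt_of_le_of_ne hq2 (Ne.symm h)) d) (not_lt.2 h3)
  refine hreal β hβ q.2.re ?_
  have : ((q.2.re : ℝ) : ℂ) = q.2 := Complex.ext (by simp) (by simp [h4])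
  rw [this, hq1]

end RootHomotopy

/-! ### Polynomials along lines -/

section LinePoly

open Polynomial

variable {k K : Type*} [Field k] [CommRing K] [Algebra k K]

/-- The polynomial `u ↦ G ((y + u c) ^ d)`. -/
def linePoly (G : K →ₗ[k] k) (d : ℕ) (y c : K) : k[X] :=
  ∑ j ∈ Finset.range (d + 1), C (G (y ^ (d - j) * c ^ j) * d.choose j) * X ^ j

lemma eval_linePoly (G : K →ₗ[k] k) (d : ℕ) (y c : K) (u : k) :
    (linePoly G d y c).eval u = G ((y + u • c) ^ d) := by
  rw [add_comm y, add_pow, map_sum, linePoly, eval_finsetSum]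
  refine Finset.sum_congr rfl fun j _ => ?_
  have : (u • c) ^ j * y ^ (d - j) * ((d.choose j : ℕ) : K) =
      (u ^ j * (d.choose j : k)) • (y ^ (d - j) * c ^ j) := by
    rw [_root_.smul_pow, mul_smul, Nat.cast_smul_eq_nsmul, nsmul_eq_mul]
    simp only [smul_mul_assoc]
    congr 1
    ring
  rw [this, map_smul, smul_eq_mul, eval_mul, eval_C, eval_pow, eval_X]
  ring

lemma coeff_linePoly (G : K →ₗ[k] k) (d : ℕ) (y c : K) (j : ℕ) :
    (linePoly G d y c).coeff j = G (y ^ (d - j) * c ^ j) * d.choose j := by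
  rw [linePoly, finsetSum_coeff]
  simp only [coeff_C_mul_X_pow]
  rw [Finset.sum_ite_eq]
  split_ifs with h
  · rfl
  · rw [Nat.choose_eq_zero_of_lt (by simpa using h)]
    simp

lemma natDegree_linePoly_le (G : K →ₗ[k] k) (d : ℕ) (y c : K) :
    (linePoly G d y c).natDegree ≤ d := by
  rw [natDegree_le_iff_coeff_eq_zero]
  intro j hj
  rw [coeff_linePoly, Nat.choose_eq_zero_of_lt hj]
  simp

/-- The class of polynomials `x ↦ G (x ^ d)` is stable under directional derivatives: only the
functional changes. Gårding's induction can therefore run over functionals. -/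
lemma derivative_linePoly (G : K →ₗ[k] k) (d : ℕ) (y c : K) :
    derivative (linePoly G (d + 1) y c) =
      ((d : k) + 1) • linePoly (G ∘ₗ LinearMap.mulRight k c) d y c := by
  ext j
  rw [coeff_derivative, coeff_linePoly, coeff_smul, coeff_linePoly, LinearMap.comp_apply,
    LinearMap.mulRight_apply]
  have h := Nat.add_one_mul_choose_eq d j
  have h' : ((d : k) + 1) * (d.choose j : k) = ((d + 1).choose (j + 1) : k) * ((j : k) + 1) := by
    exact_mod_cast congrArg (Nat.cast : ℕ → k) h
  have h2 : d + 1 - (j + 1) = d - j := by omega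
  rw [h2, smul_eq_mul, pow_succ, mul_assoc (G _), ← h', mul_assoc (y ^ (d - j))]
  ring

end LinePoly

/-! ### Gårding's theory of hyperbolic polynomials

For a commutative algebra `E`, we consider the homogeneous polynomials `x ↦ F (x ^ d)`, where `F`
is a linear functional on `E`. -/

section Hyperbolic

open Polynomial TensorProduct

variable {E : Type*} [CommRing E] [Algebra ℝ E]

/-- The complex linear extension of a real linear functional. -/
def complexify (F : E →ₗ[ℝ] ℝ) : ℂ ⊗[ℝ] E →ₗ[ℂ] ℂ :=
  (AlgebraTensorModule.rid ℝ ℂ ℂ).toLinearMap ∘ₗ F.baseChange ℂ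

/-- The inclusion of `E` into its complexification. -/
def toComplexification : E →ₐ[ℝ] ℂ ⊗[ℝ] E := Algebra.TensorProduct.includeRight

local notation "ι'" => toComplexification

lemma complexify_coe (F : E →ₗ[ℝ] ℝ) (x : E) : complexify F (ι' x) = (F x : ℂ) := by
  simp [complexify, toComplexification]

lemma complexify_mulRight (F : E →ₗ[ℝ] ℝ) (a : E) (y : ℂ ⊗[ℝ] E) :
    complexify (F ∘ₗ LinearMap.mulRight ℝ a) y = complexify F (y * ι' a) := by
  induction y using TensorProduct.induction_on with
  | zero => simp
  | tmul z x => simp [complexify, toComplexification]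
  | add x y hx hy => rw [map_add, hx, hy, add_mul, map_add]

lemma ofReal_smul_complexification (r : ℝ) (y : ℂ ⊗[ℝ] E) : (r : ℂ) • y = r • y := by
  rw [← algebraMap_smul ℂ r y]; rfl

lemma complexify_line (F : E →ₗ[ℝ] ℝ) (d : ℕ) (x a : E) (t : ℂ) :
    complexify F ((ι' x + t • ι' a) ^ d) = aeval t (linePoly F d x a) := by
  rw [← eval_linePoly, aeval_eq_sum_range' (Nat.lt_succ_of_le (natDegree_linePoly_le F d x a)),
    eval_eq_sum_range' (Nat.lt_succ_of_le (natDegree_linePoly_le _ d _ _))]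
  refine Finset.sum_congr rfl fun j _ => ?_
  rw [coeff_linePoly, coeff_linePoly, ← map_pow, ← map_pow, ← map_mul, complexify_coe]
  simp

variable (b : E) (H : Submodule ℝ E)

/-- The polynomial `x ↦ F (x ^ d)` on `H` is hyperbolic in the direction `b`. -/
def IsHyperbolic (d : ℕ) (F : E →ₗ[ℝ] ℝ) : Prop :=
  0 < F (b ^ d) ∧ ∀ x ∈ H, ∀ t : ℂ, complexify F ((ι' x + t • ι' b) ^ d) = 0 → t.im = 0

/-- The hyperbolicity cone of `x ↦ F (x ^ d)`. -/
def hyperbolicityCone (d : ℕ) (F : E →ₗ[ℝ] ℝ) : Set E :=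
  {a | a ∈ H ∧ ∀ t : ℝ, 0 ≤ t → 0 < F ((a + t • b) ^ d)}

variable {b H} {d : ℕ} {F : E →ₗ[ℝ] ℝ}

lemma self_mem_hyperbolicityCone (hb : b ∈ H) (hF : IsHyperbolic b H d F) :
    b ∈ hyperbolicityCone b H d F := by
  refine ⟨hb, fun t ht => ?_⟩
  have : b + t • b = (1 + t) • b := by rw [add_smul, one_smul]
  rw [this, _root_.smul_pow, map_smul, smul_eq_mul]
  exact mul_pos (pow_pos (by linarith) d) hF.1

lemma add_smul_mem_hyperbolicityCone (hb : b ∈ H) {a : E} (ha : a ∈ hyperbolicityCone b H d F)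
    {s : ℝ} (hs : 0 ≤ s) : a + s • b ∈ hyperbolicityCone b H d F := by
  refine ⟨H.add_mem ha.1 (H.smul_mem s hb), fun t ht => ?_⟩
  rw [add_assoc, ← add_smul]
  exact ha.2 _ (add_nonneg hs ht)

lemma pos_of_mem_hyperbolicityCone {a : E} (ha : a ∈ hyperbolicityCone b H d F) :
    0 < F (a ^ d) := by
  simpa using ha.2 0 le_rfl

/-- Openness of the cone towards `-b`: small parameters are handled by continuity at `0`, the others
by membership of `a`. -/
lemma exists_sub_smul_mem_hyperbolicityCone (hb : b ∈ H) {a : E}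
    (ha : a ∈ hyperbolicityCone b H d F) :
    ∃ δ : ℝ, 0 < δ ∧ a - δ • b ∈ hyperbolicityCone b H d F := by
  have hc : Continuous fun t : ℝ => F ((a + t • b) ^ d) := by
    simp only [← eval_linePoly]
    exact (linePoly F d a b).continuous
  have h0 : ∀ᶠ t in nhds (0 : ℝ), 0 < F ((a + t • b) ^ d) :=
    hc.continuousAt.eventually (lt_mem_nhds (by simpa using ha.2 0 le_rfl))
  obtain ⟨ε, hε, hε'⟩ := Metric.eventually_nhds_iff.1 h0
  refine ⟨ε / 2, by positivity, H.sub_mem ha.1 (H.smul_mem _ hb), fun t ht => ?_⟩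
  have heq : a - (ε / 2) • b + t • b = a + (t - ε / 2) • b := by rw [sub_smul]; abel
  rw [heq]
  by_cases h : 0 ≤ t - ε / 2
  · exact ha.2 _ h
  · refine hε' ?_
    rw [Real.dist_eq, sub_zero, abs_lt]
    constructor <;> linarith

/-- By homogeneity, division by `u` turns the root into a root `t = iα/u` on the line `a + t b`.
Hyperbolicity makes `t` real, the cone makes it negative, and `u t = iα` fixes the sign of `Im u`.
-/
lemma im_neg_of_root_of_mem_cone (hF : IsHyperbolic b H d F) {a : E}
    (ha : a ∈ hyperbolicityCone b H d F) {α : ℝ} (hα : 0 < α) {u : ℂ}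
    (hu : complexify F ((u • ι' a + (α * Complex.I) • ι' b) ^ d) = 0) : u.im < 0 := by
  have hα' : (α : ℂ) ≠ 0 := by exact_mod_cast hα.ne'
  by_cases hu0 : u = 0
  · exfalso
    rw [hu0, zero_smul, zero_add, _root_.smul_pow, map_smul, ← map_pow, complexify_coe, smul_eq_mul] at hu
    have h1 : ((F (b ^ d) : ℝ) : ℂ) ≠ 0 := by exact_mod_cast hF.1.ne'
    exact mul_ne_zero (pow_ne_zero _ (mul_ne_zero hα' Complex.I_ne_zero)) h1 hu
  · have h1 : u • ι' a + (α * Complex.I) • ι' b = u • (ι' a + (α * Complex.I / u) • ι' b) := by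
      rw [smul_add, smul_smul, mul_div_cancel₀ _ hu0]
    rw [h1, _root_.smul_pow, map_smul, smul_eq_mul] at hu
    have h2 := (mul_eq_zero.1 hu).resolve_left (pow_ne_zero _ hu0)
    have h3 := hF.2 a ha.1 _ h2
    set t := α * Complex.I / u with ht
    have h4 : t = (t.re : ℂ) := Complex.ext (by simp) (by simp [h3])
    rw [h4, ofReal_smul_complexification, ← map_smul, ← map_add, ← map_pow, complexify_coe] at h2
    have h5 : t.re < 0 := by
      by_contra h
      push Not at h
      exact (ha.2 _ h).ne' (by exact_mod_cast h2)
    have h6 : u * t = α * Complex.I := by rw [ht, mul_div_cancel₀ _ hu0]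
    rw [h4] at h6
    have h7 := congrArg Complex.im h6
    simp only [Complex.mul_im, Complex.ofReal_re, Complex.I_im,
      Complex.ofReal_im, Complex.I_re, mul_one, mul_zero, add_zero] at h7
    nlinarith

/-- The perturbation `y` is switched on as `β y`. At `β = 0` the roots are located by
`im_neg_of_root_of_mem_cone`, and the top coefficient in `u` stays `F (a ^ d)` throughout. -/
lemma im_neg_of_root_of_homotopy (hF : IsHyperbolic b H d F) {a : E}
    (ha : a ∈ hyperbolicityCone b H d F) {α : ℝ} (hα : 0 < α) (y : ℂ ⊗[ℝ] E)
    (hy : ∀ β ∈ Icc (0 : ℝ) 1, ∀ u : ℝ,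
      complexify F (((β : ℂ) • y + (u : ℂ) • ι' a + (α * Complex.I) • ι' b) ^ d) ≠ 0) {u : ℂ}
    (hu : complexify F ((y + u • ι' a + (α * Complex.I) • ι' b) ^ d) = 0) : u.im < 0 := by
  refine im_neg_of_root_homotopy
    (fun β => linePoly (complexify F) d ((α * Complex.I) • ι' b + (β : ℂ) • y) (ι' a)) d
    (F (a ^ d)) (by exact_mod_cast (pos_of_mem_hyperbolicityCone ha).ne')
    (fun β => natDegree_linePoly_le _ _ _ _) (fun β => ?_) (fun j => ?_) (fun β hβ v => ?_)
    (fun v hv => ?_) u ?_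
  · rw [coeff_linePoly, Nat.sub_self, pow_zero, one_mul, ← map_pow, complexify_coe,
      Nat.choose_self, Nat.cast_one, mul_one]
  · have : (fun β : ℝ => (linePoly (complexify F) d ((α * Complex.I) • ι' b + (β : ℂ) • y)
        (ι' a)).coeff j) = fun β : ℝ => (linePoly (complexify F ∘ₗ
          LinearMap.mulRight ℂ (ι' a ^ j)) (d - j) ((α * Complex.I) • ι' b) y).eval (β : ℂ) *
          d.choose j := by
      funext β
      rw [coeff_linePoly, eval_linePoly]
      rfl
    rw [this]
    exact ((Polynomial.continuous _).comp Complex.continuous_ofReal).mul continuous_const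
  · rw [eval_linePoly]
    convert hy β hβ v using 3
    ring
  · rw [eval_linePoly] at hv
    refine im_neg_of_root_of_mem_cone hF ha hα (u := v) ?_
    convert hv using 3
    simp [add_comm]
  · rw [eval_linePoly, ← hu]
    congr 2
    simp only [Complex.ofReal_one, one_smul]
    ring

/-- The real part of `t` is absorbed into `x`. A real root met during the homotopy would make `i Im
t` a root along a real line in direction `b`, against hyperbolicity. -/
lemma stable_one (hb : b ∈ H) (hF : IsHyperbolic b H d F) {a x : E}
    (ha : a ∈ hyperbolicityCone b H d F)
    (hx : x ∈ H) {s t : ℂ} (hs : 0 ≤ s.im) (ht : 0 < t.im) :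
    complexify F ((ι' x + s • ι' a + t • ι' b) ^ d) ≠ 0 := by
  intro h
  refine absurd (im_neg_of_root_of_homotopy hF ha ht (ι' (x + t.re • b)) (fun β _ v h' => ?_)
    (u := s) ?_) (not_lt.2 hs)
  · have h1 := hF.2 (β • (x + t.re • b) + v • a) (H.add_mem (H.smul_mem _ (H.add_mem hx
      (H.smul_mem _ hb))) (H.smul_mem _ ha.1)) (t.im * Complex.I) (by
        rw [← h', map_add, map_smul, map_smul, ofReal_smul_complexification,
          ofReal_smul_complexification])
    simp at h1
    exact ht.ne' h1
  · rw [← h]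
    congr 2
    conv_rhs => rw [← Complex.re_add_im t, add_smul, ofReal_smul_complexification]
    rw [map_add, map_smul]
    ring

/-- The same homotopy, now in the coefficient of `c`; real roots along the way are excluded by
`stable_one`, applied with the coefficient `β s` of `a`. -/
lemma stable_two (hb : b ∈ H) (hF : IsHyperbolic b H d F) {a c : E}
    (ha : a ∈ hyperbolicityCone b H d F)
    (hc : c ∈ hyperbolicityCone b H d F) {s u t : ℂ} (hs : 0 ≤ s.im) (hu : 0 ≤ u.im)
    (ht : 0 < t.im) :
    complexify F ((s • ι' a + u • ι' c + t • ι' b) ^ d) ≠ 0 := by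
  intro h
  refine absurd (im_neg_of_root_of_homotopy hF hc ht (ι' (t.re • b) + s • ι' a)
    (fun β hβ v h' => ?_) (u := u) ?_) (not_lt.2 hu)
  · refine stable_one hb hF ha (H.add_mem (H.smul_mem β (H.smul_mem t.re hb)) (H.smul_mem v hc.1))
      (s := β * s) (t := t.im * Complex.I) ?_ (by simpa using ht) ?_
    · rw [Complex.im_ofReal_mul]
      exact mul_nonneg hβ.1 hs
    · rw [← h']
      congr 2
      rw [map_add, map_smul ι' β, map_smul ι' v, smul_add, smul_smul,
        ofReal_smul_complexification, ofReal_smul_complexification]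
      ring
  · rw [← h]
    congr 2
    conv_rhs => rw [← Complex.re_add_im t, add_smul, ofReal_smul_complexification]
    rw [map_smul]
    ring

lemma natDegree_linePoly_of_ne (G : ℂ ⊗[ℝ] E →ₗ[ℂ] ℂ) (y c : ℂ ⊗[ℝ] E) (h : G (c ^ d) ≠ 0) :
    (linePoly G d y c).natDegree = d := by
  refine le_antisymm (natDegree_linePoly_le _ _ _ _) (le_natDegree_of_ne_zero ?_)
  rw [coeff_linePoly]
  simpa using h

/-- The logarithmic derivative at `0` of a polynomial all of whose roots are sent to a "positive"
half space by `r ↦ 1 / (0 - r)`. -/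
lemma logDeriv_linePoly_pos {F : E →ₗ[ℝ] ℝ} {a : E} (y : ℂ ⊗[ℝ] E) (ha : F (a ^ (d + 1)) ≠ 0)
    (h0 : complexify F (y ^ (d + 1)) ≠ 0) (L : ℂ →ₗ[ℝ] ℝ)
    (hL : ∀ r, complexify F ((y + r • ι' a) ^ (d + 1)) = 0 → 0 < L (1 / (0 - r))) :
    0 < L (((d : ℂ) + 1) * complexify F (y ^ d * ι' a) / complexify F (y ^ (d + 1))) := by
  set P := linePoly (complexify F) (d + 1) y (ι' a) with hP
  have hdeg : P.natDegree = d + 1 := natDegree_linePoly_of_ne _ _ _ (by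
    rw [← map_pow, complexify_coe]; exact_mod_cast ha)
  have hP0 : P.eval 0 = complexify F (y ^ (d + 1)) := by
    rw [hP, eval_linePoly, zero_smul, add_zero]
  have hP1 : P.derivative.eval 0 = ((d : ℂ) + 1) * complexify F (y ^ d * ι' a) := by
    rw [hP, derivative_linePoly, eval_smul, eval_linePoly, zero_smul, add_zero, smul_eq_mul]
    rfl
  have hs := IsAlgClosed.splits P
  have hne : P ≠ 0 := by
    intro h
    rw [h] at hdeg
    simp at hdeg
  have h1 := hs.eval_derivative_div_eval_of_ne_zero (x := 0) (by rw [hP0]; exact h0)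
  rw [hP0, hP1] at h1
  rw [h1, map_multiset_sum, Multiset.map_map]
  have hcard : P.roots.card = d + 1 := by rw [← hs.natDegree_eq_card_roots, hdeg]
  have hpos : ∀ s : Multiset ℂ, s ≠ 0 → (∀ r ∈ s, 0 < L (1 / (0 - r))) →
      0 < (s.map (L ∘ fun r => 1 / (0 - r))).sum := by
    intro s
    induction s using Multiset.induction_on with
    | empty => simp
    | cons r s ih =>
      intro _ h
      rw [Multiset.map_cons, Multiset.sum_cons]
      have h2 := h r (Multiset.mem_cons_self r s)
      by_cases hs0 : s = 0
      · simpa [hs0] using h2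
      · exact add_pos h2 (ih hs0 fun q hq => h q (Multiset.mem_cons_of_mem hq))
  refine hpos _ (fun h => by simp [h] at hcard) fun r hr => hL r ?_
  have := (mem_roots hne).1 hr
  rwa [IsRoot, hP, eval_linePoly] at this

/-- Hyperbolicity in the direction `b` is transferred to every direction `a` of the cone. A root off
the negative axis can be multiplied by a complex number so as to contradict `stable_two`. -/
lemma root_neg_of_mem_cone (hb : b ∈ H) (hF : IsHyperbolic b H d F) {a c : E}
    (ha : a ∈ hyperbolicityCone b H d F) (hc : c ∈ hyperbolicityCone b H d F) {s : ℂ}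
    (hs : complexify F ((ι' c + s • ι' a) ^ d) = 0) : s.im = 0 ∧ s.re < 0 := by
  have hs0 : s ≠ 0 := by
    rintro rfl
    rw [zero_smul, add_zero, ← map_pow, complexify_coe] at hs
    exact (pos_of_mem_hyperbolicityCone hc).ne' (by exact_mod_cast hs)
  by_cases hneg : s.re + ‖s‖ ≤ 0
  · have h1 : s.re ^ 2 + s.im ^ 2 = ‖s‖ ^ 2 := by
      rw [← Complex.normSq_eq_norm_sq, Complex.normSq_apply]; ring
    have h2 := norm_pos_iff.2 hs0
    refine ⟨?_, by linarith⟩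
    have : s.im ^ 2 ≤ 0 := by nlinarith
    nlinarith [sq_nonneg s.im]
  · exfalso
    push Not at hneg
    obtain ⟨δ, hδ, hcδ⟩ := exists_sub_smul_mem_hyperbolicityCone hb hc
    -- For `s` off the closed negative axis this factor puts both `z` and `z s` in the open upper
    -- half plane. Splitting `c = (c - δ b) + δ b` supplies the coefficient of `b` required by
    -- `stable_two`.
    set z : ℂ := Complex.I * ((‖s‖ : ℂ) + (starRingEnd ℂ) s) with hz
    have hz1 : 0 < z.im := by
      simp [hz]; linarith
    have hz2 : 0 < (z * s).im := by
      have h2 := norm_pos_iff.2 hs0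
      have h1 : s.re ^ 2 + s.im ^ 2 = ‖s‖ ^ 2 := by
        rw [← Complex.normSq_eq_norm_sq, Complex.normSq_apply]; ring
      have : (z * s).im = ‖s‖ * (s.re + ‖s‖) := by
        simp [hz, Complex.mul_im]
        nlinarith
      rw [this]
      positivity
    refine stable_two hb hF ha hcδ hz2.le hz1.le (t := z * δ) ?_ ?_
    · rw [Complex.im_mul_ofReal]; positivity
    · have : (z * s) • ι' a + z • ι' (c - δ • b) + (z * δ) • ι' b = z • (ι' c + s • ι' a) := by
        rw [map_sub, map_smul, mul_smul z s, mul_smul z (δ : ℂ), ofReal_smul_complexification,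
          ← smul_add, ← smul_add]
        congr 1
        abel
      rw [this, _root_.smul_pow, map_smul, hs, smul_zero]

/-- Up to the factor `d + 1`, the quotient `F (c ^ d * a) / F (c ^ (d + 1))` is the logarithmic
derivative at `0` of `s ↦ F ((c + s a) ^ (d + 1))`. All roots of that polynomial are negative, so
every summand `1 / (0 - r)` is positive. -/
theorem pos_pow_mul_of_mem_cone (hb : b ∈ H) (hF : IsHyperbolic b H (d + 1) F) {a c : E}
    (ha : a ∈ hyperbolicityCone b H (d + 1) F) (hc : c ∈ hyperbolicityCone b H (d + 1) F) :
    0 < F (c ^ d * a) := by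
  have hc0 := pos_of_mem_hyperbolicityCone hc
  have h := logDeriv_linePoly_pos (F := F) (a := a) (ι' c) (pos_of_mem_hyperbolicityCone ha).ne'
    (by rw [← map_pow, complexify_coe]; exact_mod_cast hc0.ne') Complex.reLm (fun r hr => ?_)
  · rw [← map_pow, ← map_mul, complexify_coe, ← map_pow, complexify_coe] at h
    have h2 : ((d : ℂ) + 1) * ((F (c ^ d * a) : ℝ) : ℂ) / ((F (c ^ (d + 1)) : ℝ) : ℂ) =
        ((((d : ℝ) + 1) * F (c ^ d * a) / F (c ^ (d + 1)) : ℝ) : ℂ) := by push_cast; ring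
    rw [h2] at h
    have h3 : 0 < ((d : ℝ) + 1) * F (c ^ d * a) / F (c ^ (d + 1)) := h
    have h4 := (div_pos_iff_of_pos_right hc0).1 h3
    exact pos_of_mul_pos_right h4 (by positivity)
  · obtain ⟨h1, h2⟩ := root_neg_of_mem_cone hb hF ha hc hr
    have h3 : r = (r.re : ℂ) := Complex.ext (by simp) (by simp [h1])
    rw [h3]
    have h4 : (1 / (0 - (r.re : ℂ)) : ℂ) = ((1 / (-r.re) : ℝ) : ℂ) := by push_cast; ring
    rw [h4]
    change 0 < (1 / (-r.re) : ℝ)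
    exact one_div_pos.2 (by linarith)

/-- The polynomial along a line has real coefficients, so its roots come in conjugate pairs and one
half plane suffices. -/
lemma isHyperbolic_of_im_pos (h0 : 0 < F (b ^ d))
    (h : ∀ x ∈ H, ∀ t : ℂ, 0 < t.im → complexify F ((ι' x + t • ι' b) ^ d) ≠ 0) :
    IsHyperbolic b H d F := by
  refine ⟨h0, fun x hx t ht => ?_⟩
  rcases lt_trichotomy t.im 0 with h1 | h1 | h1
  · exfalso
    refine h x hx ((starRingEnd ℂ) t) (by simpa using h1) ?_
    rw [complexify_line] at ht ⊢
    rw [aeval_conj, ht, map_zero]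
  · exact h1
  · exact absurd ht (h x hx t h1)

/-- The derivative of a hyperbolic polynomial in a direction of its cone is hyperbolic. -/
theorem IsHyperbolic.mulRight (hb : b ∈ H) (hF : IsHyperbolic b H (d + 1) F) {a : E}
    (ha : a ∈ hyperbolicityCone b H (d + 1) F) :
    IsHyperbolic b H d (F ∘ₗ LinearMap.mulRight ℝ a) := by
  refine isHyperbolic_of_im_pos (pos_pow_mul_of_mem_cone hb hF ha
    (self_mem_hyperbolicityCone hb hF)) fun x hx t ht h => ?_
  rw [complexify_mulRight] at h
  -- Gauss–Lucas argument: by `stable_one` all roots in the direction `a` lie in the lower half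
  -- plane. The logarithmic derivative then has negative imaginary part and cannot vanish.
  have h1 := logDeriv_linePoly_pos (F := F) (a := a) (ι' x + t • ι' b)
    (pos_of_mem_hyperbolicityCone ha).ne' (fun h' => ht.ne' (hF.2 x hx t h')) (-Complex.imLm)
    (fun r hr => ?_)
  · rw [h] at h1
    simp at h1
  · have hr' : r.im < 0 := by
      by_contra hr'
      push Not at hr'
      refine stable_one hb hF ha hx hr' ht ?_
      rw [← hr]
      congr 2
      ring
    change 0 < -(1 / (0 - r)).im
    have hr0 : r ≠ 0 := fun h => by simp [h] at hr'
    rw [one_div, Complex.inv_im, zero_sub, Complex.neg_im, Complex.normSq_neg, neg_neg]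
    rw [neg_pos]
    exact div_neg_of_neg_of_pos hr' (Complex.normSq_pos.2 hr0)

lemma mem_hyperbolicityCone_mulRight (hb : b ∈ H) (hF : IsHyperbolic b H (d + 1) F) {a c : E}
    (ha : a ∈ hyperbolicityCone b H (d + 1) F) (hc : c ∈ hyperbolicityCone b H (d + 1) F) :
    c ∈ hyperbolicityCone b H d (F ∘ₗ LinearMap.mulRight ℝ a) :=
  ⟨hc.1, fun _ ht => pos_pow_mul_of_mem_cone hb hF ha (add_smul_mem_hyperbolicityCone hb hc ht)⟩

/-- Gårding's inequality (positivity of the completely polarised form). -/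
theorem prod_pos_of_mem_hyperbolicityCone (hb : b ∈ H) (s : Multiset E) :
    ∀ F : E →ₗ[ℝ] ℝ, IsHyperbolic b H s.card F →
      (∀ a ∈ s, a ∈ hyperbolicityCone b H s.card F) → 0 < F s.prod := by
  induction s using Multiset.induction_on with
  | empty => intro F hF _; simpa using hF.1
  | cons a s ih =>
    intro F hF hs
    rw [Multiset.card_cons] at hF hs
    have ha := hs a (Multiset.mem_cons_self a s)
    have h := ih _ (hF.mulRight hb ha) fun c hc =>
      mem_hyperbolicityCone_mulRight hb hF ha (hs c (Multiset.mem_cons_of_mem hc))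
    rw [Multiset.prod_cons, mul_comm]
    exact h

lemma IsHyperbolic.mulRight_pow (hb : b ∈ H) (r : ℕ) :
    ∀ F : E →ₗ[ℝ] ℝ, IsHyperbolic b H (d + r) F →
      IsHyperbolic b H d (F ∘ₗ LinearMap.mulRight ℝ (b ^ r)) := by
  induction r with
  | zero => intro F hF; simpa using hF
  | succ r ih =>
    intro F hF
    have h := ih _ (IsHyperbolic.mulRight (d := d + r) hb hF (self_mem_hyperbolicityCone hb hF))
    convert h using 1
    ext x
    simp only [LinearMap.comp_apply, LinearMap.mulRight_apply]
    rw [pow_succ, mul_assoc]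

end Hyperbolic

/-! ### The closed cone and its dual description -/

section ClosedCone

open Filter Topology

variable {E : Type*} [CommRing E] [Algebra ℝ E]

/-- The elements `a` of `H` with `τ (a ^ j * b ^ (n - j)) ≥ 0` for all `j ≤ m`. -/
def closedCone (b : E) (H : Submodule ℝ E) (τ : E →ₗ[ℝ] ℝ) (n m : ℕ) : Set E :=
  {a | a ∈ H ∧ ∀ j ≤ m, 0 ≤ τ (a ^ j * b ^ (n - j))}

variable {b : E} {H : Submodule ℝ E} {τ : E →ₗ[ℝ] ℝ} {n m : ℕ}

lemma self_mem_closedCone (hb : b ∈ H) (hτ : IsHyperbolic b H n τ) (hmn : m ≤ n) :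
    b ∈ closedCone b H τ n m := by
  refine ⟨hb, fun j hj => ?_⟩
  rw [← pow_add, Nat.add_sub_cancel' (hj.trans hmn)]
  exact hτ.1.le

lemma isHyperbolic_truncate (hb : b ∈ H) (hτ : IsHyperbolic b H n τ) (hmn : m ≤ n) :
    IsHyperbolic b H m (τ ∘ₗ LinearMap.mulRight ℝ (b ^ (n - m))) := by
  refine IsHyperbolic.mulRight_pow hb (n - m) τ ?_
  rwa [Nat.add_sub_cancel' hmn]

/-- In the binomial expansion all terms are nonnegative by definition of the closed cone, and the
term without `a` is strictly positive. -/
lemma add_smul_mem_cone_of_mem_closedCone (hb : b ∈ H) (hτ : IsHyperbolic b H n τ) (hmn : m ≤ n)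
    {a : E} (ha : a ∈ closedCone b H τ n m) {ε : ℝ} (hε : 0 < ε) :
    a + ε • b ∈ hyperbolicityCone b H m (τ ∘ₗ LinearMap.mulRight ℝ (b ^ (n - m))) := by
  refine ⟨H.add_mem ha.1 (H.smul_mem _ hb), fun t ht => ?_⟩
  have hs : 0 < ε + t := by linarith
  rw [LinearMap.comp_apply, LinearMap.mulRight_apply, add_assoc, ← add_smul, add_pow,
    Finset.sum_mul, map_sum]
  have hterm : ∀ j ∈ Finset.range (m + 1),
      τ (a ^ j * ((ε + t) • b) ^ (m - j) * (m.choose j : E) * b ^ (n - m)) =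
      (ε + t) ^ (m - j) * m.choose j * τ (a ^ j * b ^ (n - j)) := by
    intro j hj
    have hj' : j ≤ m := Nat.lt_succ_iff.1 (Finset.mem_range.1 hj)
    have h1 : n - j = (m - j) + (n - m) := by omega
    have : a ^ j * ((ε + t) • b) ^ (m - j) * (m.choose j : E) * b ^ (n - m) =
        ((ε + t) ^ (m - j) * m.choose j) • (a ^ j * b ^ (n - j)) := by
      rw [smul_pow, mul_smul, Nat.cast_smul_eq_nsmul, nsmul_eq_mul, h1, pow_add]
      simp only [smul_mul_assoc, mul_smul_comm]
      congr 1
      ring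
    rw [this, map_smul, smul_eq_mul]
  rw [Finset.sum_congr rfl hterm]
  refine Finset.sum_pos' (fun j hj => ?_) ⟨0, by simp, ?_⟩
  · exact mul_nonneg (by positivity) (ha.2 j (Nat.lt_succ_iff.1 (Finset.mem_range.1 hj)))
  · simp only [Nat.sub_zero, Nat.choose_zero_right, Nat.cast_one, mul_one, pow_zero, one_mul]
    exact mul_pos (by positivity) hτ.1

lemma continuous_prod_add_smul (b : E) (s : Multiset E) :
    ∀ F : E →ₗ[ℝ] ℝ, Continuous fun ε : ℝ => F (s.map fun a => a + ε • b).prod := by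
  induction s using Multiset.induction_on with
  | empty => intro F; simpa using continuous_const
  | cons a s ih =>
    intro F
    have : (fun ε : ℝ => F ((a ::ₘ s).map fun a => a + ε • b).prod) = fun ε : ℝ =>
        (F ∘ₗ LinearMap.mulLeft ℝ a) (s.map fun a => a + ε • b).prod +
        ε * (F ∘ₗ LinearMap.mulLeft ℝ b) (s.map fun a => a + ε • b).prod := by
      funext ε
      rw [Multiset.map_cons, Multiset.prod_cons, add_mul, map_add, smul_mul_assoc, map_smul]
      rfl
    rw [this]
    exact (ih _).add (continuous_id.mul (ih _))

/-- Mixed products of elements of the closed cone are nonnegative. -/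
theorem mixed_nonneg (hb : b ∈ H) (hτ : IsHyperbolic b H n τ) (hmn : m ≤ n) (s : Multiset E)
    (hs : s.card ≤ m) (h : ∀ a ∈ s, a ∈ closedCone b H τ n m) :
    0 ≤ τ (b ^ (n - s.card) * s.prod) := by
  -- Gårding's inequality needs exactly `m` factors in the open cone: the product is padded by
  -- copies of `b`, and each factor is shifted by `ε b` before letting `ε → 0`.
  set s' := s + Multiset.replicate (m - s.card) b with hs'
  have hcard : s'.card = m := by simp [hs']; omega
  have hmem : ∀ a ∈ s', a ∈ closedCone b H τ n m := by
    intro a ha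
    rcases Multiset.mem_add.1 ha with ha | ha
    · exact h a ha
    · rw [Multiset.eq_of_mem_replicate ha]
      exact self_mem_closedCone hb hτ hmn
  have hpos : ∀ ε : ℝ, 0 < ε → 0 < (τ ∘ₗ LinearMap.mulRight ℝ (b ^ (n - m)))
      (s'.map fun a => a + ε • b).prod := by
    intro ε hε
    refine prod_pos_of_mem_hyperbolicityCone hb _ _ ?_ ?_
    · rw [Multiset.card_map, hcard]
      exact isHyperbolic_truncate hb hτ hmn
    · intro c hc
      obtain ⟨a, ha, rfl⟩ := Multiset.mem_map.1 hc
      rw [Multiset.card_map, hcard]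
      exact add_smul_mem_cone_of_mem_closedCone hb hτ hmn (hmem a ha) hε
  have hlim : Tendsto (fun ε : ℝ => (τ ∘ₗ LinearMap.mulRight ℝ (b ^ (n - m)))
      (s'.map fun a => a + ε • b).prod) (𝓝[>] 0)
      (𝓝 ((τ ∘ₗ LinearMap.mulRight ℝ (b ^ (n - m))) (s'.map fun a => a + (0 : ℝ) • b).prod)) :=
    ((continuous_prod_add_smul b s' _).tendsto 0).mono_left nhdsWithin_le_nhds
  have h0 := ge_of_tendsto hlim (eventually_nhdsWithin_of_forall fun ε hε => (hpos ε hε).le)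
  simp only [zero_smul, add_zero, Multiset.map_id', LinearMap.comp_apply,
    LinearMap.mulRight_apply] at h0
  rw [hs', Multiset.prod_add, Multiset.prod_replicate] at h0
  have h1 : n - s.card = (m - s.card) + (n - m) := by omega
  rw [h1, pow_add, mul_comm, ← mul_assoc]
  exact h0

/-- Gårding's inequality for `j` copies of `a` and `m - j` copies of `b`. -/
lemma mem_closedCone_of_mem_cone (hb : b ∈ H) (hτ : IsHyperbolic b H n τ) (hmn : m ≤ n) {a : E}
    (ha : a ∈ hyperbolicityCone b H m (τ ∘ₗ LinearMap.mulRight ℝ (b ^ (n - m)))) :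
    a ∈ closedCone b H τ n m := by
  refine ⟨ha.1, fun j hj => ?_⟩
  have hc : (Multiset.replicate j a + Multiset.replicate (m - j) b).card = m := by simp; omega
  have h := prod_pos_of_mem_hyperbolicityCone hb
    (Multiset.replicate j a + Multiset.replicate (m - j) b)
    (τ ∘ₗ LinearMap.mulRight ℝ (b ^ (n - m)))
    (by rw [hc]; exact isHyperbolic_truncate hb hτ hmn) (fun c hc' => ?_)
  · rw [Multiset.prod_add, Multiset.prod_replicate, Multiset.prod_replicate, LinearMap.comp_apply,
      LinearMap.mulRight_apply, mul_assoc, ← pow_add] at h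
    have h1 : n - j = m - j + (n - m) := by omega
    rw [h1]
    exact h.le
  · rw [hc]
    rcases Multiset.mem_add.1 hc' with h | h
    · rw [Multiset.eq_of_mem_replicate h]; exact ha
    · rw [Multiset.eq_of_mem_replicate h]
      exact self_mem_hyperbolicityCone hb (isHyperbolic_truncate hb hτ hmn)

/-- If `a + ε b` lies in the open cone for all `ε > 0`, then `a` lies in the closed cone. -/
lemma mem_closedCone_of_forall_pos (hb : b ∈ H) (hτ : IsHyperbolic b H n τ) (hmn : m ≤ n) {a : E}
    (haH : a ∈ H)
    (ha : ∀ t : ℝ, 0 < t → 0 < τ ((a + t • b) ^ m * b ^ (n - m))) :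
    a ∈ closedCone b H τ n m := by
  refine ⟨haH, fun j hj => ?_⟩
  have hmem : ∀ ε : ℝ, 0 < ε → a + ε • b ∈ closedCone b H τ n m := by
    intro ε hε
    refine mem_closedCone_of_mem_cone hb hτ hmn ⟨H.add_mem haH (H.smul_mem _ hb), fun t ht => ?_⟩
    rw [add_assoc, ← add_smul]
    exact ha _ (by linarith)
  have hc : Continuous fun ε : ℝ => τ ((a + ε • b) ^ j * b ^ (n - j)) := by
    have := continuous_prod_add_smul b (Multiset.replicate j a)
      (τ ∘ₗ LinearMap.mulRight ℝ (b ^ (n - j)))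
    simpa using this
  have hlim : Tendsto (fun ε : ℝ => τ ((a + ε • b) ^ j * b ^ (n - j))) (𝓝[>] 0)
      (𝓝 (τ ((a + (0 : ℝ) • b) ^ j * b ^ (n - j)))) :=
    (hc.tendsto 0).mono_left nhdsWithin_le_nhds
  have h0 := ge_of_tendsto hlim
    (eventually_nhdsWithin_of_forall fun ε hε => (hmem ε hε).2 j hj)
  simpa using h0

/-- The closed cone is described by the linear inequalities coming from its own elements. -/
theorem mem_closedCone_of_dual (hb : b ∈ H) (hτ : IsHyperbolic b H n τ) (hmn : m ≤ n)
    (hm : 1 ≤ m) {a : E} (haH : a ∈ H)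
    (ha : ∀ c ∈ closedCone b H τ n m, 0 ≤ τ (c ^ (m - 1) * b ^ (n - m) * a)) :
    a ∈ closedCone b H τ n m := by
  obtain ⟨q, rfl⟩ : ∃ q, m = q + 1 := ⟨m - 1, by omega⟩
  simp only [Nat.add_sub_cancel] at ha
  refine mem_closedCone_of_forall_pos hb hτ hmn haH ?_
  by_contra hcon
  push Not at hcon
  obtain ⟨t₁, ht₁, hft₁⟩ := hcon
  set F := τ ∘ₗ LinearMap.mulRight ℝ (b ^ (n - (q + 1))) with hF
  set f := linePoly F (q + 1) a b with hf
  have hfe : ∀ t, f.eval t = τ ((a + t • b) ^ (q + 1) * b ^ (n - (q + 1))) := fun t => by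
    rw [hf, eval_linePoly]; rfl
  have hfd : ∀ t, f.derivative.eval t =
      ((q : ℝ) + 1) * τ ((a + t • b) ^ q * b ^ (n - (q + 1)) * b) := fun t => by
    rw [hf, derivative_linePoly, Polynomial.eval_smul, eval_linePoly, smul_eq_mul]
    simp only [hF, LinearMap.comp_apply, LinearMap.mulRight_apply]
    congr 2
    ring
  have hpos : 0 < F (b ^ (q + 1)) := (isHyperbolic_truncate hb hτ hmn).1
  have hcoeff : f.coeff (q + 1) = F (b ^ (q + 1)) := by
    rw [hf, coeff_linePoly]; simp
  have hnd : f.natDegree = q + 1 := le_antisymm (natDegree_linePoly_le _ _ _ _)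
    (Polynomial.le_natDegree_of_ne_zero (by rw [hcoeff]; exact hpos.ne'))
  have htop : Tendsto (fun t => f.eval t) atTop atTop := by
    refine Polynomial.tendsto_atTop_of_leadingCoeff_nonneg f ?_ ?_
    · rw [← Polynomial.natDegree_pos_iff_degree_pos]; omega
    · rw [Polynomial.leadingCoeff, hnd, hcoeff]; exact hpos.le
  obtain ⟨R, hR⟩ := (htop.eventually_gt_atTop 0).exists_forall_of_atTop
  -- Beyond the last point `t₀ > 0` where `f ≤ 0`, the element `a + t b` lies in the cone, so the
  -- hypothesis may be tested against `c = a + t b`.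
  set S : Set ℝ := {t | t₁ ≤ t ∧ f.eval t ≤ 0} with hS
  have hScl : IsClosed S := (isClosed_le continuous_const continuous_id).inter
    (isClosed_le f.continuous continuous_const)
  have hSb : BddAbove S := ⟨R, fun t ht => by
    by_contra h
    push Not at h
    exact absurd (hR t h.le) (not_lt.2 ht.2)⟩
  have hSn : S.Nonempty := ⟨t₁, le_rfl, by rw [hfe]; exact hft₁⟩
  set t₀ := sSup S with ht₀
  have ht₀S : t₀ ∈ S := hScl.csSup_mem hSn hSb
  have ht₀pos : 0 < t₀ := lt_of_lt_of_le ht₁ ht₀S.1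
  have hgt : ∀ t, t₀ < t → 0 < f.eval t := by
    intro t ht
    by_contra h
    push Not at h
    exact absurd (le_csSup hSb (show t ∈ S from ⟨ht₀S.1.trans ht.le, h⟩)) (not_le.2 ht)
  have hcone : ∀ t, t₀ < t → a + t • b ∈ closedCone b H τ n (q + 1) := by
    intro t ht
    refine mem_closedCone_of_mem_cone hb hτ hmn ⟨H.add_mem haH (H.smul_mem _ hb), fun s hs => ?_⟩
    rw [add_assoc, ← add_smul]
    have := hgt (t + s) (by linarith)
    rw [hfe] at this
    exact this
  -- Writing `a = (a + t b) - t b`, the hypothesis for `c = a + t b` becomes this differential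
  -- inequality, opposite in direction to what a zero at `t₀ > 0` requires.
  have hineq : ∀ t, t₀ < t → t * f.derivative.eval t ≤ ((q : ℝ) + 1) * f.eval t := by
    intro t ht
    have h1 := ha _ (hcone t ht)
    have h2 : (a + t • b) ^ q * b ^ (n - (q + 1)) * a =
        (a + t • b) ^ (q + 1) * b ^ (n - (q + 1)) -
          t • ((a + t • b) ^ q * b ^ (n - (q + 1)) * b) := by
      rw [← mul_smul_comm, pow_succ]; ring
    rw [h2, map_sub, map_smul, smul_eq_mul, ← hfe] at h1
    rw [hfd]
    have hq : (0 : ℝ) ≤ (q : ℝ) + 1 := by positivity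
    nlinarith [mul_nonneg hq h1]
  -- The quotient cannot increase, yet it is nonpositive at `t₀` and positive beyond it.
  have hanti : AntitoneOn (fun t => f.eval t / t ^ (q + 1)) (Ici t₀) := by
    have hne : ∀ t ∈ Ici t₀, t ^ (q + 1) ≠ 0 := fun t ht =>
      pow_ne_zero _ (lt_of_lt_of_le ht₀pos ht).ne'
    refine antitoneOn_of_deriv_nonpos (convex_Ici t₀)
      (f.continuous.continuousOn.div (continuous_pow _).continuousOn hne) ?_ ?_
    · intro t ht
      rw [interior_Ici] at ht
      exact (f.differentiable.differentiableAt.div (differentiable_pow _).differentiableAt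
        (hne t (mem_Ici.2 (le_of_lt ht)))).differentiableWithinAt
    · intro t ht
      rw [interior_Ici] at ht
      have ht' : 0 < t := ht₀pos.trans ht
      have hd := (f.hasDerivAt t).div (hasDerivAt_pow (q + 1) t) (hne t (mem_Ici.2 (le_of_lt ht)))
      rw [show (fun t => f.eval t / t ^ (q + 1)) =
        ((fun x => Polynomial.eval x f) / fun x => x ^ (q + 1)) from rfl, hd.deriv]
      refine div_nonpos_of_nonpos_of_nonneg ?_ (by positivity)
      have h1 := hineq t ht
      have h2 : 0 ≤ t ^ q := by positivity
      simp only [Nat.add_sub_cancel]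
      push_cast
      rw [pow_succ]
      nlinarith [mul_nonneg h2 (sub_nonneg.2 h1)]
  have h1 := hanti (mem_Ici.2 le_rfl) (mem_Ici.2 (by linarith : t₀ ≤ t₀ + 1))
    (by linarith : t₀ ≤ t₀ + 1)
  have h2 : f.eval t₀ / t₀ ^ (q + 1) ≤ 0 := div_nonpos_of_nonpos_of_nonneg ht₀S.2 (by positivity)
  have h3 : 0 < f.eval (t₀ + 1) / (t₀ + 1) ^ (q + 1) :=
    div_pos (hgt _ (by linarith)) (by positivity)
  simp only at h1
  linarith

end ClosedCone

/-! ### Alternating forms and the exterior algebra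

A vector `v` stands for the covector `⟨v, ·⟩`; the exterior algebra of `ℂⁿ` is thus used as an
algebra of constant differential forms. -/

section Exterior

open ExteriorAlgebra

variable {n : ℕ}

/-- The exterior algebra of `ℂⁿ` as a real vector space. -/
abbrev Lam (n : ℕ) : Type := ExteriorAlgebra ℝ (Cn n)

/-- The monomial `ℓ₁ ∧ ⋯ ∧ ℓ_d`, as an alternating map. -/
def mono {d : ℕ} (l : Fin d → Cn n) : Cn n [⋀^Fin d]→ₗ[ℝ] ℝ :=
  MultilinearMap.alternatization
    ((MultilinearMap.mkPiAlgebra ℝ (Fin d) ℝ).compLinearMap fun i => innerₗ (Cn n) (l i))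

lemma mono_apply {d : ℕ} (l u : Fin d → Cn n) :
    mono l u = ∑ σ : Equiv.Perm (Fin d), Equiv.Perm.sign σ • ∏ i, inner ℝ (l i) (u (σ i)) := by
  rw [mono, MultilinearMap.alternatization_apply]
  rfl

lemma mono_eq_det {d : ℕ} (l u : Fin d → Cn n) :
    mono l u = (Matrix.of fun i j => inner ℝ (l i) (u j)).det := by
  rw [mono_apply, ← Matrix.det_transpose, Matrix.det_apply]
  rfl

/-- `(ℓ₁, …, ℓ_d) ↦ det ⟨ℓ_a, f_b⟩`, where `f` is the standard frame. -/
def topMono (n d : ℕ) : Cn n [⋀^Fin d]→ₗ[ℝ] ℝ :=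
  (Matrix.detRowAlternating : (Fin d → ℝ) [⋀^Fin d]→ₗ[ℝ] ℝ).compLinearMap
    (LinearMap.pi fun b => (innerₗ (Cn n)).flip (frame n b))

/-- The coefficient with respect to the volume form, on the exterior algebra. -/
def tau (n : ℕ) : Lam n →ₗ[ℝ] ℝ := liftAlternating fun d => topMono n d

lemma tau_ιMulti {d : ℕ} (l : Fin d → Cn n) : tau n (ιMulti ℝ d l) = topCoeff (mono l) := by
  rw [tau, liftAlternating_apply_ιMulti, topCoeff, mono_eq_det]
  rfl

/-- The pairs `(x, η)` such that `x` is homogeneous of degree `d` and represents `η`. -/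
def Rep (n d : ℕ) : Submodule ℝ (Lam n × (Cn n [⋀^Fin d]→ₗ[ℝ] ℝ)) :=
  Submodule.span ℝ (range fun l : Fin d → Cn n => (ιMulti ℝ d l, mono l))

lemma ιMulti_mem_Rep {d : ℕ} (l : Fin d → Cn n) : (ιMulti ℝ d l, mono l) ∈ Rep n d :=
  Submodule.subset_span ⟨l, rfl⟩

lemma zero_mem_Rep (d : ℕ) : ((0 : Lam n), (0 : Cn n [⋀^Fin d]→ₗ[ℝ] ℝ)) ∈ Rep n d :=
  (Rep n d).zero_mem

lemma topCoeff_add {N : ℕ} (ψ η : Cn n [⋀^Fin N]→ₗ[ℝ] ℝ) :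
    topCoeff (ψ + η) = topCoeff ψ + topCoeff η := rfl

lemma topCoeff_smul {N : ℕ} (c : ℝ) (ψ : Cn n [⋀^Fin N]→ₗ[ℝ] ℝ) :
    topCoeff (c • ψ) = c * topCoeff ψ := rfl

/-- `topCoeff` as a linear map. -/
def topCoeffₗ (n N : ℕ) : (Cn n [⋀^Fin N]→ₗ[ℝ] ℝ) →ₗ[ℝ] ℝ where
  toFun := topCoeff
  map_add' := topCoeff_add
  map_smul' := topCoeff_smul

lemma topCoeffₗ_apply {N : ℕ} (ψ : Cn n [⋀^Fin N]→ₗ[ℝ] ℝ) : topCoeffₗ n N ψ = topCoeff ψ := rfl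

lemma tau_eq_topCoeff {d : ℕ} {x : Lam n} {η : Cn n [⋀^Fin d]→ₗ[ℝ] ℝ} (h : (x, η) ∈ Rep n d) :
    tau n x = topCoeff η := by
  have hle : Rep n d ≤ LinearMap.eqLocus (tau n ∘ₗ LinearMap.fst ℝ _ _)
      (topCoeffₗ n d ∘ₗ LinearMap.snd ℝ _ _) := by
    refine Submodule.span_le.2 ?_
    rintro p ⟨l, rfl⟩
    exact tau_ιMulti l
  have h' := LinearMap.mem_eqLocus.1 (hle h)
  rwa [LinearMap.comp_apply, LinearMap.comp_apply, LinearMap.fst_apply, LinearMap.snd_apply,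
    topCoeffₗ_apply] at h'

/-! ### Wedge products and multiplication in the exterior algebra -/

lemma wedge_add_left {a b : ℕ} (α α' : Cn n [⋀^Fin a]→ₗ[ℝ] ℝ) (η : Cn n [⋀^Fin b]→ₗ[ℝ] ℝ) :
    wedge (α + α') η = wedge α η + wedge α' η := by
  unfold wedge
  rw [← AlternatingMap.domCoprod'_apply, TensorProduct.add_tmul, map_add]
  ext v
  simp

lemma wedge_add_right {a b : ℕ} (α : Cn n [⋀^Fin a]→ₗ[ℝ] ℝ) (η η' : Cn n [⋀^Fin b]→ₗ[ℝ] ℝ) :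
    wedge α (η + η') = wedge α η + wedge α η' := by
  unfold wedge
  rw [← AlternatingMap.domCoprod'_apply, TensorProduct.tmul_add, map_add]
  ext v
  simp

lemma wedge_smul_left {a b : ℕ} (c : ℝ) (α : Cn n [⋀^Fin a]→ₗ[ℝ] ℝ)
    (η : Cn n [⋀^Fin b]→ₗ[ℝ] ℝ) : wedge (c • α) η = c • wedge α η := by
  unfold wedge
  rw [← AlternatingMap.domCoprod'_apply, ← TensorProduct.smul_tmul', map_smul]
  ext v
  simp

lemma wedge_smul_right {a b : ℕ} (c : ℝ) (α : Cn n [⋀^Fin a]→ₗ[ℝ] ℝ)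
    (η : Cn n [⋀^Fin b]→ₗ[ℝ] ℝ) : wedge α (c • η) = c • wedge α η := by
  unfold wedge
  rw [← AlternatingMap.domCoprod'_apply, TensorProduct.tmul_smul, map_smul]
  ext v
  simp

lemma wedge_zero_left {a b : ℕ} (η : Cn n [⋀^Fin b]→ₗ[ℝ] ℝ) :
    wedge (0 : Cn n [⋀^Fin a]→ₗ[ℝ] ℝ) η = 0 := by
  have := wedge_smul_left 0 (0 : Cn n [⋀^Fin a]→ₗ[ℝ] ℝ) η
  simpa using this

lemma wedge_zero_right {a b : ℕ} (α : Cn n [⋀^Fin a]→ₗ[ℝ] ℝ) :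
    wedge α (0 : Cn n [⋀^Fin b]→ₗ[ℝ] ℝ) = 0 := by
  have := wedge_smul_right 0 α (0 : Cn n [⋀^Fin b]→ₗ[ℝ] ℝ)
  simpa using this

lemma wedge_mono {a b : ℕ} (l : Fin a → Cn n) (l' : Fin b → Cn n) :
    wedge (mono l) (mono l') = mono (Fin.append l l') := by
  ext u
  unfold wedge mono
  rw [← MultilinearMap.domCoprod_alternization, AlternatingMap.domDomCongr_apply,
    LinearMap.compAlternatingMap_apply, MultilinearMap.alternatization_apply,
    MultilinearMap.alternatization_apply, map_sum]
  refine Fintype.sum_equiv finSumFinEquiv.permCongr _ _ fun σ => ?_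
  rw [Equiv.Perm.sign_permCongr, map_zsmul_unit]
  congr 1
  simp only [MultilinearMap.domDomCongr_apply, MultilinearMap.domCoprod_apply,
    LinearMap.mul'_apply, MultilinearMap.compLinearMap_apply, MultilinearMap.mkPiAlgebra_apply]
  rw [Fin.prod_univ_add]
  congr 1
  · refine Finset.prod_congr rfl fun i _ => ?_
    simp [Equiv.permCongr_apply]
  · refine Finset.prod_congr rfl fun i _ => ?_
    simp [Equiv.permCongr_apply]

/-- The dictionary between covectors and the exterior algebra is multiplicative. As it is a relation
spanned by pairs of monomials, bilinearity reduces this to `wedge_mono`, and no isomorphism has to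
be constructed. -/
lemma Rep_wedge {a b : ℕ} {x y : Lam n} {α : Cn n [⋀^Fin a]→ₗ[ℝ] ℝ} {η : Cn n [⋀^Fin b]→ₗ[ℝ] ℝ}
    (hx : (x, α) ∈ Rep n a) (hy : (y, η) ∈ Rep n b) : (x * y, wedge α η) ∈ Rep n (a + b) := by
  have : ∀ p ∈ Rep n a, ∀ q ∈ Rep n b, (p.1 * q.1, wedge p.2 q.2) ∈ Rep n (a + b) := by
    intro p hp q hq
    induction hp, hq using Submodule.span_induction₂ with
    | mem_mem p q hp hq =>
      obtain ⟨l, rfl⟩ := hp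
      obtain ⟨l', rfl⟩ := hq
      simp only [wedge_mono, ιMulti_mul_ιMulti]
      exact ιMulti_mem_Rep _
    | zero_left q _ => simpa [wedge_zero_left] using zero_mem_Rep (a + b)
    | zero_right p _ => simpa [wedge_zero_right] using zero_mem_Rep (a + b)
    | add_left p p' q _ _ _ h h' =>
      simpa [add_mul, wedge_add_left] using (Rep n (a + b)).add_mem h h'
    | add_right p q q' _ _ _ h h' =>
      simpa [mul_add, wedge_add_right] using (Rep n (a + b)).add_mem h h'
    | smul_left c p q _ _ h =>
      simpa [wedge_smul_left] using (Rep n (a + b)).smul_mem c h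
    | smul_right c p q _ _ h =>
      simpa [wedge_smul_right] using (Rep n (a + b)).smul_mem c h
  exact this _ hx _ hy

/-! ### The frame -/

lemma inner_real_eq_re (v w : Cn n) : inner ℝ v w = (inner ℂ v w : ℂ).re := by
  simp only [PiLp.inner_apply, Complex.re_sum]
  rfl

lemma mulI_apply (v : Cn n) : mulI n v = Complex.I • v := rfl

lemma mulI_mulI (v : Cn n) : mulI n (mulI n v) = -v := by
  rw [mulI_apply, mulI_apply, smul_smul, Complex.I_mul_I, neg_one_smul]

lemma inner_mulI_left (v w : Cn n) : inner ℝ (mulI n v) w = -inner ℝ v (mulI n w) := by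
  rw [inner_real_eq_re, inner_real_eq_re, mulI_apply, mulI_apply, inner_smul_left,
    inner_smul_right]
  simp

lemma inner_mulI_left_eq_im (v w : Cn n) : inner ℝ (mulI n v) w = (inner ℂ v w : ℂ).im := by
  rw [inner_real_eq_re, mulI_apply, inner_smul_left]
  simp

lemma inner_mulI_mulI (v w : Cn n) : inner ℝ (mulI n v) (mulI n w) = inner ℝ v w := by
  rw [inner_mulI_left, mulI_mulI, inner_neg_right, neg_neg]

lemma norm_mulI (v : Cn n) : ‖mulI n v‖ = ‖v‖ := by
  rw [mulI_apply, norm_smul, Complex.norm_I, one_mul]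

/-- A family satisfying the Parseval identity `v = ∑ ⟨f_i, v⟩ f_i`. -/
def IsParseval {ι : Type*} [Fintype ι] (f : ι → Cn n) : Prop :=
  ∀ v, ∑ i, (inner ℝ (f i) v : ℝ) • f i = v

lemma sum_range_two_mul {M : Type*} [AddCommMonoid M] (g : ℕ → M) (k : ℕ) :
    ∑ i ∈ Finset.range (2 * k), g i = ∑ j ∈ Finset.range k, (g (2 * j) + g (2 * j + 1)) := by
  induction k with
  | zero => simp
  | succ k ih =>
    rw [Nat.mul_succ, Finset.sum_range_succ, Finset.sum_range_succ, ih, Finset.sum_range_succ,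
      add_assoc]

lemma isParseval_of_orthonormalBasis (w : OrthonormalBasis (Fin n) ℂ (Cn n)) (v : Cn n) :
    ∑ j, ((inner ℝ (w j) v : ℝ) • w j + (inner ℝ (mulI n (w j)) v : ℝ) • mulI n (w j)) = v := by
  conv_rhs => rw [← w.sum_repr' v]
  refine Finset.sum_congr rfl fun j _ => ?_
  rw [inner_real_eq_re, inner_mulI_left_eq_im, mulI_apply]
  conv_rhs => rw [← Complex.re_add_im (inner ℂ (w j) v : ℂ), add_smul, mul_smul]
  rfl

/-- The standard complex orthonormal basis. -/
abbrev stdBasis (n : ℕ) : OrthonormalBasis (Fin n) ℂ (Cn n) := EuclideanSpace.basisFun (Fin n) ℂ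

lemma frame_even (j : Fin n) : frame n (2 * j) = stdBasis n j := by
  have h : 2 * (j : ℕ) / 2 = j := by omega
  unfold frame
  rw [dif_pos (by rw [h]; exact j.2), if_pos (by omega)]
  simp [h]

lemma frame_odd (j : Fin n) : frame n (2 * j + 1) = mulI n (stdBasis n j) := by
  have h : (2 * (j : ℕ) + 1) / 2 = j := by omega
  unfold frame
  rw [dif_pos (by rw [h]; exact j.2), if_neg (by omega), mulI_apply]
  ext i
  simp [h]

/-- The frame as a family indexed by `Fin (2 n)`. -/
def fr (n : ℕ) (i : Fin (2 * n)) : Cn n := frame n i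

lemma sum_fr {M : Type*} [AddCommMonoid M] (g : Cn n → M) :
    ∑ i, g (fr n i) = ∑ j, (g (stdBasis n j) + g (mulI n (stdBasis n j))) := by
  unfold fr
  rw [Fin.sum_univ_eq_sum_range (fun i => g (frame n i)), sum_range_two_mul,
    ← Fin.sum_univ_eq_sum_range (fun j => g (frame n (2 * j)) + g (frame n (2 * j + 1)))]
  simp only [frame_even, frame_odd]

lemma isParseval_fr : IsParseval (fr n) := by
  intro v
  rw [sum_fr (fun w => (inner ℝ w v : ℝ) • w)]
  exact isParseval_of_orthonormalBasis _ v

/-- The element of the exterior algebra representing an alternating map. -/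
def hat {d : ℕ} : (Cn n [⋀^Fin d]→ₗ[ℝ] ℝ) →ₗ[ℝ] Lam n where
  toFun η := ((d.factorial : ℝ)⁻¹) • ∑ I : Fin d → Fin (2 * n),
    η (fun i => fr n (I i)) • ιMulti ℝ d (fun i => fr n (I i))
  map_add' η η' := by
    simp only [AlternatingMap.add_apply, add_smul, Finset.sum_add_distrib, smul_add]
  map_smul' c η := by
    simp only [AlternatingMap.smul_apply, smul_eq_mul, mul_smul, RingHom.id_apply]
    rw [← Finset.smul_sum, smul_comm]

lemma hat_apply {d : ℕ} (η : Cn n [⋀^Fin d]→ₗ[ℝ] ℝ) :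
    hat η = ((d.factorial : ℝ)⁻¹) • ∑ I : Fin d → Fin (2 * n),
      η (fun i => fr n (I i)) • ιMulti ℝ d (fun i => fr n (I i)) := rfl

/-- Each of the `d!` permutations in the monomials contributes the same value: its sign is cancelled
by the alternation of `η`. This accounts for the factor `1 / d!` in `hat`. -/
lemma sum_mono_eq {d : ℕ} (η : Cn n [⋀^Fin d]→ₗ[ℝ] ℝ) :
    ((d.factorial : ℝ)⁻¹) • ∑ I : Fin d → Fin (2 * n),
      η (fun i => fr n (I i)) • mono (fun i => fr n (I i)) = η := by
  ext v
  have h1 : ∀ u : Fin d → Cn n, ∑ I : Fin d → Fin (2 * n),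
      η (fun i => fr n (I i)) * ∏ i, inner ℝ (fr n (I i)) (u i) = η u := by
    intro u
    conv_rhs => rw [show u = fun i => ∑ j, (inner ℝ (fr n j) (u i) : ℝ) • fr n j from
      funext fun i => (isParseval_fr (u i)).symm]
    rw [← AlternatingMap.coe_multilinearMap, MultilinearMap.map_sum]
    refine Finset.sum_congr rfl fun I _ => ?_
    rw [MultilinearMap.map_smul_univ, smul_eq_mul, mul_comm]
  rw [AlternatingMap.smul_apply]
  have hsum : ∀ (s : Finset (Fin d → Fin (2 * n)))
      (g : (Fin d → Fin (2 * n)) → Cn n [⋀^Fin d]→ₗ[ℝ] ℝ), (∑ I ∈ s, g I) v = ∑ I ∈ s, g I v :=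
    fun s g => map_sum ({ toFun := fun A => A v, map_add' := fun _ _ => rfl, map_zero' := rfl } :
      (Cn n [⋀^Fin d]→ₗ[ℝ] ℝ) →+ ℝ) g s
  rw [hsum]
  have h2 : ∑ I : Fin d → Fin (2 * n), (η (fun i => fr n (I i)) • mono (fun i => fr n (I i))) v
      = d.factorial * η v := by
    simp only [AlternatingMap.smul_apply, mono_apply, smul_eq_mul, Finset.mul_sum]
    rw [Finset.sum_comm]
    have h3 : ∀ σ : Equiv.Perm (Fin d), ∑ I : Fin d → Fin (2 * n),
        η (fun i => fr n (I i)) * (Equiv.Perm.sign σ • ∏ i, inner ℝ (fr n (I i)) (v (σ i)))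
        = η v := by
      intro σ
      simp only [mul_smul_comm]
      rw [← Finset.smul_sum, h1 (fun i => v (σ i))]
      have := η.map_perm v σ
      rw [show (fun i => v (σ i)) = v ∘ σ from rfl, this, smul_smul, Int.units_mul_self, one_smul]
    rw [Finset.sum_congr rfl fun σ _ => h3 σ]
    simp [Fintype.card_perm]
  rw [h2, smul_eq_mul, ← mul_assoc, inv_mul_cancel₀ (by positivity), one_mul]

lemma hat_mem_Rep {d : ℕ} (η : Cn n [⋀^Fin d]→ₗ[ℝ] ℝ) : (hat η, η) ∈ Rep n d := by
  have h : ((hat η, η) : Lam n × (Cn n [⋀^Fin d]→ₗ[ℝ] ℝ)) = ((d.factorial : ℝ)⁻¹) •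
      ∑ I : Fin d → Fin (2 * n), η (fun i => fr n (I i)) •
        (ιMulti ℝ d (fun i => fr n (I i)), mono (fun i => fr n (I i))) := by
    refine Prod.ext ?_ ?_
    · simp [hat_apply, Prod.fst_sum]
    · conv_lhs => rw [← sum_mono_eq η]
      simp [Prod.snd_sum]
  rw [h]
  exact Submodule.smul_mem _ _ (Submodule.sum_mem _ fun I _ =>
    Submodule.smul_mem _ _ (ιMulti_mem_Rep _))

end Exterior

/-! ### The commutative algebra of even forms -/

section Even

open ExteriorAlgebra

variable {n : ℕ}

/-- The centre of the exterior algebra; it contains the forms of even degree. -/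
def Ev (n : ℕ) : Type := Subalgebra.center ℝ (Lam n)

instance : CommRing (Ev n) := inferInstanceAs (CommRing (Subalgebra.center ℝ (Lam n)))

instance : Algebra ℝ (Ev n) := inferInstanceAs (Algebra ℝ (Subalgebra.center ℝ (Lam n)))

/-- The inclusion of the centre. -/
def evVal (n : ℕ) : Ev n →ₐ[ℝ] Lam n := (Subalgebra.center ℝ (Lam n)).val

lemma evVal_injective : Function.Injective (evVal n) := Subtype.val_injective

lemma evVal_commutes (x : Ev n) (y : Lam n) : y * evVal n x = evVal n x * y :=
  Subalgebra.mem_center_iff.1 x.2 y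

lemma ι_mul_swap (u v : Cn n) : ι ℝ u * ι ℝ v = -(ι ℝ v * ι ℝ u) :=
  eq_neg_of_add_eq_zero_left (ι_add_mul_swap u v)

lemma two_mem_center (u v : Cn n) : ι ℝ u * ι ℝ v ∈ Subalgebra.center ℝ (Lam n) := by
  rw [Subalgebra.mem_center_iff]
  intro x
  induction x using ExteriorAlgebra.induction with
  | algebraMap r => exact Algebra.commutes r _
  | ι w =>
    calc ι ℝ w * (ι ℝ u * ι ℝ v) = (ι ℝ w * ι ℝ u) * ι ℝ v := (mul_assoc _ _ _).symm
      _ = -(ι ℝ u * (ι ℝ w * ι ℝ v)) := by rw [ι_mul_swap w u, neg_mul, mul_assoc]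
      _ = ι ℝ u * ι ℝ v * ι ℝ w := by rw [ι_mul_swap w v, mul_neg, neg_neg, mul_assoc]
  | mul x y hx hy =>
    rw [mul_assoc, hy, ← mul_assoc, hx, mul_assoc]
  | add x y hx hy => rw [add_mul, mul_add, hx, hy]

/-- The two-form `u ∧ v`. -/
def two : Cn n →ₗ[ℝ] Cn n →ₗ[ℝ] Ev n :=
  LinearMap.mk₂ ℝ (fun u v => (⟨ι ℝ u * ι ℝ v, two_mem_center u v⟩ : Subalgebra.center ℝ (Lam n)))
    (fun _ _ _ => Subtype.ext (by simp [add_mul]; rfl)) (fun _ _ _ => Subtype.ext (by simp; rfl))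
    (fun _ _ _ => Subtype.ext (by simp [mul_add]; rfl)) (fun _ _ _ => Subtype.ext (by simp; rfl))

lemma coe_two (u v : Cn n) : evVal n (two u v) = ι ℝ u * ι ℝ v := rfl

lemma two_self (v : Cn n) : two v v = 0 := evVal_injective (ι_sq_zero v)

lemma two_swap (u v : Cn n) : two u v = -two v u := evVal_injective (ι_mul_swap u v)

/-- Exchanging the outer vectors `u` and `u'` costs three transpositions. With equal arguments it
makes elementary forms square to zero. -/
lemma two_mul_two_swap_left (u v u' v' : Cn n) : two u v * two u' v' = -(two u' v * two u v') := by
  refine evVal_injective ?_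
  rw [map_neg, map_mul, map_mul]
  change ι ℝ u * ι ℝ v * (ι ℝ u' * ι ℝ v') = -(ι ℝ u' * ι ℝ v * (ι ℝ u * ι ℝ v'))
  have h1 : ι ℝ u * ι ℝ v * (ι ℝ u' * ι ℝ v') = ι ℝ u * (ι ℝ v * ι ℝ u') * ι ℝ v' := by
    simp only [mul_assoc]
  have h2 : ι ℝ u' * ι ℝ v * (ι ℝ u * ι ℝ v') = ι ℝ u' * (ι ℝ v * ι ℝ u) * ι ℝ v' := by
    simp only [mul_assoc]
  rw [h1, h2, ι_mul_swap v u', ι_mul_swap v u, mul_neg, mul_neg, ← mul_assoc, ← mul_assoc,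
    ι_mul_swap u' u]
  simp

/-- The form `v ∧ J v`, which represents `(i/2) α ∧ ᾱ` for `α = ⟨v, ·⟩`. -/
def elem (v : Cn n) : Ev n := two v (mulI n v)

lemma elem_mul_self (v : Cn n) : elem v * elem v = 0 := by
  have h := two_mul_two_swap_left v (mulI n v) v (mulI n v)
  have h2 : elem v * elem v = -(elem v * elem v) := h
  have h3 : (2 : ℝ) • (elem v * elem v) = 0 := by
    rw [two_smul]
    nth_rewrite 1 [h2]
    exact neg_add_cancel _
  exact (smul_eq_zero.1 h3).resolve_left two_ne_zero

lemma elem_smul (c : ℝ) (v : Cn n) : elem (c • v) = c ^ 2 • elem v := by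
  rw [elem, map_smul, map_smul, map_smul, LinearMap.smul_apply, smul_smul, ← sq]
  rfl

lemma elem_add (u v : Cn n) :
    elem (u + v) = elem u + elem v + (two u (mulI n v) + two v (mulI n u)) := by
  unfold elem
  simp only [map_add, LinearMap.add_apply]
  abel

/-- The coefficient functional on even forms. -/
def tauE (n : ℕ) : Ev n →ₗ[ℝ] ℝ := tau n ∘ₗ (evVal n).toLinearMap

lemma tauE_apply (x : Ev n) : tauE n x = tau n (evVal n x) := rfl

/-! ### Contractions -/

/-- A contraction is a trace, hence frame independent: one argument is expanded in `g` and the sum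
over `f` is collapsed. This permits replacing the standard frame by an eigenbasis. -/
lemma contract_congr {ι κ M : Type*} [Fintype ι] [Fintype κ] [AddCommGroup M] [Module ℝ M]
    {f : ι → Cn n} {g : κ → Cn n} (hf : IsParseval f) (hg : IsParseval g)
    (B : Cn n →ₗ[ℝ] Cn n →ₗ[ℝ] M) (T : Cn n →ₗ[ℝ] Cn n) :
    ∑ i, B (f i) (T (f i)) = ∑ j, B (g j) (T (g j)) := by
  calc ∑ i, B (f i) (T (f i)) = ∑ i, ∑ j, B (g j) (T ((inner ℝ (f i) (g j) : ℝ) • f i)) := by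
        refine Finset.sum_congr rfl fun i _ => ?_
        nth_rewrite 1 [← hg (f i)]
        simp only [map_sum, map_smul, LinearMap.sum_apply, LinearMap.smul_apply]
        refine Finset.sum_congr rfl fun j _ => ?_
        rw [real_inner_comm]
    _ = _ := by
        rw [Finset.sum_comm]
        refine Finset.sum_congr rfl fun j _ => ?_
        rw [← map_sum, ← map_sum, hf (g j)]

lemma contract_symm {ι M : Type*} [Fintype ι] [AddCommGroup M] [Module ℝ M]
    {f : ι → Cn n} (hf : IsParseval f) (B : Cn n →ₗ[ℝ] Cn n →ₗ[ℝ] M) (T : Cn n →ₗ[ℝ] Cn n)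
    (hT : T.IsSymmetric) : ∑ i, B (T (f i)) (f i) = ∑ i, B (f i) (T (f i)) := by
  calc ∑ i, B (T (f i)) (f i) = ∑ i, ∑ j, B (f j) ((inner ℝ (f i) (T (f j)) : ℝ) • f i) := by
        refine Finset.sum_congr rfl fun i _ => ?_
        nth_rewrite 1 [← hf (T (f i))]
        simp only [map_sum, map_smul, LinearMap.sum_apply, LinearMap.smul_apply]
        refine Finset.sum_congr rfl fun j _ => ?_
        rw [← hT (f i) (f j), real_inner_comm]
    _ = _ := by
        rw [Finset.sum_comm]
        refine Finset.sum_congr rfl fun j _ => ?_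
        conv_rhs => rw [← hf (T (f j))]
        simp only [map_sum]

lemma IsParseval.comp_mulI {ι : Type*} [Fintype ι] {f : ι → Cn n} (hf : IsParseval f) :
    IsParseval fun i => mulI n (f i) := by
  intro v
  have h := congrArg (mulI n) (hf (-mulI n v))
  rw [map_neg, mulI_mulI, neg_neg, map_sum] at h
  conv_rhs => rw [← h]
  refine Finset.sum_congr rfl fun i _ => ?_
  rw [map_smul, inner_mulI_left, inner_neg_right]

lemma isParseval_sumElim (w : OrthonormalBasis (Fin n) ℂ (Cn n)) :
    IsParseval (Sum.elim (fun j => w j) fun j => mulI n (w j)) := by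
  intro v
  rw [Fintype.sum_sum_type, ← Finset.sum_add_distrib]
  exact isParseval_of_orthonormalBasis w v

/-- The real `(1,1)`-form associated with a real operator `T`:
`(1/2) ∑ f_a ∧ J T f_a` for the standard frame `f`. -/
def hop : (Cn n →ₗ[ℝ] Cn n) →ₗ[ℝ] Ev n where
  toFun T := (1 / 2 : ℝ) • ∑ a, two (fr n a) (mulI n (T (fr n a)))
  map_add' T S := by
    simp only [LinearMap.add_apply, map_add, Finset.sum_add_distrib, smul_add]
  map_smul' c T := by
    simp only [LinearMap.smul_apply, map_smul, ← Finset.smul_sum, RingHom.id_apply]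
    rw [smul_comm]

lemma hop_apply (T : Cn n →ₗ[ℝ] Cn n) :
    hop T = (1 / 2 : ℝ) • ∑ a, two (fr n a) (mulI n (T (fr n a))) := rfl

/-- `two` composed with `J` in the second variable. -/
def twoJ : Cn n →ₗ[ℝ] Cn n →ₗ[ℝ] Ev n := two.compl₂ (mulI n : Cn n →ₗ[ℝ] Cn n)

lemma twoJ_apply (u v : Cn n) : twoJ u v = two u (mulI n v) := rfl

lemma hop_eq {ι : Type*} [Fintype ι] {f : ι → Cn n} (hf : IsParseval f)
    (T : Cn n →ₗ[ℝ] Cn n) : hop T = (1 / 2 : ℝ) • ∑ a, two (f a) (mulI n (T (f a))) := by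
  rw [hop_apply]
  congr 1
  exact contract_congr isParseval_fr hf twoJ T

/-- The form `β`. -/
def beta (n : ℕ) : Ev n := hop LinearMap.id

/-- Real `(1,1)`-forms. -/
def Herm (n : ℕ) : Submodule ℝ (Ev n) where
  carrier := {a | ∃ T : Cn n →ₗ[ℝ] Cn n, T.IsSymmetric ∧ a = hop T}
  add_mem' := by
    rintro _ _ ⟨T, hT, rfl⟩ ⟨S, hS, rfl⟩
    exact ⟨T + S, hT.add hS, (map_add _ _ _).symm⟩
  zero_mem' := ⟨0, LinearMap.IsSymmetric.zero, (map_zero _).symm⟩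
  smul_mem' := by
    rintro c _ ⟨T, hT, rfl⟩
    exact ⟨c • T, hT.smul (by simp), (map_smul _ _ _).symm⟩

lemma hop_mem_Herm {T : Cn n →ₗ[ℝ] Cn n} (hT : T.IsSymmetric) : hop T ∈ Herm n := ⟨T, hT, rfl⟩

lemma beta_mem_Herm : beta n ∈ Herm n := hop_mem_Herm LinearMap.IsSymmetric.id

/-- The complex linear part of a real operator. -/
def cpart (T : Cn n →ₗ[ℝ] Cn n) : Cn n →ₗ[ℂ] Cn n where
  toFun x := (1 / 2 : ℝ) • (T x - mulI n (T (mulI n x)))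
  map_add' x y := by simp only [map_add, ← smul_add]; congr 1; abel
  map_smul' c x := by
    have hc : ∀ y : Cn n, c • y = c.re • y + c.im • mulI n y := fun y => by
      rw [mulI_apply]
      conv_lhs => rw [← Complex.re_add_im c, add_smul, mul_smul]
      rfl
    rw [RingHom.id_apply, hc, hc]
    simp only [map_add, map_smul, mulI_mulI, map_neg, map_sub, smul_sub, smul_add, smul_neg]
    simp only [smul_comm (1 / 2 : ℝ)]
    abel

lemma cpart_apply (T : Cn n →ₗ[ℝ] Cn n) (x : Cn n) :
    cpart T x = (1 / 2 : ℝ) • (T x - mulI n (T (mulI n x))) := rfl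

lemma cpart_inner_real {T : Cn n →ₗ[ℝ] Cn n} (hT : T.IsSymmetric) (x y : Cn n) :
    (inner ℝ (cpart T x) y : ℝ) = inner ℝ x (cpart T y) := by
  rw [cpart_apply, cpart_apply, real_inner_smul_left, real_inner_smul_right, inner_sub_left,
    inner_sub_right, hT x y, inner_mulI_left, hT, inner_mulI_left, neg_neg]

lemma cpart_isSymmetric {T : Cn n →ₗ[ℝ] Cn n} (hT : T.IsSymmetric) :
    (cpart T).IsSymmetric := by
  intro x y
  refine Complex.ext ?_ ?_
  · rw [← inner_real_eq_re, ← inner_real_eq_re, cpart_inner_real hT]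
  · rw [← inner_mulI_left_eq_im, ← inner_mulI_left_eq_im, ← cpart_inner_real hT, mulI_apply,
      mulI_apply, map_smul]

/-- The operators `T` and `-J T J` define the same (1,1)-form, as seen by computing in the frame `J
f`. Only the complex linear part matters, and that part is Hermitian, hence unitarily
diagonalisable. -/
lemma hop_cpart {T : Cn n →ₗ[ℝ] Cn n} (hT : T.IsSymmetric) :
    hop ((cpart T).restrictScalars ℝ) = hop T := by
  have h1 : (cpart T).restrictScalars ℝ = (1 / 2 : ℝ) • (T + (-1 : ℝ) •
      ((mulI n : Cn n →ₗ[ℝ] Cn n) ∘ₗ T ∘ₗ (mulI n : Cn n →ₗ[ℝ] Cn n))) := by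
    ext1 x
    simp [cpart_apply, sub_eq_add_neg]
  have h2 : hop ((-1 : ℝ) • ((mulI n : Cn n →ₗ[ℝ] Cn n) ∘ₗ T ∘ₗ (mulI n : Cn n →ₗ[ℝ] Cn n)))
      = hop T := by
    rw [hop_eq isParseval_fr.comp_mulI T, hop_apply]
    congr 1
    have h3 := contract_symm isParseval_fr.comp_mulI twoJ T hT
    simp only [twoJ_apply] at h3
    rw [← h3]
    refine Finset.sum_congr rfl fun a _ => ?_
    simp only [neg_smul, one_smul, LinearMap.neg_apply, LinearMap.comp_apply,
      ContinuousLinearMap.coe_coe, map_neg, mulI_mulI, neg_neg]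
    rw [two_swap]
  rw [h1, map_smul, map_add, h2, ← two_smul ℝ, smul_smul]
  norm_num

lemma beta_eq_sum (w : OrthonormalBasis (Fin n) ℂ (Cn n)) : beta n = ∑ j, elem (w j) := by
  rw [beta, hop_eq (isParseval_sumElim w), Fintype.sum_sum_type, ← Finset.sum_add_distrib,
    Finset.smul_sum]
  refine Finset.sum_congr rfl fun j _ => ?_
  simp only [Sum.elim_inl, Sum.elim_inr, LinearMap.id_apply, mulI_mulI, map_neg]
  rw [← two_swap, elem, ← two_smul ℝ, smul_smul]
  norm_num

/-- Simultaneous diagonalisation of a real `(1,1)`-form and `β`. -/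
lemma exists_diagonal {T : Cn n →ₗ[ℝ] Cn n} (hT : T.IsSymmetric) :
    ∃ (w : OrthonormalBasis (Fin n) ℂ (Cn n)) (c : Fin n → ℝ),
      hop T = ∑ j, c j • elem (w j) ∧
      ∀ j, c j = (1 / 2 : ℝ) * (inner ℝ (w j) (T (w j)) +
        inner ℝ (mulI n (w j)) (T (mulI n (w j)))) := by
  have hS := cpart_isSymmetric hT
  have hn : Module.finrank ℂ (Cn n) = n := by simp
  refine ⟨hS.eigenvectorBasis hn, hS.eigenvalues hn, ?_, fun j => ?_⟩
  · rw [← hop_cpart hT, hop_eq (isParseval_sumElim (hS.eigenvectorBasis hn)),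
      Fintype.sum_sum_type, ← Finset.sum_add_distrib, Finset.smul_sum]
    refine Finset.sum_congr rfl fun j _ => ?_
    set v := hS.eigenvectorBasis hn j with hv
    have h1 : cpart T v = hS.eigenvalues hn j • v := by
      rw [hv, hS.apply_eigenvectorBasis]; rfl
    have h2 : cpart T (mulI n v) = hS.eigenvalues hn j • mulI n v := by
      rw [mulI_apply, map_smul, h1, smul_comm]
    simp only [Sum.elim_inl, Sum.elim_inr, LinearMap.restrictScalars_apply]
    rw [← hv, h1, h2, map_smul, map_smul, map_smul, map_smul, mulI_mulI, map_neg, ← two_swap,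
      ← two_smul ℝ, smul_smul, elem]
    norm_num
  · set v := hS.eigenvectorBasis hn j with hv
    have h1 : cpart T v = hS.eigenvalues hn j • v := by
      rw [hv, hS.apply_eigenvectorBasis]; rfl
    have h3 : inner ℝ v (cpart T v) = hS.eigenvalues hn j := by
      rw [h1, real_inner_smul_right, real_inner_self_eq_norm_sq, hv,
        (hS.eigenvectorBasis hn).norm_eq_one]
      norm_num
    rw [← h3, cpart_apply, real_inner_smul_right, inner_sub_right, inner_mulI_left,
      sub_eq_add_neg]

/-! ### Top degree powers -/

/-- Only squarefree monomials survive, and the full one arises from `s.card!` orderings. The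
vanishing of the next power is carried along for the induction. -/
lemma sum_pow_of_sq_zero {R ι : Type*} [CommRing R] [DecidableEq ι] (s : Finset ι) (x : ι → R)
    (hx : ∀ i, x i * x i = 0) :
    (∑ i ∈ s, x i) ^ s.card = s.card.factorial * ∏ i ∈ s, x i ∧
      (∑ i ∈ s, x i) ^ (s.card + 1) = 0 := by
  induction s using Finset.induction_on with
  | empty => simp
  | insert i s hi ih =>
    obtain ⟨ih1, ih2⟩ := ih
    have key : ∀ (y : R) (k : ℕ), (x i + y) ^ (k + 1) = y ^ (k + 1) + (k + 1) * x i * y ^ k := by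
      intro y k
      induction k with
      | zero => simp; ring
      | succ k ihk =>
        rw [pow_succ, ihk]
        push_cast
        have := hx i
        linear_combination ((k : R) + 1) * y ^ k * this
    rw [Finset.sum_insert hi, Finset.prod_insert hi, Finset.card_insert_of_notMem hi]
    constructor
    · rw [key, ih2, ih1, Nat.factorial_succ]
      push_cast
      ring
    · rw [key, pow_succ, ih2]
      ring

lemma tauE_diag_pow (w : OrthonormalBasis (Fin n) ℂ (Cn n)) (c : Fin n → ℝ) :
    tauE n ((∑ j, c j • elem (w j)) ^ n) = (∏ j, c j) * tauE n (beta n ^ n) := by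
  have h1 := (sum_pow_of_sq_zero Finset.univ (fun j => c j • elem (w j)) fun j => by
    rw [smul_mul_smul_comm, elem_mul_self, smul_zero]).1
  have h2 := (sum_pow_of_sq_zero Finset.univ (fun j => elem (w j)) fun j => elem_mul_self _).1
  rw [Finset.card_univ, Fintype.card_fin] at h1 h2
  rw [beta_eq_sum w, h1, h2, Finset.prod_smul, mul_smul_comm, map_smul, smul_eq_mul]

lemma inner_fr (a b : Fin (2 * n)) : inner ℝ (fr n a) (fr n b) = if a = b then (1 : ℝ) else 0 := by
  have hs : ∀ j k : Fin n, (inner ℂ (stdBasis n j) (stdBasis n k) : ℂ) = if j = k then 1 else 0 :=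
    orthonormal_iff_ite.1 (stdBasis n).orthonormal
  have hr : ∀ j k : Fin n, (inner ℝ (stdBasis n j) (stdBasis n k) : ℝ) = if j = k then 1 else 0 := by
    intro j k
    rw [inner_real_eq_re, hs]; split_ifs <;> simp
  have hi : ∀ j k : Fin n, (inner ℝ (mulI n (stdBasis n j)) (stdBasis n k) : ℝ) = 0 := by
    intro j k
    rw [inner_mulI_left_eq_im, hs]; split_ifs <;> simp
  have hcase : ∀ a : Fin (2 * n), (∃ j : Fin n, (a : ℕ) = 2 * j ∧ fr n a = stdBasis n j) ∨
      ∃ j : Fin n, (a : ℕ) = 2 * j + 1 ∧ fr n a = mulI n (stdBasis n j) := by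
    intro a
    have ha := a.2
    rcases Nat.even_or_odd' (a : ℕ) with ⟨j, hj | hj⟩
    · left
      refine ⟨⟨j, by omega⟩, hj, ?_⟩
      rw [fr, hj]
      exact frame_even ⟨j, by omega⟩
    · right
      refine ⟨⟨j, by omega⟩, hj, ?_⟩
      rw [fr, hj]
      exact frame_odd ⟨j, by omega⟩
  rcases hcase a with ⟨j, hj, ha⟩ | ⟨j, hj, ha⟩ <;> rcases hcase b with ⟨k, hk, hb⟩ | ⟨k, hk, hb⟩
  · rw [ha, hb, hr]
    congr 1
    rw [Fin.ext_iff, Fin.ext_iff, hj, hk]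
    exact propext (by omega)
  · rw [ha, hb, real_inner_comm, hi, if_neg]
    rw [Fin.ext_iff, hj, hk]; omega
  · rw [ha, hb, hi, if_neg]
    rw [Fin.ext_iff, hj, hk]; omega
  · rw [ha, hb, inner_mulI_mulI, hr]
    congr 1
    rw [Fin.ext_iff, Fin.ext_iff, hj, hk]
    exact propext (by omega)

lemma coe_prod_two_frame (k : ℕ) :
    evVal n (∏ j ∈ Finset.range k, two (frame n (2 * j)) (frame n (2 * j + 1))) =
      ιMulti ℝ (2 * k) fun i => frame n i := by
  induction k with
  | zero => simp [ιMulti_apply]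
  | succ k ih =>
    rw [Finset.prod_range_succ, map_mul, ih, coe_two, ιMulti_apply, ιMulti_apply,
      show 2 * (k + 1) = 2 * k + 1 + 1 from by ring, List.ofFn_succ', List.ofFn_succ',
      List.concat_eq_append, List.concat_eq_append, List.prod_append, List.prod_append]
    simp [mul_assoc]

/-- `β^n` is `n!` times the volume form `dx₁ ∧ dy₁ ∧ ⋯ ∧ dxₙ ∧ dyₙ`. -/
lemma tauE_beta_pow_pos : 0 < tauE n (beta n ^ n) := by
  have h2 := (sum_pow_of_sq_zero Finset.univ (fun j => elem (stdBasis n j))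
    fun j => elem_mul_self _).1
  rw [Finset.card_univ, Fintype.card_fin] at h2
  rw [beta_eq_sum (stdBasis n), h2, ← nsmul_eq_mul, map_nsmul]
  have h3 : ∏ j, elem (stdBasis n j) =
      ∏ j ∈ Finset.range n, two (frame n (2 * j)) (frame n (2 * j + 1)) := by
    rw [← Fin.prod_univ_eq_prod_range (fun j => two (frame n (2 * j)) (frame n (2 * j + 1)))]
    refine Finset.prod_congr rfl fun j _ => ?_
    rw [frame_even, frame_odd, elem]
  rw [h3, tauE_apply, coe_prod_two_frame, tau_ιMulti, topCoeff, mono_eq_det]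
  have h4 : (Matrix.of fun i j : Fin (2 * n) => inner ℝ (frame n i) (frame n j)) =
      (1 : Matrix (Fin (2 * n)) (Fin (2 * n)) ℝ) := by
    ext i j
    rw [Matrix.of_apply, Matrix.one_apply]
    exact inner_fr i j
  rw [h4, Matrix.det_one]
  simpa using Nat.factorial_pos n

/-! ### Hyperbolicity and the cone of `m`-positive forms -/

/-- After simultaneous diagonalisation with `β` the polynomial along a line is `τ(βⁿ) ∏ (t + c_j)`,
where the `c_j` are the real eigenvalues. -/
lemma isHyperbolic_tauE : IsHyperbolic (beta n) (Herm n) n (tauE n) := by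
  refine ⟨tauE_beta_pow_pos, ?_⟩
  rintro _ ⟨T, hT, rfl⟩ t ht
  obtain ⟨w, c, hw, -⟩ := exists_diagonal hT
  rw [complexify_line] at ht
  have hpoly : linePoly (tauE n) n (hop T) (beta n) =
      Polynomial.C (tauE n (beta n ^ n)) * ∏ j, (Polynomial.X + Polynomial.C (c j)) := by
    refine Polynomial.funext fun s => ?_
    rw [eval_linePoly, Polynomial.eval_mul, Polynomial.eval_C, Polynomial.eval_prod, hw,
      beta_eq_sum w, Finset.smul_sum, ← Finset.sum_add_distrib]
    simp only [← add_smul]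
    rw [tauE_diag_pow w, ← beta_eq_sum w, mul_comm]
    simp [add_comm]
  rw [hpoly, map_mul, map_prod] at ht
  rcases mul_eq_zero.1 ht with h | h
  · rw [Polynomial.aeval_C] at h
    have := tauE_beta_pow_pos (n := n)
    exact absurd h (by simpa using this.ne')
  · obtain ⟨j, -, hj⟩ := Finset.prod_eq_zero_iff.1 h
    have := congrArg Complex.im hj
    simpa using this

/-- The cone of `m`-positive real `(1,1)`-forms. -/
def gam (n m : ℕ) : Set (Ev n) := closedCone (beta n) (Herm n) (tauE n) n m

lemma gam_mono {m m' : ℕ} (h : m ≤ m') : gam n m' ⊆ gam n m := fun _ ha =>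
  ⟨ha.1, fun j hj => ha.2 j (hj.trans h)⟩

/-- The averages over `v` and `J v` determine the eigenvalues. If these are nonnegative the form
lies in the smallest cone `gam n n`, hence in all of them. -/
lemma hop_mem_gam {m : ℕ} (hmn : m ≤ n) {T : Cn n →ₗ[ℝ] Cn n} (hT : T.IsSymmetric)
    (hpos : ∀ v, 0 ≤ (inner ℝ v (T v) + inner ℝ (mulI n v) (T (mulI n v)) : ℝ)) :
    hop T ∈ gam n m := by
  refine gam_mono hmn (mem_closedCone_of_forall_pos beta_mem_Herm isHyperbolic_tauE le_rfl
    (hop_mem_Herm hT) fun t ht => ?_)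
  obtain ⟨w, c, hw, hc⟩ := exists_diagonal hT
  rw [Nat.sub_self, pow_zero, mul_one, hw, beta_eq_sum w, Finset.smul_sum,
    ← Finset.sum_add_distrib]
  simp only [← add_smul]
  rw [tauE_diag_pow w]
  refine mul_pos (Finset.prod_pos fun j _ => ?_) tauE_beta_pow_pos
  have := hpos (w j)
  rw [hc j]
  linarith

/-- The rank one operator `x ↦ ⟨v, x⟩ v`. -/
def rankOne (v : Cn n) : Cn n →ₗ[ℝ] Cn n := (innerₗ (Cn n) v).smulRight v

lemma rankOne_apply (v x : Cn n) : rankOne v x = (inner ℝ v x : ℝ) • v := rfl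

lemma rankOne_isSymmetric (v : Cn n) : (rankOne v).IsSymmetric := by
  intro x y
  rw [rankOne_apply, rankOne_apply, real_inner_smul_left, real_inner_smul_right,
    real_inner_comm x v]
  ring

lemma hop_rankOne (v : Cn n) : hop (rankOne v) = (1 / 2 : ℝ) • elem v := by
  rw [hop_apply, elem]
  congr 1
  conv_rhs => rw [← isParseval_fr v]
  rw [isParseval_fr v]
  nth_rewrite 2 [← isParseval_fr v]
  simp only [map_sum, map_smul, LinearMap.sum_apply, LinearMap.smul_apply, rankOne_apply]
  exact Finset.sum_congr rfl fun a _ => by rw [real_inner_comm]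

lemma elem_eq_hop (v : Cn n) : elem v = hop ((2 : ℝ) • rankOne v) := by
  rw [map_smul, hop_rankOne, smul_smul]; norm_num

lemma elem_mem_gam {m : ℕ} (hmn : m ≤ n) (v : Cn n) : elem v ∈ gam n m := by
  rw [elem_eq_hop]
  refine hop_mem_gam hmn ((rankOne_isSymmetric v).smul (by simp)) fun x => ?_
  simp only [LinearMap.smul_apply, rankOne_apply, real_inner_smul_right]
  rw [real_inner_comm x v, real_inner_comm (mulI n x) v]
  have h1 := mul_self_nonneg (inner ℝ x v : ℝ)
  have h2 := mul_self_nonneg (inner ℝ (mulI n x) v : ℝ)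
  linarith

/-- This is the Cauchy–Schwarz inequality. It lets elementary factors be traded for `β` in trace
estimates. -/
lemma beta_sub_elem_mem_gam {m : ℕ} (hmn : m ≤ n) {v : Cn n} (hv : ‖v‖ ≤ 1) :
    beta n - elem v ∈ gam n m := by
  rw [elem_eq_hop, beta, ← map_sub]
  refine hop_mem_gam hmn (LinearMap.IsSymmetric.id.sub ((rankOne_isSymmetric v).smul (by simp)))
    fun x => ?_
  have h1 : (inner ℝ x v : ℝ) ^ 2 + (inner ℝ (mulI n x) v : ℝ) ^ 2 ≤ ‖x‖ ^ 2 := by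
    have h2 : ‖(inner ℂ x v : ℂ)‖ ≤ ‖x‖ * ‖v‖ := norm_inner_le_norm x v
    have h3 : ‖(inner ℂ x v : ℂ)‖ ≤ ‖x‖ :=
      h2.trans (mul_le_of_le_one_right (norm_nonneg _) hv)
    rw [inner_real_eq_re, inner_mulI_left_eq_im]
    have h4 : (inner ℂ x v : ℂ).re ^ 2 + (inner ℂ x v : ℂ).im ^ 2 = ‖(inner ℂ x v : ℂ)‖ ^ 2 := by
      rw [← Complex.normSq_eq_norm_sq, Complex.normSq_apply]; ring
    rw [h4]
    exact pow_le_pow_left₀ (norm_nonneg _) h3 2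
  simp only [LinearMap.sub_apply, LinearMap.id_apply, LinearMap.smul_apply, rankOne_apply,
    inner_sub_right, real_inner_smul_right, real_inner_self_eq_norm_sq]
  rw [real_inner_comm x v, real_inner_comm (mulI n x) v, norm_mulI]
  nlinarith

/-- Mixed products of `m`-positive forms are nonnegative. -/
lemma tauE_mixed_nonneg {m : ℕ} (hmn : m ≤ n) (s : Multiset (Ev n)) (hs : s.card ≤ m)
    (h : ∀ a ∈ s, a ∈ gam n m) : 0 ≤ tauE n (beta n ^ (n - s.card) * s.prod) :=
  mixed_nonneg beta_mem_Herm isHyperbolic_tauE hmn s hs h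

end Even

/-! ### Homogeneous elements and invariance under rotations -/

section Invariance

open ExteriorAlgebra

variable {n : ℕ}

/-- Homogeneous elements of degree `d` of the exterior algebra. -/
def homog (n d : ℕ) : Submodule ℝ (Lam n) := (Rep n d).map (LinearMap.fst ℝ _ _)

lemma mem_homog_of_Rep {d : ℕ} {x : Lam n} {η : Cn n [⋀^Fin d]→ₗ[ℝ] ℝ} (h : (x, η) ∈ Rep n d) :
    x ∈ homog n d := ⟨_, h, rfl⟩

lemma exists_Rep_of_mem_homog {d : ℕ} {x : Lam n} (h : x ∈ homog n d) :
    ∃ η, (x, η) ∈ Rep n d := by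
  obtain ⟨⟨y, η⟩, h, rfl⟩ := h
  exact ⟨η, h⟩

lemma homog_eq_span (d : ℕ) : homog n d = Submodule.span ℝ (range (ιMulti ℝ d)) := by
  rw [homog, Rep, Submodule.map_span, ← range_comp]
  rfl

lemma ιMulti_mem_homog {d : ℕ} (l : Fin d → Cn n) : ιMulti ℝ d l ∈ homog n d :=
  mem_homog_of_Rep (ιMulti_mem_Rep l)

lemma mul_mem_homog {a b : ℕ} {x y : Lam n} (hx : x ∈ homog n a) (hy : y ∈ homog n b) :
    x * y ∈ homog n (a + b) := by
  obtain ⟨α, hα⟩ := exists_Rep_of_mem_homog hx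
  obtain ⟨η, hη⟩ := exists_Rep_of_mem_homog hy
  exact mem_homog_of_Rep (Rep_wedge hα hη)

lemma one_mem_homog : (1 : Lam n) ∈ homog n 0 := by
  have := ιMulti_mem_homog (n := n) (d := 0) Fin.elim0
  rwa [ιMulti_zero_apply] at this

lemma ι_mem_homog (v : Cn n) : ι ℝ v ∈ homog n 1 := by
  have := ιMulti_mem_homog (n := n) (d := 1) (fun _ => v)
  rwa [ιMulti_succ_apply, ιMulti_zero_apply, mul_one] at this

lemma two_mem_homog (u v : Cn n) : evVal n (two u v) ∈ homog n 2 :=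
  mul_mem_homog (ι_mem_homog u) (ι_mem_homog v)

lemma hop_mem_homog (T : Cn n →ₗ[ℝ] Cn n) : evVal n (hop T) ∈ homog n 2 := by
  rw [hop_apply, map_smul, map_sum]
  exact Submodule.smul_mem _ _ (Submodule.sum_mem _ fun a _ => two_mem_homog _ _)

lemma Herm_mem_homog {a : Ev n} (ha : a ∈ Herm n) : evVal n a ∈ homog n 2 := by
  obtain ⟨T, -, rfl⟩ := ha
  exact hop_mem_homog T

lemma pow_mem_homog {a : Ev n} (ha : evVal n a ∈ homog n 2) (k : ℕ) :
    evVal n (a ^ k) ∈ homog n (2 * k) := by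
  induction k with
  | zero => simpa using one_mem_homog
  | succ k ih =>
    rw [pow_succ, map_mul]
    exact mul_mem_homog ih ha

lemma multiset_prod_mem_homog (s : Multiset (Ev n)) (hs : ∀ a ∈ s, evVal n a ∈ homog n 2) :
    evVal n s.prod ∈ homog n (2 * s.card) := by
  induction s using Multiset.induction_on with
  | empty => simpa using one_mem_homog
  | cons a s ih =>
    rw [Multiset.prod_cons, mul_comm a, map_mul, Multiset.card_cons]
    change _ ∈ homog n (2 * s.card + 2)
    exact mul_mem_homog (ih fun c hc => hs c (Multiset.mem_cons_of_mem hc))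
      (hs a (Multiset.mem_cons_self a s))

lemma beta_mem_homog : evVal n (beta n) ∈ homog n 2 := hop_mem_homog _

/-- Multiplication by a complex number as a real linear map. -/
def rot (n : ℕ) (c : ℂ) : Cn n →ₗ[ℝ] Cn n := c • LinearMap.id

lemma rot_apply (c : ℂ) (v : Cn n) : rot n c v = c • v := rfl

lemma smul_eq_re_im (c : ℂ) (v : Cn n) : c • v = c.re • v + c.im • mulI n v := by
  rw [mulI_apply]
  conv_lhs => rw [← Complex.re_add_im c, add_smul, mul_smul]
  rfl

lemma elem_rot {c : ℂ} (hc : ‖c‖ = 1) (v : Cn n) : elem (c • v) = elem v := by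
  have h : c.re ^ 2 + c.im ^ 2 = 1 := by
    have : c.re ^ 2 + c.im ^ 2 = ‖c‖ ^ 2 := by
      rw [← Complex.normSq_eq_norm_sq, Complex.normSq_apply]; ring
    rw [this, hc, one_pow]
  rw [smul_eq_re_im, elem]
  simp only [map_add, map_smul, mulI_mulI, LinearMap.add_apply, LinearMap.smul_apply, map_neg,
    two_self, two_swap (mulI n v) v, smul_neg, neg_neg, smul_zero, add_zero, zero_add]
  rw [smul_smul, smul_smul, ← add_smul, ← sq, ← sq, h, one_smul, elem]

lemma map_rot_elem {c : ℂ} (hc : ‖c‖ = 1) (v : Cn n) :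
    ExteriorAlgebra.map (rot n c) (evVal n (elem v)) = evVal n (elem v) := by
  conv_rhs => rw [← elem_rot hc v]
  rw [elem, elem, coe_two, coe_two, map_mul, map_apply_ι, map_apply_ι, rot_apply, rot_apply]
  rw [mulI_apply, mulI_apply, smul_comm]

lemma map_rot_Herm {c : ℂ} (hc : ‖c‖ = 1) {a : Ev n} (ha : a ∈ Herm n) :
    ExteriorAlgebra.map (rot n c) (evVal n a) = evVal n a := by
  obtain ⟨T, hT, rfl⟩ := ha
  obtain ⟨w, d, hw, -⟩ := exists_diagonal hT
  rw [hw]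
  simp only [map_sum, map_smul, map_rot_elem hc]

lemma map_rot_multiset_prod {c : ℂ} (hc : ‖c‖ = 1) (s : Multiset (Ev n))
    (hs : ∀ a ∈ s, a ∈ Herm n) :
    ExteriorAlgebra.map (rot n c) (evVal n s.prod) = evVal n s.prod := by
  induction s using Multiset.induction_on with
  | empty => simp
  | cons a s ih =>
    rw [Multiset.prod_cons, map_mul, map_mul, map_rot_Herm hc (hs a (Multiset.mem_cons_self a s)),
      ih fun c hc => hs c (Multiset.mem_cons_of_mem hc)]

lemma tau_map_rot_ιMulti (R : Cn n →ₗ[ℝ] Cn n) (l : Fin (2 * n) → Cn n) :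
    tau n (ιMulti ℝ (2 * n) fun i => R (l i)) =
      tau n (ιMulti ℝ (2 * n) l) *
        (Matrix.of fun k b : Fin (2 * n) => (inner ℝ (R (fr n k)) (fr n b) : ℝ)).det := by
  rw [tau_ιMulti, tau_ιMulti, topCoeff, topCoeff, mono_eq_det, mono_eq_det, ← Matrix.det_mul]
  congr 1
  ext a b
  rw [Matrix.of_apply, Matrix.mul_apply]
  simp only [Matrix.of_apply]
  conv_lhs => rw [← isParseval_fr (l a)]
  rw [map_sum, sum_inner]
  refine Finset.sum_congr rfl fun k _ => ?_
  rw [map_smul, real_inner_smul_left, real_inner_comm]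
  rfl

/-- In top degree a linear map acts through one determinant `D`. Instead of computing `D`, it is
read off from `β^n`, which is rotation invariant and has nonzero coefficient. -/
lemma tau_map_rot {c : ℂ} (hc : ‖c‖ = 1) {x : Lam n} (hx : x ∈ homog n (2 * n)) :
    tau n (ExteriorAlgebra.map (rot n c) x) = tau n x := by
  set D := (Matrix.of fun k b : Fin (2 * n) => (inner ℝ (rot n c (fr n k)) (fr n b) : ℝ)).det
  have h : ∀ x ∈ homog n (2 * n), tau n (ExteriorAlgebra.map (rot n c) x) = tau n x * D := by
    have hle : homog n (2 * n) ≤ LinearMap.eqLocus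
        (tau n ∘ₗ (ExteriorAlgebra.map (rot n c)).toLinearMap) (D • tau n) := by
      rw [homog_eq_span]
      refine Submodule.span_le.2 ?_
      rintro _ ⟨l, rfl⟩
      refine LinearMap.mem_eqLocus.2 ?_
      rw [LinearMap.comp_apply, AlgHom.toLinearMap_apply, map_apply_ιMulti, LinearMap.smul_apply,
        smul_eq_mul, mul_comm D]
      exact tau_map_rot_ιMulti _ l
    intro x hx
    have h1 := LinearMap.mem_eqLocus.1 (hle hx)
    rwa [LinearMap.comp_apply, AlgHom.toLinearMap_apply, LinearMap.smul_apply, smul_eq_mul,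
      mul_comm D] at h1
  have h1 := h _ (pow_mem_homog beta_mem_homog n)
  rw [map_pow, map_pow, map_rot_Herm hc beta_mem_Herm, ← map_pow, ← tauE_apply] at h1
  have h2 : D = 1 := by
    have := tauE_beta_pow_pos (n := n)
    have h3 : tauE n (beta n ^ n) * (1 - D) = 0 := by linarith
    rcases mul_eq_zero.1 h3 with h4 | h4
    · exact absurd h4 this.ne'
    · linarith
  rw [h x hx, h2, mul_one]

/-! ### Norm bounds for positive functionals -/

/-- The product of a list of covectors. -/
def word (l : List (Cn n)) : Lam n := (l.map (ι ℝ)).prod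

lemma word_cons (v : Cn n) (l : List (Cn n)) : word (v :: l) = ι ℝ v * word l := by
  simp [word]

lemma word_append (l l' : List (Cn n)) : word (l ++ l') = word l * word l' := by
  simp [word]

lemma word_mul_ι (l : List (Cn n)) (v : Cn n) :
    word l * ι ℝ v = (-1 : ℝ) ^ l.length • (ι ℝ v * word l) := by
  induction l with
  | nil => simp [word]
  | cons u l ih =>
    rw [word_cons, mul_assoc, ih, mul_smul_comm, ← mul_assoc, ι_mul_swap u v, List.length_cons,
      pow_succ, neg_mul, smul_neg, mul_neg_one, neg_smul, mul_assoc]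

lemma ιMulti_eq_word {d : ℕ} (l : Fin d → Cn n) : ιMulti ℝ d l = word (List.ofFn l) := by
  rw [ιMulti_apply, word, List.map_ofFn]
  rfl

lemma word_mem_homog (l : List (Cn n)) : word l ∈ homog n l.length := by
  have := ιMulti_mem_homog (n := n) l.get
  rwa [ιMulti_eq_word, List.ofFn_get] at this

/-- Invariance of a functional under rotations, in degree `d`. -/
def RotInvariant (F : Lam n →ₗ[ℝ] ℝ) (d : ℕ) : Prop :=
  ∀ c : ℂ, ‖c‖ = 1 → ∀ l : List (Cn n), l.length = d →
    F (word (l.map fun v => c • v)) = F (word l)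

/-- The difference polarises as `elem (u + v) - elem u - elem v`. Since `elem (u + v) = 4 elem ((u +
v) / 2)` with `(u + v) / 2` in the unit ball, the constant is `4 + 1 + 1 = 6`. -/
lemma abs_sub_le_of_polarized {F : Lam n →ₗ[ℝ] ℝ} {K : ℝ} {y : Lam n}
    (hF : ∀ w : Cn n, ‖w‖ ≤ 1 → |F (evVal n (elem w) * y)| ≤ K) {u v : Cn n} (hu : ‖u‖ ≤ 1)
    (hv : ‖v‖ ≤ 1) : |F (ι ℝ u * ι ℝ (mulI n v) * y) - F (ι ℝ (mulI n u) * ι ℝ v * y)| ≤ 6 * K := by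
  have h1 : evVal n (elem (u + v)) = (4 : ℝ) • evVal n (elem ((1 / 2 : ℝ) • (u + v))) := by
    rw [elem_smul, map_smul, smul_smul]; norm_num
  have h2 : ι ℝ u * ι ℝ (mulI n v) - ι ℝ (mulI n u) * ι ℝ v =
      evVal n (elem (u + v)) - evVal n (elem u) - evVal n (elem v) := by
    rw [elem_add]
    simp only [map_add, coe_two]
    rw [ι_mul_swap (mulI n u) v]
    abel
  have h3 : ‖(1 / 2 : ℝ) • (u + v)‖ ≤ 1 := by
    rw [norm_smul]
    have := norm_add_le u v
    norm_num
    linarith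
  have h4 : F (ι ℝ u * ι ℝ (mulI n v) * y) - F (ι ℝ (mulI n u) * ι ℝ v * y) =
      4 * F (evVal n (elem ((1 / 2 : ℝ) • (u + v))) * y) - F (evVal n (elem u) * y) -
        F (evVal n (elem v) * y) := by
    rw [← map_sub, ← sub_mul, h2, h1, sub_mul, sub_mul, map_sub, map_sub, smul_mul_assoc,
      map_smul, smul_eq_mul]
  rw [h4]
  have h5 := abs_le.1 (hF _ h3)
  have h6 := abs_le.1 (hF _ hu)
  have h7 := abs_le.1 (hF _ hv)
  rw [abs_le]
  constructor <;> linarith [h5.1, h5.2, h6.1, h6.2, h7.1, h7.2]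

/-- The real part of `c` cancels, and its imaginary part multiplies the polarised difference. -/
lemma abs_rot_sub_le {F : Lam n →ₗ[ℝ] ℝ} {K : ℝ} {y : Lam n}
    (hF : ∀ w : Cn n, ‖w‖ ≤ 1 → |F (evVal n (elem w) * y)| ≤ K) {c : ℂ} (hc : ‖c‖ = 1)
    {u v : Cn n} (hu : ‖u‖ ≤ 1) (hv : ‖v‖ ≤ 1) :
    |F (ι ℝ u * ι ℝ (c • v) * y) - F (ι ℝ (c • u) * ι ℝ v * y)| ≤ 6 * K := by
  have h1 := abs_sub_le_of_polarized hF hu hv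
  have h2 : F (ι ℝ u * ι ℝ (c • v) * y) - F (ι ℝ (c • u) * ι ℝ v * y) =
      c.im * (F (ι ℝ u * ι ℝ (mulI n v) * y) - F (ι ℝ (mulI n u) * ι ℝ v * y)) := by
    rw [smul_eq_re_im, smul_eq_re_im]
    simp only [map_add, map_smul, mul_add, add_mul, mul_smul_comm, smul_mul_assoc, smul_eq_mul]
    ring
  rw [h2, abs_mul]
  have h3 : |c.im| ≤ 1 := hc ▸ Complex.abs_im_le_norm c
  calc |c.im| * _ ≤ 1 * (6 * K) := mul_le_mul h3 h1 (abs_nonneg _) zero_le_one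
    _ = 6 * K := one_mul _

/-- The rotations of the vectors of `l'` are transferred to `u` one at a time, each at cost `6 K`.
The list `l` collects the vectors already freed of their rotation. -/
lemma abs_move_rot_le {F : Lam n →ₗ[ℝ] ℝ} {K : ℝ} {N : ℕ}
    (hF : ∀ w : Cn n, ‖w‖ ≤ 1 → ∀ l : List (Cn n), l.length = N → (∀ v ∈ l, ‖v‖ ≤ 1) →
      |F (evVal n (elem w) * word l)| ≤ K) {c : ℂ} (hc : ‖c‖ = 1) (l' : List (Cn n)) :
    ∀ (u : Cn n) (l : List (Cn n)), ‖u‖ ≤ 1 → (∀ v ∈ l, ‖v‖ ≤ 1) → (∀ v ∈ l', ‖v‖ ≤ 1) →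
      l.length + l'.length = N + 1 →
      |F (ι ℝ u * word l * word (l'.map fun v => c • v)) -
        F (ι ℝ (c ^ l'.length • u) * word l * word l')| ≤ l'.length * (6 * K) := by
  induction l' with
  | nil => intro u l _ _ _ _; simp [word]
  | cons w l' ih =>
    intro u l hu hl hl' hlen
    have hw := hl' w (by simp)
    have hl'' : ∀ v ∈ l', ‖v‖ ≤ 1 := fun v hv => hl' v (by simp [hv])
    have hnorm : ∀ v : Cn n, ‖c • v‖ = ‖v‖ := fun v => by rw [norm_smul, hc, one_mul]
    have hcu : ‖c • u‖ ≤ 1 := by rwa [hnorm]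
    have h1 := ih (c • u) (l ++ [w]) hcu (by
      intro v hv
      rcases List.mem_append.1 hv with h | h
      · exact hl v h
      · rw [List.mem_singleton.1 h]; exact hw) hl'' (by simp at hlen ⊢; omega)
    have h2 := abs_rot_sub_le (F := F) (K := K) (y := word (l ++ l'.map fun v => c • v))
      (fun v hv => hF v hv _ (by simp at hlen ⊢; omega) (by
        intro x hx
        rcases List.mem_append.1 hx with h | h
        · exact hl x h
        · obtain ⟨z, hz, rfl⟩ := List.mem_map.1 h
          rw [hnorm]; exact hl'' z hz)) hc hu hw
    have e1 : ∀ a b : Cn n, ι ℝ a * word l * (ι ℝ b * word (l'.map fun v => c • v)) =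
        (-1 : ℝ) ^ l.length • (ι ℝ a * ι ℝ b * word (l ++ l'.map fun v => c • v)) := by
      intro a b
      rw [word_append, mul_assoc, ← mul_assoc (word l), word_mul_ι]
      simp only [smul_mul_assoc, mul_smul_comm, mul_assoc]
    have e2 : F (ι ℝ u * word l * word ((w :: l').map fun v => c • v)) =
        (-1 : ℝ) ^ l.length * F (ι ℝ u * ι ℝ (c • w) * word (l ++ l'.map fun v => c • v)) := by
      rw [List.map_cons, word_cons, e1, map_smul, smul_eq_mul]
    have e3 : F (ι ℝ (c • u) * word (l ++ [w]) * word (l'.map fun v => c • v)) =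
        (-1 : ℝ) ^ l.length * F (ι ℝ (c • u) * ι ℝ w * word (l ++ l'.map fun v => c • v)) := by
      have h := congrArg F (e1 (c • u) w)
      rw [F.map_smul, smul_eq_mul] at h
      rw [← h, word_append, word_cons]
      simp [word, mul_assoc]
    have e4 : F (ι ℝ (c ^ l'.length • c • u) * word (l ++ [w]) * word l') =
        F (ι ℝ (c ^ (w :: l').length • u) * word l * word (w :: l')) := by
      rw [smul_smul, ← pow_succ, List.length_cons, word_append, word_cons, word_cons]
      simp [word, mul_assoc]
    rw [e3, e4] at h1
    rw [e2]
    have h3 : |(-1 : ℝ) ^ l.length * F (ι ℝ u * ι ℝ (c • w) * word (l ++ l'.map fun v => c • v)) -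
        (-1 : ℝ) ^ l.length * F (ι ℝ (c • u) * ι ℝ w * word (l ++ l'.map fun v => c • v))| ≤
        6 * K := by
      rw [← mul_sub, abs_mul, abs_pow, abs_neg, abs_one, one_pow, one_mul]
      exact h2
    have h4 := abs_sub_le
      ((-1 : ℝ) ^ l.length * F (ι ℝ u * ι ℝ (c • w) * word (l ++ l'.map fun v => c • v)))
      ((-1 : ℝ) ^ l.length * F (ι ℝ (c • u) * ι ℝ w * word (l ++ l'.map fun v => c • v)))
      (F (ι ℝ (c ^ (w :: l').length • u) * word l * word (w :: l')))
    rw [List.length_cons]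
    push_cast
    rw [List.length_cons] at h4 h1
    linarith

/-- A rotation invariant functional is controlled by its values on elementary forms. -/
theorem exists_bound_words (n p : ℕ) : ∃ C : ℝ, 0 ≤ C ∧ ∀ (F : Lam n →ₗ[ℝ] ℝ) (B : ℝ),
    RotInvariant F (2 * p) →
    (∀ l : List (Cn n), l.length = p → (∀ v ∈ l, ‖v‖ ≤ 1) →
      |F (evVal n (l.map elem).prod)| ≤ B) →
    ∀ l : List (Cn n), l.length = 2 * p → (∀ v ∈ l, ‖v‖ ≤ 1) → |F (word l)| ≤ C * B := by
  induction p with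
  | zero =>
    refine ⟨1, zero_le_one, fun F B _ hB l hl _ => ?_⟩
    have h := hB [] rfl (by simp)
    have hnil : l = [] := List.length_eq_zero_iff.1 (by simpa using hl)
    rw [hnil, one_mul]
    simpa [word] using h
  | succ p ih =>
    obtain ⟨C, hC, ih⟩ := ih
    refine ⟨(2 * p + 1) * (6 * C) / 2, by positivity, fun F B hinv hB l hl hl1 => ?_⟩
    -- The induction hypothesis is applied to `y ↦ F (elem w * y)`, still rotation invariant because
    -- `elem w` is.
    have hF : ∀ w : Cn n, ‖w‖ ≤ 1 → ∀ l : List (Cn n), l.length = 2 * p → (∀ v ∈ l, ‖v‖ ≤ 1) →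
        |F (evVal n (elem w) * word l)| ≤ C * B := by
      intro w hw
      refine ih (F ∘ₗ LinearMap.mulLeft ℝ (evVal n (elem w))) B ?_ ?_
      · intro c hc l hl
        simp only [LinearMap.comp_apply, LinearMap.mulLeft_apply]
        have h := hinv c hc (w :: mulI n w :: l) (by simp [hl]; ring)
        simp only [List.map_cons, word_cons] at h
        rw [elem, coe_two, mul_assoc, mul_assoc, ← h, ← mul_assoc, ← mul_assoc]
        congr 2
        have h2 := congrArg (evVal n) (elem_rot hc w)
        rw [elem, elem, coe_two, coe_two] at h2
        rw [← h2, mulI_apply, mulI_apply, smul_comm]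
      · intro l hl hl1
        have h := hB (w :: l) (by simp [hl]) (by
          intro v hv
          rcases List.mem_cons.1 hv with rfl | h
          · exact hw
          · exact hl1 v h)
        simpa using h
    obtain ⟨u, l, rfl⟩ : ∃ u l', l = u :: l' := by
      cases l with
      | nil => simp at hl
      | cons u l' => exact ⟨u, l', rfl⟩
    -- The angle makes `c ^ (2 p + 2) = -1`. Rotating all vectors does not change `F`, while
    -- collecting all rotations on `u` changes the sign up to an error `(2 p + 1) * 6 C B`. Twice
    -- the value is therefore bounded by this error.
    set c : ℂ := Complex.exp ((Real.pi / (2 * p + 2) : ℝ) * Complex.I) with hcdef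
    have hc : ‖c‖ = 1 := Complex.norm_exp_ofReal_mul_I _
    have hlen : l.length = 2 * p + 1 := by simp at hl; omega
    have hcp : c ^ l.length * c = -1 := by
      rw [← pow_succ, hlen, hcdef, ← Complex.exp_nat_mul]
      have : ((2 * p + 1 + 1 : ℕ) : ℂ) * ((Real.pi / (2 * p + 2) : ℝ) * Complex.I) =
          Real.pi * Complex.I := by
        push_cast
        have h0 : (2 * (p : ℂ) + 2) ≠ 0 := by exact_mod_cast (by positivity : (2 * (p:ℝ) + 2) ≠ 0)
        field_simp
        ring
      rw [this, Complex.exp_pi_mul_I]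
    have hu : ‖c • u‖ ≤ 1 := by
      rw [norm_smul, hc, one_mul]; exact hl1 u (by simp)
    have h1 := abs_move_rot_le hF hc l (c • u) [] hu (by simp) (fun v hv => hl1 v (by simp [hv]))
      (by simp [hlen])
    rw [smul_smul, hcp] at h1
    have h2 := hinv c hc (u :: l) hl
    rw [List.map_cons, word_cons, word_cons] at h2
    have hw0 : word ([] : List (Cn n)) = 1 := by simp [word]
    rw [hw0, mul_one, mul_one, h2, neg_one_smul, map_neg, neg_mul, map_neg, sub_neg_eq_add, hlen]
      at h1
    rw [word_cons]
    have h3 : |F (ι ℝ u * word l) + F (ι ℝ u * word l)| = 2 * |F (ι ℝ u * word l)| := by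
      rw [← two_mul, abs_mul, abs_two]
    rw [h3] at h1
    push_cast at h1
    linarith

/-- Elementary factors are replaced by `β` one after another. Each replacement increases the value
because `β - elem v` is again `m`-positive and mixed products are nonnegative. -/
lemma tauE_elem_list_le {m : ℕ} (hmn : m ≤ n) (l : List (Cn n)) (hl : ∀ v ∈ l, ‖v‖ ≤ 1) :
    ∀ s : Multiset (Ev n), (∀ a ∈ s, a ∈ gam n m) → s.card + l.length ≤ m →
    |tauE n (beta n ^ (n - (s.card + l.length)) * s.prod * (l.map elem).prod)| ≤
      tauE n (beta n ^ (n - s.card) * s.prod) := by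
  induction l with
  | nil =>
    intro s hs hc
    simp only [List.length_nil, add_zero, List.map_nil, List.prod_nil, mul_one] at hc ⊢
    rw [abs_of_nonneg (tauE_mixed_nonneg hmn s hc hs)]
  | cons v l ih =>
    intro s hs hc
    rw [List.length_cons] at hc
    have hv := hl v (by simp)
    have h1 := ih (fun u hu => hl u (by simp [hu])) (elem v ::ₘ s) (by
      intro a ha
      rcases Multiset.mem_cons.1 ha with rfl | h
      · exact elem_mem_gam hmn v
      · exact hs a h) (by rw [Multiset.card_cons]; omega)
    have h2 := tauE_mixed_nonneg hmn ((beta n - elem v) ::ₘ s)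
      (by rw [Multiset.card_cons]; omega) (by
      intro a ha
      rcases Multiset.mem_cons.1 ha with rfl | h
      · exact beta_sub_elem_mem_gam hmn hv
      · exact hs a h)
    rw [Multiset.card_cons, Multiset.prod_cons] at h1 h2
    have e1 : beta n ^ (n - (s.card + (v :: l).length)) * s.prod * ((v :: l).map elem).prod =
        beta n ^ (n - (s.card + 1 + l.length)) * (elem v * s.prod) * (l.map elem).prod := by
      rw [List.length_cons, List.map_cons, List.prod_cons, show s.card + (l.length + 1) =
        s.card + 1 + l.length from by ring]
      ring
    have e2 : beta n ^ (n - (s.card + 1)) * ((beta n - elem v) * s.prod) =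
        beta n ^ (n - s.card) * s.prod - beta n ^ (n - (s.card + 1)) * (elem v * s.prod) := by
      rw [show n - s.card = n - (s.card + 1) + 1 from by omega, pow_succ]
      ring
    rw [e2, map_sub] at h2
    rw [e1]
    linarith

lemma norm_fr (i : Fin (2 * n)) : ‖fr n i‖ = 1 := by
  have h := inner_fr i i
  rw [if_pos rfl, real_inner_self_eq_norm_sq] at h
  nlinarith [norm_nonneg (fr n i)]

/-- The mass of `β^(n-k-p) ∧ a₁ ∧ ⋯ ∧ a_k` is controlled by its trace. -/
theorem exists_tau_mul_ιMulti_le (n p : ℕ) : ∃ C : ℝ, 0 ≤ C ∧ ∀ m ≤ n, ∀ s : Multiset (Ev n),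
    (∀ a ∈ s, a ∈ gam n m) → s.card + p ≤ m → ∀ I : Fin (2 * p) → Fin (2 * n),
    |tau n (evVal n (beta n ^ (n - (s.card + p)) * s.prod) * ιMulti ℝ (2 * p) fun i => fr n (I i))|
      ≤ C * tauE n (beta n ^ (n - s.card) * s.prod) := by
  obtain ⟨C, hC, h⟩ := exists_bound_words n p
  refine ⟨C, hC, fun m hmn s hs hc I => ?_⟩
  set Ω := beta n ^ (n - (s.card + p)) * s.prod with hΩ
  rw [ιMulti_eq_word]
  refine h (tau n ∘ₗ LinearMap.mulLeft ℝ (evVal n Ω)) _ ?_ ?_ _ (by simp) ?_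
  · intro c hc' l hl
    simp only [LinearMap.comp_apply, LinearMap.mulLeft_apply]
    have h1 : evVal n Ω ∈ homog n (2 * (n - (s.card + p)) + 2 * s.card) := by
      rw [hΩ, map_mul]
      exact mul_mem_homog (pow_mem_homog beta_mem_homog _)
        (multiset_prod_mem_homog s fun a ha => Herm_mem_homog (hs a ha).1)
    have h2 := mul_mem_homog h1 (word_mem_homog l)
    rw [hl, show 2 * (n - (s.card + p)) + 2 * s.card + 2 * p = 2 * n from by omega] at h2
    have h3 := tau_map_rot hc' h2
    have h4 : ExteriorAlgebra.map (rot n c) (evVal n Ω) = evVal n Ω := by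
      rw [hΩ, map_mul, map_pow, map_mul, map_pow, map_rot_Herm hc' beta_mem_Herm,
        map_rot_multiset_prod hc' s fun a ha => (hs a ha).1]
    have h5 : ExteriorAlgebra.map (rot n c) (word l) = word (l.map fun v => c • v) := by
      rw [word, word, map_list_prod, List.map_map, List.map_map]
      congr 1
      refine List.map_congr_left fun v _ => ?_
      simp [rot_apply]
    rw [map_mul, h4, h5] at h3
    exact h3
  · intro l hl hl1
    simp only [LinearMap.comp_apply, LinearMap.mulLeft_apply]
    rw [← map_mul, ← tauE_apply]
    have := tauE_elem_list_le hmn l hl1 s hs (by omega)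
    rwa [hl] at this
  · intro v hv
    obtain ⟨i, rfl⟩ := (List.mem_ofFn' _ _).1 hv
    exact (norm_fr _).le

theorem exists_tau_mul_hat_le (n p : ℕ) : ∃ C : ℝ, 0 ≤ C ∧ ∀ m ≤ n, ∀ s : Multiset (Ev n),
    (∀ a ∈ s, a ∈ gam n m) → s.card + p ≤ m → ∀ η : Covec n (2 * p),
    |tau n (evVal n (beta n ^ (n - (s.card + p)) * s.prod) * hat η.toAlternatingMap)|
      ≤ C * ‖η‖ * tauE n (beta n ^ (n - s.card) * s.prod) := by
  obtain ⟨C, hC, h⟩ := exists_tau_mul_ιMulti_le n p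
  refine ⟨(((2 * p).factorial : ℝ)⁻¹ * Fintype.card (Fin (2 * p) → Fin (2 * n))) * C,
    by positivity, fun m hmn s hs hc η => ?_⟩
  rw [hat_apply, mul_smul_comm, map_smul, smul_eq_mul, abs_mul, abs_of_nonneg (by positivity),
    Finset.mul_sum, map_sum]
  set Q := tauE n (beta n ^ (n - s.card) * s.prod)
  have h1 : ∀ I : Fin (2 * p) → Fin (2 * n), |tau n (evVal n (beta n ^ (n - (s.card + p)) * s.prod) *
      (η.toAlternatingMap (fun i => fr n (I i)) • ιMulti ℝ (2 * p) fun i => fr n (I i)))| ≤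
      ‖η‖ * (C * Q) := by
    intro I
    rw [mul_smul_comm, map_smul, smul_eq_mul, abs_mul]
    refine mul_le_mul ?_ (h m hmn s hs hc I) (abs_nonneg _) (norm_nonneg _)
    have h2 := η.le_opNorm fun i => fr n (I i)
    simp only [norm_fr, Finset.prod_const_one, mul_one] at h2
    exact h2
  calc _ ≤ ((2 * p).factorial : ℝ)⁻¹ * ∑ I : Fin (2 * p) → Fin (2 * n), ‖η‖ * (C * Q) := by
        refine mul_le_mul_of_nonneg_left ?_ (by positivity)
        exact (Finset.abs_sum_le_sum_abs _ _).trans (Finset.sum_le_sum fun I _ => h1 I)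
    _ = _ := by
        rw [Finset.sum_const, Finset.card_univ, nsmul_eq_mul]
        ring

end Invariance

/-! ### Differential forms and the exterior algebra -/

section FormCalculus

open ExteriorAlgebra

variable {n : ℕ}

lemma Rep_sum {d : ℕ} {κ : Type*} (s : Finset κ) {x : κ → Lam n}
    {η : κ → Cn n [⋀^Fin d]→ₗ[ℝ] ℝ} (h : ∀ i ∈ s, (x i, η i) ∈ Rep n d) :
    (∑ i ∈ s, x i, ∑ i ∈ s, η i) ∈ Rep n d := by
  have h1 := (Rep n d).sum_mem h
  rwa [show ∑ i ∈ s, (x i, η i) = (∑ i ∈ s, x i, ∑ i ∈ s, η i) from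
    Prod.ext (by simp [Prod.fst_sum]) (by simp [Prod.snd_sum])] at h1

lemma Rep_smul {d : ℕ} (c : ℝ) {x : Lam n} {η : Cn n [⋀^Fin d]→ₗ[ℝ] ℝ} (h : (x, η) ∈ Rep n d) :
    (c • x, c • η) ∈ Rep n d := (Rep n d).smul_mem c h

lemma Rep_induction {d e : ℕ} (f : Lam n →ₗ[ℝ] Lam n)
    (g : (Cn n [⋀^Fin d]→ₗ[ℝ] ℝ) →ₗ[ℝ] (Cn n [⋀^Fin e]→ₗ[ℝ] ℝ))
    (h : ∀ l : Fin d → Cn n, (f (ιMulti ℝ d l), g (mono l)) ∈ Rep n e) {x : Lam n}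
    {η : Cn n [⋀^Fin d]→ₗ[ℝ] ℝ} (hx : (x, η) ∈ Rep n d) : (f x, g η) ∈ Rep n e := by
  have hle : Rep n d ≤ (Rep n e).comap (f.prodMap g) := by
    refine Submodule.span_le.2 ?_
    rintro _ ⟨l, rfl⟩
    exact h l
  exact hle hx

/-- Laplace expansion along the first row. -/
lemma alternatizeUncurryFin_mono {d : ℕ} (v : Cn n) (l : Fin d → Cn n) :
    AlternatingMap.alternatizeUncurryFin ((innerₗ (Cn n) v).smulRight (mono l)) =
      mono (Fin.cons v l : Fin (d + 1) → Cn n) := by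
  ext u
  rw [AlternatingMap.alternatizeUncurryFin_apply, mono_eq_det, Matrix.det_succ_row_zero]
  refine Finset.sum_congr rfl fun i _ => ?_
  rw [LinearMap.smulRight_apply, AlternatingMap.smul_apply, mono_eq_det, zsmul_eq_mul, smul_eq_mul,
    ← mul_assoc]
  push_cast
  rfl

lemma Rep_alternatizeUncurryFin_smulRight {d : ℕ} (v : Cn n) {x : Lam n}
    {η : Cn n [⋀^Fin d]→ₗ[ℝ] ℝ} (h : (x, η) ∈ Rep n d) :
    (ι ℝ v * x, AlternatingMap.alternatizeUncurryFin ((innerₗ (Cn n) v).smulRight η)) ∈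
      Rep n (d + 1) := by
  refine Rep_induction (LinearMap.mulLeft ℝ (ι ℝ v))
    (AlternatingMap.alternatizeUncurryFinLM ∘ₗ LinearMap.smulRightₗ (innerₗ (Cn n) v))
    (fun l => ?_) h
  rw [LinearMap.mulLeft_apply, LinearMap.comp_apply]
  change (_, AlternatingMap.alternatizeUncurryFin ((innerₗ (Cn n) v).smulRight (mono l))) ∈ _
  rw [alternatizeUncurryFin_mono]
  have := ιMulti_mem_Rep (n := n) (Fin.cons v l : Fin (d + 1) → Cn n)
  rw [ιMulti_succ_apply] at this
  simpa [Matrix.vecTail, Function.comp_def] using this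

/-- The formula `d = ∑ f_a ∧ ∂_a`, obtained by expanding the differentiated direction in the frame.
-/
lemma Rep_alternatizeUncurryFin {d : ℕ} (L : Cn n →L[ℝ] Covec n d) {x : Fin (2 * n) → Lam n}
    (h : ∀ a, (x a, (L (fr n a)).toAlternatingMap) ∈ Rep n d) :
    (∑ a, ι ℝ (fr n a) * x a,
      (ContinuousAlternatingMap.alternatizeUncurryFin L).toAlternatingMap) ∈ Rep n (d + 1) := by
  have h1 := Rep_sum Finset.univ fun a _ => Rep_alternatizeUncurryFin_smulRight (fr n a) (h a)
  convert h1 using 2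
  ext u
  have hsum : ∀ (s : Finset (Fin (2 * n)))
      (g : Fin (2 * n) → Cn n [⋀^Fin (d + 1)]→ₗ[ℝ] ℝ), (∑ I ∈ s, g I) u = ∑ I ∈ s, g I u :=
    fun s g => map_sum ({ toFun := fun A => A u, map_add' := fun _ _ => rfl, map_zero' := rfl } :
      (Cn n [⋀^Fin (d + 1)]→ₗ[ℝ] ℝ) →+ ℝ) g s
  rw [hsum]
  simp only [AlternatingMap.alternatizeUncurryFin_apply, LinearMap.smulRight_apply,
    AlternatingMap.smul_apply]
  rw [Finset.sum_comm]
  change ContinuousAlternatingMap.alternatizeUncurryFin L u = _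
  rw [ContinuousAlternatingMap.alternatizeUncurryFin_apply]
  refine Finset.sum_congr rfl fun i _ => ?_
  rw [← Finset.smul_sum]
  congr 1
  conv_lhs => rw [← isParseval_fr (u i)]
  rw [map_sum, ContinuousAlternatingMap.sum_apply]
  refine Finset.sum_congr rfl fun a _ => ?_
  rw [map_smul]
  rfl

lemma mono_compLinearMap {d : ℕ} {R S : Cn n →ₗ[ℝ] Cn n}
    (hRS : ∀ u v, (inner ℝ u (R v) : ℝ) = inner ℝ (S u) v) (l : Fin d → Cn n) :
    (mono l).compLinearMap R = mono fun i => S (l i) := by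
  ext u
  rw [AlternatingMap.compLinearMap_apply, mono_apply, mono_apply]
  simp only [hRS]

/-- A vector `v` stands for the covector `⟨v, ·⟩`, so pullback by `R` acts on vectors through the
adjoint `S`. -/
lemma Rep_comp {d : ℕ} {R S : Cn n →ₗ[ℝ] Cn n}
    (hRS : ∀ u v, (inner ℝ u (R v) : ℝ) = inner ℝ (S u) v) {x : Lam n}
    {η : Cn n [⋀^Fin d]→ₗ[ℝ] ℝ} (h : (x, η) ∈ Rep n d) :
    (ExteriorAlgebra.map S x, η.compLinearMap R) ∈ Rep n d := by
  refine Rep_induction (ExteriorAlgebra.map S).toLinearMap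
    { toFun := fun η => η.compLinearMap R
      map_add' := fun _ _ => rfl
      map_smul' := fun _ _ => rfl } (fun l => ?_) h
  rw [AlgHom.toLinearMap_apply, map_apply_ιMulti]
  change (_, (mono l).compLinearMap R) ∈ _
  rw [mono_compLinearMap hRS]
  exact ιMulti_mem_Rep _

/-! ### The operators `dᶜ` and `ddᶜ` in the frame -/

lemma fderiv_const_clm_apply {E : Type*} [NormedAddCommGroup E] [NormedSpace ℝ E]
    (F G : Type*)
    [NormedAddCommGroup F] [NormedSpace ℝ F] [NormedAddCommGroup G] [NormedSpace ℝ G]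
    (L : F →L[ℝ] G) {f : E → F} {z : E} (h : DifferentiableAt ℝ f z) :
    fderiv ℝ (fun y => L (f y)) z = L ∘L fderiv ℝ f z :=
  (L.hasFDerivAt.comp z h.hasFDerivAt).fderiv

/-- The operator `dᶜ` acting on the differential. -/
def dcLin (n d : ℕ) : (Cn n →L[ℝ] Covec n d) →L[ℝ] Covec n (d + 1) :=
  (1 / 4 : ℝ) • (ContinuousAlternatingMap.compContinuousLinearMapCLM (-mulI n) ∘L
    ContinuousAlternatingMap.alternatizeUncurryFinCLM ℝ (Cn n) ℝ ∘L
    (ContinuousLinearMap.compL ℝ (Cn n) (Covec n d) (Covec n d)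
      (ContinuousAlternatingMap.compContinuousLinearMapCLM (mulI n))))

lemma dc_eq {d : ℕ} {ψ : Form n d} {z : Cn n} (hψ : DifferentiableAt ℝ ψ z) :
    dc ψ z = dcLin n d (fderiv ℝ ψ z) := by
  unfold dc extDeriv
  have h : fderiv ℝ (fun y => (ψ y).compContinuousLinearMap (mulI n)) z =
      (ContinuousAlternatingMap.compContinuousLinearMapCLM (mulI n) :
        Covec n d →L[ℝ] Covec n d) ∘L fderiv ℝ ψ z :=
    fderiv_const_clm_apply (Covec n d) (Covec n d)
      (ContinuousAlternatingMap.compContinuousLinearMapCLM (mulI n)) hψ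
  rw [h]
  rfl

/-- The inner and outer pullbacks act by `-J` and `J`, which cancel on the coefficients. Only the
new covector keeps a `J`, so that `dᶜ = (1/4) ∑ J f_a ∧ ∂_a`. -/
lemma Rep_dcLin {d : ℕ} (L : Cn n →L[ℝ] Covec n d) {x : Fin (2 * n) → Lam n}
    (h : ∀ a, (x a, (L (fr n a)).toAlternatingMap) ∈ Rep n d) :
    ((1 / 4 : ℝ) • ∑ a, ι ℝ (mulI n (fr n a)) * x a, (dcLin n d L).toAlternatingMap) ∈
      Rep n (d + 1) := by
  have h1 : ∀ a, (ExteriorAlgebra.map (-(mulI n : Cn n →ₗ[ℝ] Cn n)) (x a),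
      ((L (fr n a)).compContinuousLinearMap (mulI n)).toAlternatingMap) ∈ Rep n d := fun a =>
    Rep_comp (R := (mulI n : Cn n →ₗ[ℝ] Cn n)) (fun u v => by
      have := inner_mulI_left u v
      simp [this]) (h a)
  have h2 := Rep_alternatizeUncurryFin
    ((ContinuousAlternatingMap.compContinuousLinearMapCLM (mulI n) :
        Covec n d →L[ℝ] Covec n d) ∘L L) h1
  have h3 := Rep_smul (1 / 4 : ℝ) (Rep_comp (R := (-(mulI n : Cn n →ₗ[ℝ] Cn n)))
    (S := (mulI n : Cn n →ₗ[ℝ] Cn n)) (fun u v => by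
      have := inner_mulI_left u v
      simp [this]) h2)
  convert h3 using 2
  swap
  · rfl
  rw [map_sum]
  congr 1
  refine Finset.sum_congr rfl fun a _ => ?_
  rw [map_mul, map_apply_ι, ← AlgHom.comp_apply, map_comp_map]
  congr 1
  have : (mulI n : Cn n →ₗ[ℝ] Cn n) ∘ₗ (-(mulI n : Cn n →ₗ[ℝ] Cn n)) = LinearMap.id := by
    ext1 v
    simp [mulI_mulI]
  rw [this, map_id]
  rfl

lemma two_le_infty : minSmoothness ℝ 2 ≤ (∞ : WithTop ℕ∞) := by
  rw [minSmoothness_of_isRCLikeNormedField]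
  exact WithTop.coe_le_coe.2 (le_top : (2 : ℕ∞) ≤ ⊤)

/-- The directional derivative in the direction `v`. -/
def pd (v : Cn n) (f : Cn n → ℝ) (z : Cn n) : ℝ := fderiv ℝ f z v

/-- The element of the exterior algebra representing `ddᶜ w`. -/
def hess (w : Cn n → ℝ) (z : Cn n) : Ev n :=
  (1 / 4 : ℝ) • ∑ a, ∑ b, pd (fr n a) (pd (fr n b) w) z • two (fr n a) (mulI n (fr n b))

/-- The coefficients of a form in the frame. -/
def coef {d : ℕ} (ψ : Form n d) (I : Fin d → Fin (2 * n)) (z : Cn n) : ℝ :=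
  ψ z fun i => fr n (I i)

/-- Evaluation of covectors as a continuous linear map. -/
def evalCLM {d : ℕ} (v : Fin d → Cn n) : Covec n d →L[ℝ] ℝ :=
  ContinuousAlternatingMap.apply ℝ (Cn n) ℝ v

lemma coef_eq {d : ℕ} (ψ : Form n d) (I : Fin d → Fin (2 * n)) :
    coef ψ I = fun z => evalCLM (fun i => fr n (I i)) (ψ z) := rfl

lemma contDiff_coef {d : ℕ} {ψ : Form n d} {r : WithTop ℕ∞} (hψ : ContDiff ℝ r ψ)
    (I : Fin d → Fin (2 * n)) : ContDiff ℝ r (coef ψ I) :=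
  (evalCLM _).contDiff.comp hψ

lemma contDiff_pd {f : Cn n → ℝ} (hf : ContDiff ℝ ∞ f) (v : Cn n) : ContDiff ℝ ∞ (pd v f) :=
  (hf.fderiv_right (m := ∞) (by simp)).clm_apply contDiff_const

lemma pd_pd_eq {f : Cn n → ℝ} (hf : ContDiff ℝ ∞ f) (u v z : Cn n) :
    pd u (pd v f) z = fderiv ℝ (fderiv ℝ f) z u v := by
  have h1 : DifferentiableAt ℝ (fderiv ℝ f) z :=
    ((hf.fderiv_right (m := ∞) (by simp)).differentiable (by simp)) z
  unfold pd
  rw [fderiv_clm_apply h1 (differentiableAt_const v)]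
  simp

lemma pd_comm {f : Cn n → ℝ} (hf : ContDiff ℝ ∞ f) (u v : Cn n) :
    pd u (pd v f) = pd v (pd u f) := by
  funext z
  rw [pd_pd_eq hf, pd_pd_eq hf]
  exact (hf.contDiffAt.isSymmSndFDerivAt two_le_infty) u v

lemma hat_snd_deriv {d : ℕ} {ψ : Form n d} (hψ : ContDiff ℝ ∞ ψ) (z u v : Cn n) :
    hat (fderiv ℝ (fderiv ℝ ψ) z u v).toAlternatingMap = ((d.factorial : ℝ)⁻¹) •
      ∑ I : Fin d → Fin (2 * n), pd u (pd v (coef ψ I)) z • ιMulti ℝ d (fun i => fr n (I i)) := by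
  rw [hat_apply]
  congr 1
  refine Finset.sum_congr rfl fun I _ => ?_
  congr 1
  set e := evalCLM (fun i => fr n (I i)) with he
  have h1 : fderiv ℝ (coef ψ I) = fun y => e ∘L fderiv ℝ ψ y := by
    funext y
    rw [coef_eq]
    exact (e.hasFDerivAt.comp y
      ((hψ.differentiable (by simp)) y).hasFDerivAt).fderiv
  have h2 : DifferentiableAt ℝ (fderiv ℝ ψ) z :=
    ((hψ.fderiv_right (m := ∞) (by simp)).differentiable (by simp)) z
  rw [pd_pd_eq (contDiff_coef hψ I), h1]
  have h4 : fderiv ℝ (fun y => e ∘L fderiv ℝ ψ y) z =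
      (ContinuousLinearMap.compL ℝ (Cn n) (Covec n d) ℝ e) ∘L fderiv ℝ (fderiv ℝ ψ) z :=
    fderiv_const_clm_apply (Cn n →L[ℝ] Covec n d) (Cn n →L[ℝ] ℝ)
      (ContinuousLinearMap.compL ℝ (Cn n) (Covec n d) ℝ e) h2
  rw [h4]
  rfl

/-- The element of the exterior algebra representing `ddᶜ ψ`. -/
def ddcHat {d : ℕ} (ψ : Form n d) (z : Cn n) : Lam n :=
  ((d.factorial : ℝ)⁻¹) • ∑ I : Fin d → Fin (2 * n),
    evVal n (hess (coef ψ I) z) * ιMulti ℝ d (fun i => fr n (I i))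

lemma Rep_ddc {d : ℕ} {ψ : Form n d} (hψ : ContDiff ℝ ∞ ψ) (z : Cn n) :
    (ddcHat ψ z, (ddc ψ z).toAlternatingMap) ∈ Rep n (d + 2) := by
  have h1 : dc ψ = fun y => dcLin n d (fderiv ℝ ψ y) :=
    funext fun y => dc_eq ((hψ.differentiable (by simp)) y)
  have h2 : DifferentiableAt ℝ (fderiv ℝ ψ) z :=
    ((hψ.fderiv_right (m := ∞) (by simp)).differentiable (by simp)) z
  have h3 : fderiv ℝ (dc ψ) z = dcLin n d ∘L fderiv ℝ (fderiv ℝ ψ) z := by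
    rw [h1, fderiv_const_clm_apply (Cn n →L[ℝ] Covec n d) (Covec n (d + 1)) (dcLin n d) h2]
  have h4 : ∀ a, ((1 / 4 : ℝ) • ∑ b, ι ℝ (mulI n (fr n b)) *
      hat (fderiv ℝ (fderiv ℝ ψ) z (fr n a) (fr n b)).toAlternatingMap,
      (fderiv ℝ (dc ψ) z (fr n a)).toAlternatingMap) ∈ Rep n (d + 1) := by
    intro a
    rw [h3]
    exact Rep_dcLin _ fun b => hat_mem_Rep _
  have h5 := Rep_alternatizeUncurryFin (fderiv ℝ (dc ψ) z) h4
  convert h5 using 2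
  swap
  · rfl
  simp only [hat_snd_deriv hψ, ddcHat, hess]
  simp only [map_smul, map_sum, mul_smul_comm, smul_mul_assoc, Finset.smul_sum, Finset.mul_sum,
    Finset.sum_mul, coe_two]
  rw [Finset.sum_comm]
  refine Finset.sum_congr rfl fun a _ => ?_
  rw [Finset.sum_comm]
  refine Finset.sum_congr rfl fun b _ => Finset.sum_congr rfl fun I _ => ?_
  rw [← mul_assoc]
  simp only [smul_smul]
  congr 1
  ring

lemma Rep_ddcFun {f : Cn n → ℝ} (hf : ContDiff ℝ ∞ f) (z : Cn n) :
    (evVal n (hess f z), ddcFun f z) ∈ Rep n 2 := by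
  have hz : ContDiff ℝ ∞ (zeroForm f : Form n 0) := by
    unfold zeroForm
    exact (ContinuousAlternatingMap.constOfIsEmptyLIE ℝ (Cn n) ℝ (Fin 0)).contDiff.comp hf
  have h := Rep_ddc hz z
  have h1 : ddcHat (zeroForm f : Form n 0) z = evVal n (hess f z) := by
    rw [ddcHat, Fintype.sum_unique, ιMulti_zero_apply, mul_one, Nat.factorial_zero, Nat.cast_one,
      inv_one, one_smul]
    rfl
  rwa [h1] at h

lemma Rep_wedgeProd : ∀ (j : ℕ) (x : Fin j → Ev n) (α : Fin j → Cn n [⋀^Fin 2]→ₗ[ℝ] ℝ),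
    (∀ i, (evVal n (x i), α i) ∈ Rep n 2) → (evVal n (∏ i, x i), wedgeProd j α) ∈ Rep n (2 * j)
  | 0, x, α, _ => by
    have h := ιMulti_mem_Rep (n := n) (d := 0) Fin.elim0
    rw [ιMulti_zero_apply] at h
    rw [Fin.prod_univ_zero, map_one]
    convert h using 2
    ext u
    rw [mono_apply]
    simp [wedgeProd]
  | j + 1, x, α, h => by
    rw [Fin.prod_univ_castSucc, map_mul]
    exact Rep_wedge (Rep_wedgeProd j (fun i => x i.castSucc) (Fin.init α) fun i => h i.castSucc)
      (h (Fin.last j))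

/-! ### Hessians -/

lemma sum_two_eq_hop (S : Cn n →ₗ[ℝ] Cn n) :
    ∑ a, ∑ b, (inner ℝ (fr n b) (S (fr n a)) : ℝ) • two (fr n a) (mulI n (fr n b)) =
      (2 : ℝ) • hop S := by
  rw [hop_apply, smul_smul, mul_one_div_cancel two_ne_zero, one_smul]
  refine Finset.sum_congr rfl fun a _ => ?_
  conv_rhs => rw [← isParseval_fr (S (fr n a))]
  simp only [map_sum, map_smul]

/-- The Hessian operator. -/
def hessOp (w : Cn n → ℝ) (z : Cn n) : Cn n →ₗ[ℝ] Cn n :=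
  ∑ b, ((fderiv ℝ (fderiv ℝ w) z).flip (fr n b) : Cn n →ₗ[ℝ] ℝ).smulRight (fr n b)

lemma inner_hessOp {w : Cn n → ℝ} (z u v : Cn n) :
    inner ℝ v (hessOp w z u) = fderiv ℝ (fderiv ℝ w) z u v := by
  conv_rhs => rw [← isParseval_fr v]
  rw [hessOp, LinearMap.sum_apply, inner_sum, map_sum]
  refine Finset.sum_congr rfl fun b _ => ?_
  rw [map_smul, LinearMap.smulRight_apply, real_inner_smul_right, real_inner_comm, smul_eq_mul,
    mul_comm]
  rfl

lemma hessOp_isSymmetric {w : Cn n → ℝ} (hw : ContDiff ℝ ∞ w) (z : Cn n) :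
    (hessOp w z).IsSymmetric := by
  intro u v
  rw [inner_hessOp, real_inner_comm, inner_hessOp]
  exact (hw.contDiffAt.isSymmSndFDerivAt two_le_infty) u v

lemma hess_eq_hop {w : Cn n → ℝ} (hw : ContDiff ℝ ∞ w) (z : Cn n) :
    hess w z = (1 / 2 : ℝ) • hop (hessOp w z) := by
  have h := sum_two_eq_hop (hessOp w z)
  simp only [inner_hessOp] at h
  rw [hess]
  simp only [pd_pd_eq hw]
  rw [h, smul_smul]
  norm_num

lemma hess_mem_Herm {w : Cn n → ℝ} (hw : ContDiff ℝ ∞ w) (z : Cn n) : hess w z ∈ Herm n := by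
  rw [hess_eq_hop hw]
  exact (Herm n).smul_mem _ (hop_mem_Herm (hessOp_isSymmetric hw z))

/-- The quadratic function with operator `T`. -/
def quad (T : Cn n →ₗ[ℝ] Cn n) (z : Cn n) : ℝ := inner ℝ z (T z)

lemma contDiff_quad (T : Cn n →ₗ[ℝ] Cn n) : ContDiff ℝ ∞ (quad T) :=
  contDiff_id.inner ℝ (LinearMap.toContinuousLinearMap T).contDiff

lemma pd_quad {T : Cn n →ₗ[ℝ] Cn n} (hT : T.IsSymmetric) (v z : Cn n) :
    pd v (quad T) z = 2 * inner ℝ v (T z) := by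
  have h := (hasFDerivAt_id (𝕜 := ℝ) z).inner ℝ (LinearMap.toContinuousLinearMap T).hasFDerivAt
    (x := z)
  have h2 : HasFDerivAt (quad T) _ z := h
  rw [pd, h2.fderiv]
  simp
  rw [← hT z v, real_inner_comm]
  ring

/-- Every form in `Herm n` is thus the constant `ddᶜ` of a quadratic function; such functions serve
as the competitors in the definition of `m`-sh. -/
lemma hess_quad {T : Cn n →ₗ[ℝ] Cn n} (hT : T.IsSymmetric) (z : Cn n) :
    hess (quad T) z = hop T := by
  have h1 : ∀ a b, pd (fr n a) (pd (fr n b) (quad T)) z =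
      2 * inner ℝ (fr n b) (T (fr n a)) := by
    intro a b
    have h2 : pd (fr n b) (quad T) = fun y => 2 * inner ℝ (fr n b) (T y) :=
      funext fun y => pd_quad hT _ y
    rw [h2, pd]
    have h3 : HasFDerivAt (fun y => 2 * inner ℝ (fr n b) (T y))
        ((2 : ℝ) • (innerSL ℝ (fr n b) ∘L LinearMap.toContinuousLinearMap T)) z :=
      ((2 : ℝ) • (innerSL ℝ (fr n b) ∘L LinearMap.toContinuousLinearMap T)).hasFDerivAt
    rw [h3.fderiv]
    simp
  rw [hess]
  simp only [h1, mul_smul]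
  simp only [← Finset.smul_sum]
  rw [sum_two_eq_hop, smul_smul, smul_smul]
  norm_num

lemma hess_norm_sq (z : Cn n) : hess (fun w : Cn n => ‖w‖ ^ 2) z = beta n := by
  have h : (fun w : Cn n => ‖w‖ ^ 2) = quad LinearMap.id := by
    funext w
    rw [quad, LinearMap.id_apply, real_inner_self_eq_norm_sq]
  rw [h, hess_quad LinearMap.IsSymmetric.id, beta]

lemma contDiff_norm_sq' : ContDiff ℝ ∞ (fun w : Cn n => ‖w‖ ^ 2) := contDiff_norm_sq ℝ

lemma Rep_betaPow (q : ℕ) (z : Cn n) : (evVal n (beta n ^ q), betaPow q z) ∈ Rep n (2 * q) := by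
  have h := Rep_wedgeProd q (fun _ => beta n) (fun _ => ddcFun (fun w : Cn n => ‖w‖ ^ 2) z)
    fun _ => by
      have := Rep_ddcFun (n := n) contDiff_norm_sq' z
      rwa [hess_norm_sq] at this
  rw [Finset.prod_const, Finset.card_univ, Fintype.card_fin] at h
  exact h

/-- The gradient. -/
def gradVec (w : Cn n → ℝ) (z : Cn n) : Cn n := ∑ a, pd (fr n a) w z • fr n a

lemma two_gradVec (w : Cn n → ℝ) (z : Cn n) :
    elem (gradVec w z) =
      ∑ a, ∑ b, (pd (fr n a) w z * pd (fr n b) w z) • two (fr n a) (mulI n (fr n b)) := by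
  rw [elem, gradVec]
  simp only [map_sum, map_smul, LinearMap.sum_apply, LinearMap.smul_apply, Finset.smul_sum,
    smul_smul]
  rw [Finset.sum_comm]
  simp only [mul_comm]

lemma pd_mul {f g : Cn n → ℝ} (hf : ContDiff ℝ ∞ f) (hg : ContDiff ℝ ∞ g) (v z : Cn n) :
    pd v (fun y => f y * g y) z = f z * pd v g z + g z * pd v f z := by
  unfold pd
  rw [fderiv_fun_mul ((hf.differentiable (by simp)) z) ((hg.differentiable (by simp)) z)]
  simp

lemma pd_comp {f : Cn n → ℝ} (hf : ContDiff ℝ ∞ f) {χ : ℝ → ℝ} (hχ : ContDiff ℝ ∞ χ)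
    (v z : Cn n) : pd v (fun y => χ (f y)) z = deriv χ (f z) * pd v f z := by
  unfold pd
  have h := ((hχ.differentiable (by simp)) (f z)).hasDerivAt.comp_hasFDerivAt z
    ((hf.differentiable (by simp)) z).hasFDerivAt
  have h2 : HasFDerivAt (fun y => χ (f y)) (deriv χ (f z) • fderiv ℝ f z) z := h
  rw [h2.fderiv]
  simp

lemma contDiff_deriv {χ : ℝ → ℝ} (hχ : ContDiff ℝ ∞ χ) : ContDiff ℝ ∞ (deriv χ) :=
  (contDiff_infty_iff_deriv.1 hχ).2

/-- Chain rule `ddᶜ χ(f) = χ' ddᶜ f + χ'' df ∧ dᶜf`, with `df ∧ dᶜf` written as `(1/4) elem (∇f)`: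
the sign of its contribution is that of `χ''`. -/
lemma hess_comp {f : Cn n → ℝ} (hf : ContDiff ℝ ∞ f) {χ : ℝ → ℝ} (hχ : ContDiff ℝ ∞ χ)
    (z : Cn n) : hess (fun y => χ (f y)) z =
      deriv χ (f z) • hess f z + (1 / 4 * deriv (deriv χ) (f z)) • elem (gradVec f z) := by
  have h1 : ∀ u v, pd u (pd v fun y => χ (f y)) z =
      deriv χ (f z) * pd u (pd v f) z + deriv (deriv χ) (f z) * (pd u f z * pd v f z) := by
    intro u v
    have h2 : pd v (fun y => χ (f y)) = fun y => deriv χ (f y) * pd v f y :=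
      funext fun y => pd_comp hf hχ v y
    rw [h2, pd_mul (f := fun y => deriv χ (f y)) ((contDiff_deriv hχ).comp hf) (contDiff_pd hf v),
      pd_comp hf (contDiff_deriv hχ)]
    ring
  rw [two_gradVec, hess, hess]
  simp only [h1, add_smul, Finset.sum_add_distrib, smul_add, mul_smul]
  simp only [← Finset.smul_sum]
  rw [smul_comm (deriv χ (f z))]

end FormCalculus

/-! ### Integration by parts -/

section Parts

open ExteriorAlgebra

variable {n : ℕ}

/-- Products of Hessians. -/
def hprod (W : Multiset (Cn n → ℝ)) (z : Cn n) : Ev n := (W.map fun w => hess w z).prod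

lemma hprod_zero (z : Cn n) : hprod 0 z = 1 := rfl

lemma hprod_cons (w : Cn n → ℝ) (W : Multiset (Cn n → ℝ)) (z : Cn n) :
    hprod (w ::ₘ W) z = hess w z * hprod W z := by
  rw [hprod, Multiset.map_cons, Multiset.prod_cons]
  rfl

/-- The functional `y ↦ τ (y ∧ x)`. -/
def tauL (x : Lam n) : Ev n →ₗ[ℝ] ℝ :=
  tau n ∘ₗ LinearMap.mulRight ℝ x ∘ₗ (evVal n).toLinearMap

lemma tauL_apply (x : Lam n) (y : Ev n) : tauL x y = tau n (evVal n y * x) := rfl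

lemma tauL_mul (x : Lam n) (c y : Ev n) : tauL x (c * y) = tauL (evVal n c * x) y := by
  rw [tauL_apply, tauL_apply, mul_comm c y, map_mul (evVal n), mul_assoc]

lemma map_hess_mul (L : Ev n →ₗ[ℝ] ℝ) (w : Cn n → ℝ) (z : Cn n) (Y : Ev n) :
    L (hess w z * Y) = ∑ a, ∑ b, 1 / 4 * (pd (fr n a) (pd (fr n b) w) z *
      L (two (fr n a) (mulI n (fr n b)) * Y)) := by
  simp only [hess, smul_mul_assoc, Finset.sum_mul, map_smul, map_sum, smul_eq_mul, Finset.mul_sum]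

lemma contDiff_hprod {W : Multiset (Cn n → ℝ)} (hW : ∀ w ∈ W, ContDiff ℝ ∞ w)
    (L : Ev n →ₗ[ℝ] ℝ) : ContDiff ℝ ∞ fun z => L (hprod W z) := by
  induction W using Multiset.induction_on generalizing L with
  | empty =>
    simp only [hprod_zero]
    exact contDiff_const
  | cons w W ih =>
    simp only [hprod_cons, map_hess_mul]
    refine ContDiff.sum fun a _ => ?_
    refine ContDiff.sum fun b _ => ?_
    refine ContDiff.mul contDiff_const (ContDiff.mul ?_ ?_)
    · exact contDiff_pd (contDiff_pd (hW w (Multiset.mem_cons_self w W)) _) _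
    · exact ih (fun v hv => hW v (Multiset.mem_cons_of_mem hv)) (L ∘ₗ LinearMap.mulLeft ℝ _)

lemma pd_sum {κ : Type*} (s : Finset κ) {f : κ → Cn n → ℝ} (hf : ∀ i ∈ s, ContDiff ℝ ∞ (f i))
    (v z : Cn n) : pd v (fun y => ∑ i ∈ s, f i y) z = ∑ i ∈ s, pd v (f i) z := by
  unfold pd
  rw [fderiv_fun_sum fun i hi => ((hf i hi).differentiable (by simp)) z]
  simp

lemma pd_const_mul (c : ℝ) {f : Cn n → ℝ} (hf : ContDiff ℝ ∞ f) (v z : Cn n) :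
    pd v (fun y => c * f y) z = c * pd v f z := by
  unfold pd
  rw [fderiv_const_mul ((hf.differentiable (by simp)) z)]
  simp

lemma sum_antisymm {κ : Type*} [Fintype κ] {T : κ → κ → ℝ} (h : ∀ a b, T a b = -T b a) :
    ∑ a, ∑ b, T a b = 0 := by
  have h1 : ∑ a, ∑ b, T a b = -∑ a, ∑ b, T a b := by
    conv_lhs => rw [Finset.sum_comm]
    rw [← Finset.sum_neg_distrib]
    refine Finset.sum_congr rfl fun a _ => ?_
    rw [← Finset.sum_neg_distrib]
    exact Finset.sum_congr rfl fun b _ => h b a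
  linarith

lemma pd_hprod_cons {w : Cn n → ℝ} (hw : ContDiff ℝ ∞ w) {W : Multiset (Cn n → ℝ)}
    (hW : ∀ w ∈ W, ContDiff ℝ ∞ w) (v u : Cn n) (x : Lam n) (z : Cn n) :
    pd v (fun y => tauL (ι ℝ u * x) (hprod (w ::ₘ W) y)) z =
      (∑ b, ∑ c, 1 / 4 * (pd (fr n b) (pd (fr n c) w) z *
        pd v (fun y => tauL (ι ℝ u * (evVal n (two (fr n b) (mulI n (fr n c))) * x))
          (hprod W y)) z)) +
      ∑ b, ∑ c, 1 / 4 * (pd v (pd (fr n b) (pd (fr n c) w)) z *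
        tauL (ι ℝ u * (evVal n (two (fr n b) (mulI n (fr n c))) * x)) (hprod W z)) := by
  have h1 : ∀ b c (y : Cn n), tauL (ι ℝ u * x) (two (fr n b) (mulI n (fr n c)) * hprod W y) =
      tauL (ι ℝ u * (evVal n (two (fr n b) (mulI n (fr n c))) * x)) (hprod W y) := by
    intro b c y
    rw [tauL_mul, ← mul_assoc, ← evVal_commutes, mul_assoc]
  have hs : ∀ b c, ContDiff ℝ ∞ (pd (fr n b) (pd (fr n c) w)) := fun b c =>
    contDiff_pd (contDiff_pd hw _) _
  have hT : ∀ x : Lam n, ContDiff ℝ ∞ fun y => tauL x (hprod W y) := fun x =>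
    contDiff_hprod hW _
  simp only [hprod_cons, map_hess_mul, h1]
  rw [pd_sum _ fun b _ => ContDiff.sum fun c _ => contDiff_const.mul ((hs b c).mul (hT _)),
    ← Finset.sum_add_distrib]
  refine Finset.sum_congr rfl fun b _ => ?_
  rw [pd_sum _ fun c _ => contDiff_const.mul ((hs b c).mul (hT _)), ← Finset.sum_add_distrib]
  refine Finset.sum_congr rfl fun c _ => ?_
  rw [pd_const_mul _ ((hs b c).mul (hT _)), pd_mul (hs b c) (hT _)]
  ring

/-- Closedness of `ddᶜ w₁ ∧ ⋯ ∧ ddᶜ w_k` under `d` and `dᶜ`. In the Leibniz rule the third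
derivatives are symmetric in two indices in which the exterior product is antisymmetric. -/
lemma divergence_hprod {W : Multiset (Cn n → ℝ)} (hW : ∀ w ∈ W, ContDiff ℝ ∞ w) (x : Lam n)
    (z : Cn n) :
    ∑ a, pd (fr n a) (fun y => tauL (ι ℝ (fr n a) * x) (hprod W y)) z = 0 ∧
    ∑ a, pd (fr n a) (fun y => tauL (ι ℝ (mulI n (fr n a)) * x) (hprod W y)) z = 0 := by
  induction W using Multiset.induction_on generalizing x with
  | empty =>
    simp only [hprod_zero]
    constructor <;> refine Finset.sum_eq_zero fun a _ => ?_ <;> simp [pd]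
  | cons w W ih =>
    have hw := hW w (Multiset.mem_cons_self w W)
    have hW' : ∀ v ∈ W, ContDiff ℝ ∞ v := fun v hv => hW v (Multiset.mem_cons_of_mem hv)
    have key : ∀ u : Fin (2 * n) → Cn n,
        (∀ x : Lam n, ∑ a, pd (fr n a) (fun y => tauL (ι ℝ (u a) * x) (hprod W y)) z = 0) →
        (∑ a, ∑ b, ∑ c, 1 / 4 * (pd (fr n a) (pd (fr n b) (pd (fr n c) w)) z *
          tauL (ι ℝ (u a) * (evVal n (two (fr n b) (mulI n (fr n c))) * x)) (hprod W z)) = 0) →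
        ∑ a, pd (fr n a) (fun y => tauL (ι ℝ (u a) * x) (hprod (w ::ₘ W) y)) z = 0 := by
      intro u h1 h2
      simp only [pd_hprod_cons hw hW']
      rw [Finset.sum_add_distrib, h2, add_zero, Finset.sum_comm]
      refine Finset.sum_eq_zero fun b _ => ?_
      rw [Finset.sum_comm]
      refine Finset.sum_eq_zero fun c _ => ?_
      rw [← Finset.mul_sum, ← Finset.mul_sum, h1, mul_zero, mul_zero]
    constructor
    · refine key _ (fun x => (ih hW' x).1) (sum_antisymm fun a b => ?_)
      rw [← Finset.sum_neg_distrib]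
      refine Finset.sum_congr rfl fun c _ => ?_
      have h3 : ι ℝ (fr n a) * (evVal n (two (fr n b) (mulI n (fr n c))) * x) =
          -(ι ℝ (fr n b) * (evVal n (two (fr n a) (mulI n (fr n c))) * x)) := by
        rw [coe_two, coe_two, mul_assoc, mul_assoc, ← mul_assoc, ι_mul_swap, neg_mul, mul_assoc]
      rw [pd_comm (contDiff_pd hw (fr n c)) (fr n a) (fr n b), h3, tauL_apply, tauL_apply, mul_neg,
        map_neg]
      ring
    · refine key _ (fun x => (ih hW' x).2) ?_
      rw [Finset.sum_comm]
      refine Finset.sum_eq_zero fun b _ => sum_antisymm fun a c => ?_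
      have h3 : ι ℝ (mulI n (fr n a)) * (evVal n (two (fr n b) (mulI n (fr n c))) * x) =
          -(ι ℝ (mulI n (fr n c)) * (evVal n (two (fr n b) (mulI n (fr n a))) * x)) := by
        have h5 : ∀ p q r : Cn n, ι ℝ p * (ι ℝ q * ι ℝ r) = -(ι ℝ r * (ι ℝ q * ι ℝ p)) := by
          intro p q r
          rw [← mul_assoc, ι_mul_swap p q, neg_mul, mul_assoc, ι_mul_swap p r, mul_neg, neg_neg,
            ← mul_assoc, ι_mul_swap q r, neg_mul, mul_assoc]
        rw [coe_two, coe_two, ← mul_assoc, h5, neg_mul, mul_assoc]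
      rw [pd_comm (contDiff_pd hw (fr n c)) (fr n a) (fr n b), pd_comm hw (fr n a) (fr n c),
        pd_comm (contDiff_pd hw (fr n a)) (fr n c) (fr n b), h3, tauL_apply, tauL_apply, mul_neg,
        map_neg]
      ring

lemma hasCompactSupport_pd {f : Cn n → ℝ} (hf : HasCompactSupport f) (v : Cn n) :
    HasCompactSupport (pd v f) := hf.fderiv_apply ℝ v

lemma integral_pd_eq_zero {f : Cn n → ℝ} (hf : ContDiff ℝ ∞ f) (hc : HasCompactSupport f)
    (v : Cn n) : ∫ z, pd v f z = 0 := by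
  have hi := (contDiff_pd hf v).continuous.integrable_of_hasCompactSupport
      (μ := (volume : Measure (Cn n))) (hasCompactSupport_pd hc v)
  have hi2 := hf.continuous.integrable_of_hasCompactSupport (μ := (volume : Measure (Cn n))) hc
  have h := integral_mul_fderiv_eq_neg_fderiv_mul_of_integrable (μ := (volume : Measure (Cn n)))
    (𝕜 := ℝ) (f := fun _ : Cn n => (1 : ℝ)) (g := f) (v := v) (by simp)
    (by simp only [one_mul]; exact hi) (by simp only [one_mul]; exact hi2)
    (fun _ _ => differentiableAt_const _) (fun z _ => (hf.differentiable (by simp)) z)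
  simp only [one_mul, fderiv_fun_const, Pi.zero_apply, zero_apply, zero_mul,
    integral_zero, neg_zero] at h
  exact h

lemma hess_eq_zero_of_notMem {f : Cn n → ℝ} {z : Cn n} (hz : z ∉ tsupport f) : hess f z = 0 := by
  have h1 : ∀ a b, pd (fr n a) (pd (fr n b) f) z = 0 := fun a b =>
    image_eq_zero_of_notMem_tsupport fun hz' => hz <|
      (tsupport_fderiv_apply_subset ℝ (fr n b)) ((tsupport_fderiv_apply_subset ℝ (fr n a)) hz')
  simp [hess, h1]

/-- The coefficients of `ddᶜ w₁ ∧ ⋯ ∧ ddᶜ w_k ∧ x`. -/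
def hcoef (W : Multiset (Cn n → ℝ)) (x : Lam n) (a b : Fin (2 * n)) (z : Cn n) : ℝ :=
  tauL x (two (fr n a) (mulI n (fr n b)) * hprod W z)

lemma contDiff_hcoef {W : Multiset (Cn n → ℝ)} (hW : ∀ w ∈ W, ContDiff ℝ ∞ w) (x : Lam n)
    (a b : Fin (2 * n)) : ContDiff ℝ ∞ (hcoef W x a b) :=
  contDiff_hprod hW (tauL x ∘ₗ LinearMap.mulLeft ℝ (two (fr n a) (mulI n (fr n b))))

lemma sum_pd_hcoef_left {W : Multiset (Cn n → ℝ)} (hW : ∀ w ∈ W, ContDiff ℝ ∞ w) (x : Lam n)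
    (b : Fin (2 * n)) (z : Cn n) : ∑ a, pd (fr n a) (hcoef W x a b) z = 0 := by
  rw [← (divergence_hprod hW (ι ℝ (mulI n (fr n b)) * x) z).1]
  refine Finset.sum_congr rfl fun a _ => ?_
  congr 1
  funext y
  rw [hcoef, tauL_mul, coe_two, mul_assoc]

lemma sum_pd_hcoef_right {W : Multiset (Cn n → ℝ)} (hW : ∀ w ∈ W, ContDiff ℝ ∞ w) (x : Lam n)
    (a : Fin (2 * n)) (z : Cn n) : ∑ b, pd (fr n b) (hcoef W x a b) z = 0 := by
  rw [← (divergence_hprod hW (-(ι ℝ (fr n a) * x)) z).2]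
  refine Finset.sum_congr rfl fun b _ => ?_
  congr 1
  funext y
  rw [hcoef, tauL_mul, coe_two, ι_mul_swap, neg_mul, mul_neg, mul_assoc]

/-- Green's identity. Taking the outer derivative in direction `a` in one term and `b` in the other
cancels the mixed first-order terms `∂_a g ∂_b f`; derivatives of the coefficients drop out by
closedness. -/
lemma hess_symm_eq_divergence {W : Multiset (Cn n → ℝ)} (hW : ∀ w ∈ W, ContDiff ℝ ∞ w) (x : Lam n)
    {f g : Cn n → ℝ} (hf : ContDiff ℝ ∞ f) (hg : ContDiff ℝ ∞ g) (z : Cn n) :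
    g z * tauL x (hess f z * hprod W z) - f z * tauL x (hess g z * hprod W z) =
      ∑ a, ∑ b, 1 / 4 * (pd (fr n a) (fun y => g y * pd (fr n b) f y * hcoef W x a b y) z -
        pd (fr n b) (fun y => f y * pd (fr n a) g y * hcoef W x a b y) z) := by
  have hsf := fun b => contDiff_pd hf (fr n b)
  have hsg := fun b => contDiff_pd hg (fr n b)
  have e1 : ∀ a b, 1 / 4 * (pd (fr n a) (fun y => g y * pd (fr n b) f y * hcoef W x a b y) z -
      pd (fr n b) (fun y => f y * pd (fr n a) g y * hcoef W x a b y) z) =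
      (g z * (1 / 4 * (pd (fr n a) (pd (fr n b) f) z * hcoef W x a b z)) -
        f z * (1 / 4 * (pd (fr n a) (pd (fr n b) g) z * hcoef W x a b z))) +
      (1 / 4 * (g z * pd (fr n b) f z) * pd (fr n a) (hcoef W x a b) z -
        1 / 4 * (f z * pd (fr n a) g z) * pd (fr n b) (hcoef W x a b) z) := by
    intro a b
    rw [pd_mul (hg.mul (hsf b)) (contDiff_hcoef hW x a b),
      pd_mul (hf.mul (hsg a)) (contDiff_hcoef hW x a b),
      pd_mul hg (hsf b), pd_mul hf (hsg a), pd_comm hg (fr n b) (fr n a)]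
    ring
  simp only [e1, Finset.sum_add_distrib, Finset.sum_sub_distrib]
  have e2 : ∑ a, ∑ b, 1 / 4 * (g z * pd (fr n b) f z) * pd (fr n a) (hcoef W x a b) z = 0 := by
    rw [Finset.sum_comm]
    refine Finset.sum_eq_zero fun b _ => ?_
    rw [← Finset.mul_sum, sum_pd_hcoef_left hW, mul_zero]
  have e3 : ∑ a, ∑ b, 1 / 4 * (f z * pd (fr n a) g z) * pd (fr n b) (hcoef W x a b) z = 0 := by
    refine Finset.sum_eq_zero fun a _ => ?_
    rw [← Finset.mul_sum, sum_pd_hcoef_right hW, mul_zero]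
  rw [e2, e3, map_hess_mul, map_hess_mul, sub_zero, add_zero]
  simp only [← Finset.mul_sum, hcoef]

lemma contDiff_mem_cons {w : Cn n → ℝ} (hw : ContDiff ℝ ∞ w) {W : Multiset (Cn n → ℝ)}
    (hW : ∀ w ∈ W, ContDiff ℝ ∞ w) : ∀ v ∈ w ::ₘ W, ContDiff ℝ ∞ v := fun v hv => by
  rcases Multiset.mem_cons.1 hv with rfl | hv
  exacts [hw, hW v hv]

lemma continuous_hess_mul_hprod {W : Multiset (Cn n → ℝ)} (hW : ∀ w ∈ W, ContDiff ℝ ∞ w)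
    {f : Cn n → ℝ} (hf : ContDiff ℝ ∞ f) (L : Ev n →ₗ[ℝ] ℝ) :
    Continuous fun z => L (hess f z * hprod W z) := by
  have h1 := contDiff_hprod (contDiff_mem_cons hf hW) L
  simp only [hprod_cons] at h1
  exact h1.continuous

lemma integrable_mul_hess {W : Multiset (Cn n → ℝ)} (hW : ∀ w ∈ W, ContDiff ℝ ∞ w) (x : Lam n)
    {f g : Cn n → ℝ} (hf : ContDiff ℝ ∞ f) (hc : HasCompactSupport f) (hg : ContDiff ℝ ∞ g) :
    Integrable fun z => g z * tauL x (hess f z * hprod W z) := by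
  refine (hg.continuous.mul (continuous_hess_mul_hprod hW hf _)).integrable_of_hasCompactSupport
    (HasCompactSupport.intro hc fun z hz => ?_)
  rw [Pi.mul_apply, hess_eq_zero_of_notMem hz, zero_mul, map_zero, mul_zero]

/-- Only `f` needs compact support, so `g` may be a potential and `f` a coefficient of a test form
or a cutoff. -/
theorem integral_hess_symm {W : Multiset (Cn n → ℝ)} (hW : ∀ w ∈ W, ContDiff ℝ ∞ w) (x : Lam n)
    {f g : Cn n → ℝ} (hf : ContDiff ℝ ∞ f) (hc : HasCompactSupport f) (hg : ContDiff ℝ ∞ g) :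
    ∫ z, g z * tauL x (hess f z * hprod W z) = ∫ z, f z * tauL x (hess g z * hprod W z) := by
  have hs1 : ∀ a b, ContDiff ℝ ∞ fun y => g y * pd (fr n b) f y * hcoef W x a b y := fun a b =>
    (hg.mul (contDiff_pd hf (fr n b))).mul (contDiff_hcoef hW x a b)
  have hs2 : ∀ a b, ContDiff ℝ ∞ fun y => f y * pd (fr n a) g y * hcoef W x a b y := fun a b =>
    (hf.mul (contDiff_pd hg (fr n a))).mul (contDiff_hcoef hW x a b)
  have hc1 : ∀ a b, HasCompactSupport fun y => g y * pd (fr n b) f y * hcoef W x a b y :=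
    fun a b => ((hasCompactSupport_pd hc (fr n b)).mul_left).mul_right
  have hc2 : ∀ a b, HasCompactSupport fun y => f y * pd (fr n a) g y * hcoef W x a b y :=
    fun a b => (hc.mul_right).mul_right
  have hi2 : Integrable fun z => f z * tauL x (hess g z * hprod W z) :=
    (hf.continuous.mul (continuous_hess_mul_hprod hW hg _)).integrable_of_hasCompactSupport
      hc.mul_right
  rw [← sub_eq_zero, ← integral_sub (integrable_mul_hess hW x hf hc hg) hi2]
  simp only [hess_symm_eq_divergence hW x hf hg]
  have hint : ∀ (F : Cn n → ℝ) (v : Cn n), ContDiff ℝ ∞ F → HasCompactSupport F →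
      Integrable (pd v F) := fun F v hF hFc =>
    (contDiff_pd hF v).continuous.integrable_of_hasCompactSupport (hasCompactSupport_pd hFc v)
  have hint2 : ∀ a b, Integrable fun z =>
      1 / 4 * (pd (fr n a) (fun y => g y * pd (fr n b) f y * hcoef W x a b y) z -
        pd (fr n b) (fun y => f y * pd (fr n a) g y * hcoef W x a b y) z) := fun a b =>
    ((hint _ _ (hs1 a b) (hc1 a b)).sub (hint _ _ (hs2 a b) (hc2 a b))).const_mul _
  rw [integral_finsetSum _ fun a _ => integrable_finsetSum _ fun b _ => hint2 a b]
  refine Finset.sum_eq_zero fun a _ => ?_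
  rw [integral_finsetSum _ fun b _ => hint2 a b]
  refine Finset.sum_eq_zero fun b _ => ?_
  rw [integral_const_mul, integral_sub (hint _ _ (hs1 a b) (hc1 a b))
      (hint _ _ (hs2 a b) (hc2 a b)),
    integral_pd_eq_zero (hs1 a b) (hc1 a b), integral_pd_eq_zero (hs2 a b) (hc2 a b)]
  simp

lemma hprod_mem_homog {W : Multiset (Cn n → ℝ)} (hW : ∀ w ∈ W, ContDiff ℝ ∞ w) (z : Cn n) :
    evVal n (hprod W z) ∈ homog n (2 * W.card) := by
  have h := multiset_prod_mem_homog (W.map fun w => hess w z) fun a ha => by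
    obtain ⟨w, hw, rfl⟩ := Multiset.mem_map.1 ha
    exact Herm_mem_homog (hess_mem_Herm (hW w hw) z)
  rwa [Multiset.card_map] at h

/-- Two representatives of one covector need not be compared in the exterior algebra: `τ` sees them
only through `topCoeff` of the same wedge product. -/
lemma tau_congr {a d : ℕ} {y x x' : Lam n} {η : Cn n [⋀^Fin d]→ₗ[ℝ] ℝ} (hy : y ∈ homog n a)
    (hx : (x, η) ∈ Rep n d) (hx' : (x', η) ∈ Rep n d) : tau n (y * x) = tau n (y * x') := by
  obtain ⟨α, hα⟩ := exists_Rep_of_mem_homog hy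
  rw [tau_eq_topCoeff (Rep_wedge hα hx), tau_eq_topCoeff (Rep_wedge hα hx')]

lemma hat_eq_coef {d : ℕ} (ψ : Form n d) (z : Cn n) :
    hat (ψ z).toAlternatingMap = ((d.factorial : ℝ)⁻¹) •
      ∑ I : Fin d → Fin (2 * n), coef ψ I z • ιMulti ℝ d (fun i => fr n (I i)) := hat_apply _

lemma hat_smul {d : ℕ} (c : ℝ) (η : Covec n d) :
    hat (c • η).toAlternatingMap = c • hat η.toAlternatingMap :=
  map_smul hat c η.toAlternatingMap

lemma hasCompactSupport_coef {d : ℕ} {ψ : Form n d} (hψ : HasCompactSupport ψ)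
    (I : Fin d → Fin (2 * n)) : HasCompactSupport (coef ψ I) :=
  hψ.comp_left (g := fun η : Covec n d => η fun i => fr n (I i)) rfl

/-- The integral of `β^q ∧ ddᶜ w₁ ∧ ⋯ ∧ ddᶜ w_k ∧ ψ`. -/
def smoothCurrent (q : ℕ) (W : Multiset (Cn n → ℝ)) {d : ℕ} (ψ : Form n d) : ℝ :=
  ∫ z, tau n (evVal n (beta n ^ q * hprod W z) * hat (ψ z).toAlternatingMap)

lemma tau_mul_hat_eq {q : ℕ} {d : ℕ} (Y : Ev n) (ψ : Form n d) (z : Cn n) :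
    tau n (evVal n (beta n ^ q * Y) * hat (ψ z).toAlternatingMap) =
      ((d.factorial : ℝ)⁻¹) * ∑ I : Fin d → Fin (2 * n), coef ψ I z *
        tauL (evVal n (beta n ^ q) * ιMulti ℝ d (fun i => fr n (I i))) Y := by
  rw [hat_eq_coef, mul_smul_comm, map_smul, Finset.mul_sum, map_sum, smul_eq_mul]
  congr 1
  refine Finset.sum_congr rfl fun I _ => ?_
  rw [mul_smul_comm, map_smul, smul_eq_mul, ← tauL_mul]
  rfl

lemma continuous_coef {d : ℕ} {ψ : Form n d} (hψ : Continuous ψ) (I : Fin d → Fin (2 * n)) :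
    Continuous (coef ψ I) := (evalCLM (fun i => fr n (I i))).continuous.comp hψ

lemma continuous_smoothCurrent_integrand {W : Multiset (Cn n → ℝ)}
    (hW : ∀ w ∈ W, ContDiff ℝ ∞ w) (q : ℕ) {d : ℕ} {ψ : Form n d} (hψ : Continuous ψ) :
    Continuous fun z =>
      tau n (evVal n (beta n ^ q * hprod W z) * hat (ψ z).toAlternatingMap) := by
  simp only [tau_mul_hat_eq]
  exact continuous_const.mul (continuous_finsetSum _ fun I _ =>
    (continuous_coef hψ I).mul (contDiff_hprod hW _).continuous)

lemma hasCompactSupport_smoothCurrent_integrand (W : Multiset (Cn n → ℝ)) (q : ℕ) {d : ℕ}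
    {ψ : Form n d} (hψ : HasCompactSupport ψ) :
    HasCompactSupport fun z =>
      tau n (evVal n (beta n ^ q * hprod W z) * hat (ψ z).toAlternatingMap) := by
  refine hψ.mono fun z hz => ?_
  contrapose! hz
  simp only [Function.mem_support, not_not] at hz ⊢
  rw [hz]
  have : hat (0 : Covec n d).toAlternatingMap = 0 := map_zero hat
  rw [this, mul_zero, map_zero]

lemma integrable_smoothCurrent {W : Multiset (Cn n → ℝ)}
    (hW : ∀ w ∈ W, ContDiff ℝ ∞ w) (q : ℕ) {d : ℕ} {ψ : Form n d} (hψ : Continuous ψ)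
    (hc : HasCompactSupport ψ) : Integrable fun z =>
      tau n (evVal n (beta n ^ q * hprod W z) * hat (ψ z).toAlternatingMap) :=
  (continuous_smoothCurrent_integrand hW q hψ).integrable_of_hasCompactSupport
    (hasCompactSupport_smoothCurrent_integrand W q hc)

/-- The smooth counterpart of the recursion in `IsDdcWedge`: `integral_hess_symm` is applied to each
coefficient of `ψ`. -/
theorem smoothCurrent_cons {W : Multiset (Cn n → ℝ)} (hW : ∀ w ∈ W, ContDiff ℝ ∞ w) (q : ℕ)
    {d : ℕ} {ψ : Form n d} (hψ : ContDiff ℝ ∞ ψ) (hc : HasCompactSupport ψ) {w : Cn n → ℝ}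
    (hw : ContDiff ℝ ∞ w) :
    smoothCurrent q (w ::ₘ W) ψ = smoothCurrent q W fun z => w z • ddc ψ z := by
  have hcf := fun I => contDiff_coef hψ I
  have hcc := fun I => hasCompactSupport_coef hc I
  have h1 : ∀ z, tau n (evVal n (beta n ^ q * hprod W z) * hat (w z • ddc ψ z).toAlternatingMap) =
      ((d.factorial : ℝ)⁻¹) * ∑ I : Fin d → Fin (2 * n), w z *
        tauL (evVal n (beta n ^ q) * ιMulti ℝ d (fun i => fr n (I i)))
          (hess (coef ψ I) z * hprod W z) := by
    intro z
    have e2 : evVal n (beta n ^ q * hprod W z) ∈ homog n (2 * q + 2 * W.card) := by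
      rw [map_mul]
      exact mul_mem_homog (pow_mem_homog beta_mem_homog q) (hprod_mem_homog hW z)
    rw [hat_smul, mul_smul_comm, map_smul, tau_congr e2 (hat_mem_Rep _) (Rep_ddc hψ z), ddcHat,
      mul_smul_comm, map_smul, Finset.mul_sum, map_sum, smul_eq_mul, smul_eq_mul, mul_left_comm,
      Finset.mul_sum]
    congr 1
    refine Finset.sum_congr rfl fun I _ => ?_
    rw [← tauL_mul, tauL_apply, ← mul_assoc, ← map_mul]
    congr 4
    ring
  rw [smoothCurrent, smoothCurrent]
  simp only [h1, tau_mul_hat_eq, hprod_cons]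
  rw [integral_const_mul, integral_const_mul]
  congr 1
  rw [integral_finsetSum, integral_finsetSum]
  · exact Finset.sum_congr rfl fun I _ => (integral_hess_symm hW _ (hcf I) (hcc I) hw).symm
  · intro I _
    exact integrable_mul_hess hW _ (hcf I) (hcc I) hw
  · intro I _
    exact ((hcf I).continuous.mul
      (continuous_hess_mul_hprod hW hw _)).integrable_of_hasCompactSupport (hcc I).mul_right

end Parts

/-! ### Smooth approximation -/

section Approximation

open ContinuousLinearMap

variable {n : ℕ}

lemma pd_convolution {ρ g : Cn n → ℝ} (hρ : ContDiff ℝ ∞ ρ) (hc : HasCompactSupport ρ)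
    (hg : LocallyIntegrable g volume) (v : Cn n) :
    pd v (convolution ρ g (lsmul ℝ ℝ) volume) = convolution (pd v ρ) g (lsmul ℝ ℝ) volume := by
  funext z
  have h := hc.hasFDerivAt_convolution_left (μ := (volume : Measure (Cn n))) (lsmul ℝ ℝ)
    (hρ.of_le (by simp)) hg z
  rw [pd, h.fderiv, convolution, convolution, ContinuousLinearMap.integral_apply]
  · rfl
  · exact (hc.fderiv (𝕜 := ℝ)).convolutionExists_left _ (hρ.continuous_fderiv (by simp)) hg z

lemma pd_comp_sub {ρ : Cn n → ℝ} (hρ : ContDiff ℝ ∞ ρ) (v z y : Cn n) :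
    pd v (fun y => ρ (z - y)) y = -pd v ρ (z - y) := by
  unfold pd
  have h1 : HasFDerivAt (fun y : Cn n => z - y) (-ContinuousLinearMap.id ℝ (Cn n)) y :=
    (hasFDerivAt_id y).const_sub z
  have h2 : HasFDerivAt (fun y => ρ (z - y)) _ y :=
    ((hρ.differentiable (by simp)) (z - y)).hasFDerivAt.comp y h1
  rw [h2.fderiv]
  simp

lemma pd_neg' (f : Cn n → ℝ) (v z : Cn n) : pd v (fun y => -f y) z = -pd v f z := by
  unfold pd
  rw [fderiv_fun_neg]
  rfl

lemma hess_comp_sub {ρ : Cn n → ℝ} (hρ : ContDiff ℝ ∞ ρ) (z y : Cn n) :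
    hess (fun y => ρ (z - y)) y = hess ρ (z - y) := by
  have h : ∀ u v, pd u (pd v fun y => ρ (z - y)) y = pd u (pd v ρ) (z - y) := by
    intro u v
    have h1 : (pd v fun y => ρ (z - y)) = fun y => -pd v ρ (z - y) :=
      funext fun y => pd_comp_sub hρ v z y
    rw [h1, pd_neg', pd_comp_sub (contDiff_pd hρ v), neg_neg]
  simp only [hess, h]

lemma map_hess (L : Ev n →ₗ[ℝ] ℝ) (w : Cn n → ℝ) (z : Cn n) :
    L (hess w z) = ∑ a, ∑ b, 1 / 4 * (pd (fr n a) (pd (fr n b) w) z *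
      L (two (fr n a) (mulI n (fr n b)))) := by
  have := map_hess_mul L w z 1
  simpa only [mul_one] using this

/-- Both derivatives fall on `ρ`, and the reflection `y ↦ z - y` does not affect second derivatives.
The Hessian at `z` becomes `g` paired with the Hessian of the test function `y ↦ ρ (z - y)`. -/
lemma map_hess_convolution (L : Ev n →ₗ[ℝ] ℝ) {ρ g : Cn n → ℝ} (hρ : ContDiff ℝ ∞ ρ)
    (hc : HasCompactSupport ρ) (hg : LocallyIntegrable g volume) (z : Cn n) :
    L (hess (convolution ρ g (lsmul ℝ ℝ) volume) z) =
      ∫ y, g y * L (hess (fun y => ρ (z - y)) y) := by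
  simp only [hess_comp_sub hρ]
  rw [map_hess]
  have hs : ∀ a b, ContDiff ℝ ∞ (pd (fr n a) (pd (fr n b) ρ)) := fun a b =>
    contDiff_pd (contDiff_pd hρ _) _
  have hcs : ∀ a b, HasCompactSupport (pd (fr n a) (pd (fr n b) ρ)) := fun a b =>
    hasCompactSupport_pd (hasCompactSupport_pd hc _) _
  have h1 : ∀ a b, pd (fr n a) (pd (fr n b) (convolution ρ g (lsmul ℝ ℝ) volume)) z =
      ∫ y, g y * pd (fr n a) (pd (fr n b) ρ) (z - y) := by
    intro a b
    rw [pd_convolution hρ hc hg, pd_convolution (contDiff_pd hρ _) (hasCompactSupport_pd hc _) hg,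
      convolution_eq_swap]
    simp only [lsmul_apply, smul_eq_mul, mul_comm]
  have hi : ∀ a b, Integrable fun y => g y * pd (fr n a) (pd (fr n b) ρ) (z - y) := by
    intro a b
    have h2 := ((hcs a b).convolutionExists_left (lsmul ℝ ℝ) (hs a b).continuous hg z
      ).integrable_swap
    simpa only [lsmul_apply, smul_eq_mul, mul_comm] using h2
  simp only [h1, map_hess L ρ, Finset.mul_sum]
  have h3 : ∀ a b, Integrable fun y => g y * (1 / 4 * (pd (fr n a) (pd (fr n b) ρ) (z - y) *
      L (two (fr n a) (mulI n (fr n b))))) := by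
    intro a b
    refine ((hi a b).mul_const (1 / 4 * L (two (fr n a) (mulI n (fr n b))))).congr
      (Filter.Eventually.of_forall fun y => ?_)
    simp only
    ring
  rw [integral_finsetSum _ fun a _ => integrable_finsetSum _ fun b _ => h3 a b]
  refine Finset.sum_congr rfl fun a _ => ?_
  rw [integral_finsetSum _ fun b _ => h3 a b]
  refine Finset.sum_congr rfl fun b _ => ?_
  rw [← integral_mul_const, ← integral_const_mul]
  refine integral_congr_ae (Filter.Eventually.of_forall fun y => ?_)
  simp only
  ring

lemma Rep_pow_quad {T : Cn n →ₗ[ℝ] Cn n} (hT : T.IsSymmetric) (j : ℕ) (z : Cn n) :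
    (evVal n (hop T ^ j), wedgeProd j fun _ => ddcFun (quad T) z) ∈ Rep n (2 * j) := by
  have h := Rep_wedgeProd j (fun _ => hop T) (fun _ => ddcFun (quad T) z) fun _ => by
    have := Rep_ddcFun (n := n) (contDiff_quad T) z
    rwa [hess_quad hT] at this
  rw [Finset.prod_const, Finset.card_univ, Fintype.card_fin] at h
  exact h

lemma isC2MSubharmonic_quad {m : ℕ} {T : Cn n →ₗ[ℝ] Cn n} (hT : T.IsSymmetric)
    (h : hop T ∈ gam n m) (D : Set (Cn n)) : IsC2MSubharmonic m D (quad T) := by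
  refine ⟨((contDiff_quad T).of_le (by exact WithTop.coe_le_coe.2 (le_top : (2 : ℕ∞) ≤ ⊤))).contDiffOn, fun j _ hj z _ => ?_⟩
  rw [← tau_eq_topCoeff (Rep_wedge (Rep_pow_quad hT j z) (Rep_betaPow (n - j) z)), ← map_mul]
  exact h.2 j hj

/-- Mollification preserves `m`-subharmonicity: by duality it suffices to pair the Hessian with
powers of a constant form in the cone, and there the definition applies with all competitors equal
to one quadratic function. -/
theorem exists_smooth_approx {m : ℕ} (hm : 1 ≤ m) (hmn : m ≤ n) {D : Set (Cn n)} (hD : IsOpen D)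
    {u : Cn n → ℝ} (hu : IsContMSubharmonic m D u) {K : Set (Cn n)} (hK : IsCompact K)
    (hKD : K ⊆ D) {δ : ℝ} (hδ : 0 < δ) :
    ∃ w : Cn n → ℝ, ContDiff ℝ ∞ w ∧ (∀ z ∈ K, hess w z ∈ gam n m) ∧
      ∀ z ∈ K, |w z - u z| ≤ δ := by
  obtain ⟨ε₀, hε₀, hε₀D⟩ := hK.exists_cthickening_subset_open hD hKD
  set K' := cthickening ε₀ K with hK'
  have hK'c : IsCompact K' := hK.cthickening
  have huK' : ContinuousOn u K' := hu.2.mono hε₀D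
  obtain ⟨ε₁, hε₁, hε₁u⟩ := Metric.uniformContinuousOn_iff.1
    (hK'c.uniformContinuousOn_of_continuous huK') δ hδ
  -- The radius `ε₀` keeps the mollification inside `D`, and `ε₁` comes from uniform continuity at
  -- scale `δ`.
  set ε := min ε₀ ε₁ with hε
  have hεpos : 0 < ε := lt_min hε₀ hε₁
  let φ : ContDiffBump (0 : Cn n) := ⟨ε / 2, ε, half_pos hεpos, half_lt_self hεpos⟩
  set ρ : Cn n → ℝ := φ.normed volume with hρ
  -- Truncation makes `u` globally integrable and is invisible on `K`, since the mollifier only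
  -- reaches distance `ε` and `closedBall z ε ⊆ K'`.
  set g : Cn n → ℝ := K'.indicator u with hg
  have hρs : ContDiff ℝ ∞ ρ := φ.contDiff_normed (n := ⊤)
  have hρc : HasCompactSupport ρ := φ.hasCompactSupport_normed
  have hgi : Integrable g := (huK'.integrableOn_compact hK'c).integrable_indicator
    hK'c.isClosed.measurableSet
  have hball : ∀ z ∈ K, closedBall z ε ⊆ K' := by
    intro z hz
    refine (closedBall_subset_cthickening hz ε).trans (cthickening_mono (min_le_left _ _) K)
  refine ⟨convolution ρ g (lsmul ℝ ℝ) volume,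
    hρc.contDiff_convolution_left (n := ⊤) _ hρs hgi.locallyIntegrable, fun z hz => ?_,
    fun z hz => ?_⟩
  · have hws : ContDiff ℝ ∞ (convolution ρ g (lsmul ℝ ℝ) volume) :=
      hρc.contDiff_convolution_left (n := ⊤) _ hρs hgi.locallyIntegrable
    refine mem_closedCone_of_dual beta_mem_Herm isHyperbolic_tauE hmn hm
      (hess_mem_Herm hws z) fun c hc => ?_
    obtain ⟨T, hT, rfl⟩ := hc.1
    set ψ : Cn n → ℝ := fun y => ρ (z - y) with hψ
    have hψs : ContDiff ℝ ∞ ψ := hρs.comp (contDiff_const.sub contDiff_id)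
    have hsupp : tsupport ψ ⊆ closedBall z ε := by
      refine closure_minimal (fun y hy => ?_) isClosed_closedBall
      have h1 : z - y ∈ Function.support ρ := hy
      rw [hρ, φ.support_normed_eq, mem_ball_zero_iff] at h1
      rw [mem_closedBall, dist_comm, dist_eq_norm]
      exact h1.le
    have hψc : HasCompactSupport ψ :=
      (isCompact_closedBall z ε).of_isClosed_subset (isClosed_tsupport _) hsupp
    have key := hu.1.2.2 (fun _ => quad T) (fun _ => isC2MSubharmonic_quad hT hc D) ψ hψs hψc
      (hsupp.trans ((hball z hz).trans hε₀D)) fun y => φ.nonneg_normed _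
    have h2 := map_hess_convolution (tauE n ∘ₗ LinearMap.mulLeft ℝ
      (hop T ^ (m - 1) * beta n ^ (n - m))) hρs hρc hgi.locallyIntegrable z
    have h3 : ∀ y, topCoeff (wedge (wedge (wedgeProd (m - 1) fun _ => ddcFun (quad T) y)
        (betaPow (n - m) y)) (ddcFun ψ y)) =
        tauE n (hop T ^ (m - 1) * beta n ^ (n - m) * hess ψ y) := by
      intro y
      rw [← tau_eq_topCoeff (Rep_wedge (Rep_wedge (Rep_pow_quad hT (m - 1) y)
        (Rep_betaPow (n - m) y)) (Rep_ddcFun hψs y)), ← map_mul, ← map_mul]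
      rfl
    simp only [h3] at key
    have h4 : tauE n (hop T ^ (m - 1) * beta n ^ (n - m) *
        hess (convolution ρ g (lsmul ℝ ℝ) volume) z) =
        ∫ y, g y * tauE n (hop T ^ (m - 1) * beta n ^ (n - m) * hess ψ y) := h2
    rw [h4]
    refine key.trans_eq ?_
    have h5 : ∀ y, y ∉ K' → hess ψ y = 0 := fun y hy =>
      hess_eq_zero_of_notMem fun h => hy (hball z hz (hsupp h))
    rw [setIntegral_eq_integral_of_forall_compl_eq_zero fun y hy => by
      rw [h5 y fun h => hy (hε₀D h), mul_zero, map_zero, mul_zero]]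
    refine integral_congr_ae (Filter.Eventually.of_forall fun y => ?_)
    by_cases hy : y ∈ K'
    · simp only [hg, indicator_of_mem hy]
    · simp only [h5 y hy, mul_zero, map_zero]
  · have hzK' : z ∈ K' := hball z hz (mem_closedBall_self hεpos.le)
    have h1 := ContDiffBump.dist_normed_convolution_le (φ := φ) (μ := (volume : Measure (Cn n)))
      (g := g) (x₀ := z) (ε := δ) hgi.aestronglyMeasurable fun x hx => by
        have hx' : x ∈ ball z ε := hx
        have hxK' : x ∈ K' := hball z hz (ball_subset_closedBall hx')
        rw [hg, indicator_of_mem hxK', indicator_of_mem hzK']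
        exact (hε₁u x hxK' z hzK' (lt_of_lt_of_le hx' (min_le_right _ _))).le
    rw [Real.dist_eq] at h1
    have h2 : g z = u z := indicator_of_mem hzK' u
    rwa [h2] at h1

end Approximation

/-! ### Mass bounds -/

section Mass

open Filter Topology

variable {n : ℕ}

/-- `w j` are smooth, converge to `u` locally uniformly on `D`, and are eventually
`m`-subharmonic on each compact subset of `D`. -/
def IsSmoothApprox (m : ℕ) (D : Set (Cn n)) (u : Cn n → ℝ) (w : ℕ → Cn n → ℝ) : Prop :=
  (∀ j, ContDiff ℝ ∞ (w j)) ∧ ∀ K : Set (Cn n), IsCompact K → K ⊆ D →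
    (∀ᶠ j in atTop, ∀ z ∈ K, hess (w j) z ∈ gam n m) ∧
    ∀ δ > 0, ∀ᶠ j in atTop, ∀ z ∈ K, |w j z - u z| ≤ δ

/-- The `j`-th function approximates to within `1 / (j + 1)` on the `j`-th set of a compact
exhaustion. -/
theorem exists_isSmoothApprox {m : ℕ} (hm : 1 ≤ m) (hmn : m ≤ n) {D : Set (Cn n)} (hD : IsOpen D)
    {u : Cn n → ℝ} (hu : IsContMSubharmonic m D u) : ∃ w, IsSmoothApprox m D u w := by
  have : LocallyCompactSpace D := hD.locallyCompactSpace
  let E : CompactExhaustion D := default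
  have hE : ∀ j, IsCompact (Subtype.val '' E j) := fun j =>
    (E.isCompact j).image continuous_subtype_val
  have hED : ∀ j, Subtype.val '' E j ⊆ D := fun j => Subtype.coe_image_subset D (E j)
  choose w hw1 hw2 hw3 using fun j : ℕ => exists_smooth_approx hm hmn hD hu (hE j) (hED j)
    (δ := 1 / ((j : ℝ) + 1)) (by positivity)
  refine ⟨w, hw1, fun K hK hKD => ?_⟩
  have hK' : IsCompact (Subtype.val ⁻¹' K : Set D) :=
    Subtype.isCompact_iff.2 (by rwa [Subtype.image_preimage_coe, inter_eq_right.2 hKD])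
  obtain ⟨N, hN⟩ := E.exists_superset_of_isCompact hK'
  have hsub : ∀ j ≥ N, K ⊆ Subtype.val '' E j := fun j hj z hz =>
    ⟨⟨z, hKD hz⟩, E.subset hj (hN hz), rfl⟩
  refine ⟨?_, fun δ hδ => ?_⟩
  · filter_upwards [eventually_ge_atTop N] with j hj z hz
    exact hw2 j z (hsub j hj hz)
  · obtain ⟨N', hN'⟩ := exists_nat_one_div_lt hδ
    filter_upwards [eventually_ge_atTop N, eventually_ge_atTop N'] with j hj hj' z hz
    refine (hw3 j z (hsub j hj hz)).trans (le_trans ?_ hN'.le)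
    exact one_div_le_one_div_of_le (by positivity) (by exact_mod_cast Nat.succ_le_succ hj')

/-- The integral over `K` of `ddᶜ w₁ ∧ ⋯ ∧ ddᶜ w_k ∧ β^(n-k)`. -/
def mass (K : Set (Cn n)) (W : Multiset (Cn n → ℝ)) : ℝ :=
  ∫ z in K, tauE n (beta n ^ (n - W.card) * hprod W z)

lemma tauE_hprod_nonneg {m : ℕ} (hmn : m ≤ n) {W : Multiset (Cn n → ℝ)} (hW : W.card ≤ m)
    {z : Cn n} (h : ∀ w ∈ W, hess w z ∈ gam n m) :
    0 ≤ tauE n (beta n ^ (n - W.card) * hprod W z) := by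
  have := tauE_mixed_nonneg hmn (W.map fun w => hess w z) (by rwa [Multiset.card_map])
    fun a ha => by
      obtain ⟨w, hw, rfl⟩ := Multiset.mem_map.1 ha
      exact h w hw
  rwa [Multiset.card_map] at this

lemma continuous_tauE_hprod {W : Multiset (Cn n → ℝ)} (hW : ∀ w ∈ W, ContDiff ℝ ∞ w) (q : ℕ) :
    Continuous fun z => tauE n (beta n ^ q * hprod W z) :=
  (contDiff_hprod hW (tauE n ∘ₗ LinearMap.mulLeft ℝ (beta n ^ q))).continuous

/-- The pointwise bound by the trace, integrated over `K`. The constant depends on `n` and `p`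
alone, not on the potentials. -/
theorem exists_abs_smoothCurrent_le (n p : ℕ) : ∃ C : ℝ, 0 ≤ C ∧ ∀ m ≤ n,
    ∀ W : Multiset (Cn n → ℝ), (∀ w ∈ W, ContDiff ℝ ∞ w) → W.card + p ≤ m →
    ∀ K : Set (Cn n), IsCompact K → (∀ w ∈ W, ∀ z ∈ K, hess w z ∈ gam n m) →
    ∀ ψ : Form n (2 * p), Continuous ψ → tsupport ψ ⊆ K → ∀ b : ℝ, (∀ z, ‖ψ z‖ ≤ b) →
      |smoothCurrent (n - (W.card + p)) W ψ| ≤ C * b * mass K W := by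
  obtain ⟨C, hC, h⟩ := exists_tau_mul_hat_le n p
  refine ⟨C, hC, fun m hmn W hW hcard K hK hWK ψ hψ hψK b hb => ?_⟩
  rw [smoothCurrent, ← setIntegral_eq_integral_of_forall_compl_eq_zero (s := K) fun z hz => ?_]
  · rw [mass, ← integral_const_mul, ← Real.norm_eq_abs]
    refine norm_integral_le_of_norm_le ?_ ?_
    · exact ((continuous_tauE_hprod hW _).continuousOn.integrableOn_compact hK).const_mul _
    · refine (ae_restrict_iff' hK.measurableSet).2 (Eventually.of_forall fun z hz => ?_)
      have h1 := h m hmn (W.map fun w => hess w z) (fun a ha => by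
        obtain ⟨w, hw, rfl⟩ := Multiset.mem_map.1 ha
        exact hWK w hw z hz) (by rwa [Multiset.card_map]) (ψ z)
      rw [Multiset.card_map] at h1
      refine h1.trans ?_
      refine mul_le_mul_of_nonneg_right (mul_le_mul_of_nonneg_left (hb z) hC) ?_
      exact tauE_hprod_nonneg hmn (by omega) fun w hw => hWK w hw z hz
  · have h0 : ψ z = 0 := image_eq_zero_of_notMem_tsupport fun h => hz (hψK h)
    have : hat (0 : Covec n (2 * p)).toAlternatingMap = 0 := map_zero hat
    rw [h0, this, mul_zero, map_zero]

/-! ### Test forms, cutoffs and the Chern–Levine–Nirenberg estimate -/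

lemma contDiff_dc {d : ℕ} {ψ : Form n d} (hψ : ContDiff ℝ ∞ ψ) : ContDiff ℝ ∞ (dc ψ) := by
  have h1 : dc ψ = fun y => dcLin n d (fderiv ℝ ψ y) :=
    funext fun y => dc_eq ((hψ.differentiable (by simp)) y)
  rw [h1]
  exact (dcLin n d).contDiff.comp (hψ.fderiv_right (m := ∞) (by simp))

lemma contDiff_ddc {d : ℕ} {ψ : Form n d} (hψ : ContDiff ℝ ∞ ψ) : ContDiff ℝ ∞ (ddc ψ) := by
  have h : ContDiff ℝ ∞ (fderiv ℝ (dc ψ)) := (contDiff_dc hψ).fderiv_right (m := ∞) (by simp)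
  change ContDiff ℝ ∞ fun z => ContinuousAlternatingMap.alternatizeUncurryFinCLM ℝ (Cn n) ℝ
    (n := d + 1) (fderiv ℝ (dc ψ) z)
  exact (ContinuousAlternatingMap.alternatizeUncurryFinCLM ℝ (Cn n) ℝ).contDiff.comp h

lemma tsupport_dc_subset {d : ℕ} (ψ : Form n d) : tsupport (dc ψ) ⊆ tsupport ψ := by
  refine closure_minimal (fun z hz => ?_) (isClosed_tsupport ψ)
  by_contra h
  have h0 : ψ =ᶠ[𝓝 z] 0 := notMem_tsupport_iff_eventuallyEq.1 h
  refine hz ?_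
  have h1 : DifferentiableAt ℝ ψ z :=
    (differentiableAt_const (0 : Covec n d)).congr_of_eventuallyEq h0
  have h2 : fderiv ℝ ψ z = 0 := by
    rw [h0.fderiv_eq]
    exact fderiv_const_apply _
  rw [dc_eq h1, h2, map_zero]

lemma tsupport_ddc_subset {d : ℕ} (ψ : Form n d) : tsupport (ddc ψ) ⊆ tsupport ψ := by
  refine subset_trans (closure_minimal (fun z hz => ?_) (isClosed_tsupport (dc ψ)))
    (tsupport_dc_subset ψ)
  by_contra h
  have h0 : dc ψ =ᶠ[𝓝 z] 0 := notMem_tsupport_iff_eventuallyEq.1 h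
  refine hz ?_
  have h2 : fderiv ℝ (dc ψ) z = 0 := by
    rw [h0.fderiv_eq]
    exact fderiv_const_apply _
  rw [ddc, extDeriv, h2]
  exact map_zero (ContinuousAlternatingMap.alternatizeUncurryFinCLM ℝ (Cn n) ℝ)

lemma hasCompactSupport_ddc {d : ℕ} {ψ : Form n d} (hψ : HasCompactSupport ψ) :
    HasCompactSupport (ddc ψ) := hψ.of_isClosed_subset (isClosed_tsupport _) (tsupport_ddc_subset ψ)

lemma contDiff_zeroForm {f : Cn n → ℝ} {r : WithTop ℕ∞} (hf : ContDiff ℝ r f) :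
    ContDiff ℝ r (zeroForm f) :=
  (ContinuousAlternatingMap.constOfIsEmptyLIE ℝ (Cn n) ℝ (Fin 0)).contDiff.comp hf

lemma tsupport_zeroForm (f : Cn n → ℝ) : tsupport (zeroForm f) = tsupport f := by
  have : Function.support (zeroForm f) = Function.support f := by
    ext z
    refine not_congr ?_
    exact (map_eq_zero_iff (ContinuousAlternatingMap.constOfIsEmptyLIE ℝ (Cn n) ℝ (Fin 0))
      (LinearIsometryEquiv.injective _))
  rw [tsupport, tsupport, this]

lemma hat_zeroForm (f : Cn n → ℝ) (z : Cn n) :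
    hat (zeroForm f z).toAlternatingMap = algebraMap ℝ _ (f z) := by
  rw [hat_eq_coef, Fintype.sum_unique, ExteriorAlgebra.ιMulti_zero_apply, Nat.factorial_zero,
    Nat.cast_one, inv_one, one_smul, Algebra.algebraMap_eq_smul_one]
  rfl

lemma smoothCurrent_zeroForm (q : ℕ) (W : Multiset (Cn n → ℝ)) (f : Cn n → ℝ) :
    smoothCurrent q W (zeroForm f) = ∫ z, f z * tauE n (beta n ^ q * hprod W z) := by
  rw [smoothCurrent]
  refine integral_congr_ae (Eventually.of_forall fun z => ?_)
  simp only
  rw [hat_zeroForm, Algebra.algebraMap_eq_smul_one, mul_smul_comm, mul_one, map_smul, smul_eq_mul]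
  rfl

lemma exists_cutoff {K D : Set (Cn n)} (hK : IsCompact K) (hD : IsOpen D) (hKD : K ⊆ D) :
    ∃ χ : Cn n → ℝ, ContDiff ℝ ∞ χ ∧ HasCompactSupport χ ∧ tsupport χ ⊆ D ∧
      (∀ z, 0 ≤ χ z ∧ χ z ≤ 1) ∧ ∀ z ∈ K, χ z = 1 := by
  obtain ⟨L, hL, hKL, hLD⟩ := exists_compact_between hK hD hKD
  obtain ⟨f, hf, hf1, hf2, hf3⟩ := exists_contMDiff_zero_iff_one_iff_of_isClosed
    (modelWithCornersSelf ℝ (Cn n)) (n := ⊤) (isOpen_interior (s := L)).isClosed_compl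
    hK.isClosed (disjoint_left.2 fun z hz hz' => hz (hKL hz'))
  have hsupp : tsupport f ⊆ L := closure_minimal (fun z hz => by
    by_contra h
    exact hz ((hf2 z).1 fun h' => h (interior_subset h'))) hL.isClosed
  exact ⟨f, hf.contDiff, hL.of_isClosed_subset (isClosed_tsupport _) hsupp, hsupp.trans hLD,
    fun z => hf1 ⟨z, rfl⟩, fun z hz => (hf3 z).1 hz⟩

/-- A cutoff `χ` equal to `1` on `K` is inserted and `ddᶜ` is moved from one potential onto `χ`. The
integral is then at most a constant times `M` times the mass of the remaining `k` potentials on the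
support of `χ`. -/
theorem exists_mass_le {m : ℕ} (hmn : m ≤ n) {D : Set (Cn n)} (hD : IsOpen D) (k : ℕ)
    (hk : k ≤ m) {K : Set (Cn n)} (hK : IsCompact K) (hKD : K ⊆ D) :
    ∃ K' : Set (Cn n), IsCompact K' ∧ K' ⊆ D ∧ ∀ M : ℝ, ∃ C : ℝ, ∀ W : Multiset (Cn n → ℝ),
      W.card = k →
      (∀ w ∈ W, ContDiff ℝ ∞ w ∧ ∀ z ∈ K', hess w z ∈ gam n m ∧ |w z| ≤ M) → mass K W ≤ C := by
  induction k generalizing K with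
  | zero =>
    refine ⟨K, hK, hKD, fun M => ⟨mass K 0, fun W hW _ => ?_⟩⟩
    rw [Multiset.card_eq_zero.1 hW]
  | succ k ih =>
    obtain ⟨χ, hχs, hχc, hχD, hχ01, hχ1⟩ := exists_cutoff hK hD hKD
    obtain ⟨K', hK'c, hK'D, hC⟩ := ih (by omega) hχc hχD
    obtain ⟨C₁, hC₁, hbound⟩ := exists_abs_smoothCurrent_le n 1
    have hzs : ContDiff ℝ ∞ (zeroForm χ) := contDiff_zeroForm hχs
    have hzc : HasCompactSupport (zeroForm χ) := by
      rw [HasCompactSupport, tsupport_zeroForm]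
      exact hχc
    have hdc : Continuous (ddc (zeroForm χ)) := (contDiff_ddc hzs).continuous
    obtain ⟨B, hB⟩ := (hasCompactSupport_ddc hzc).exists_bound_of_continuous hdc
    have hB0 : 0 ≤ B := (norm_nonneg _).trans (hB 0)
    refine ⟨K' ∪ tsupport χ, hK'c.union hχc, union_subset hK'D hχD, fun M => ?_⟩
    obtain ⟨C, hC⟩ := hC M
    refine ⟨C₁ * (max M 0 * B) * C, fun W hWk hW => ?_⟩
    obtain ⟨w, hw⟩ : ∃ w, w ∈ W := Multiset.card_pos_iff_exists_mem.1 (by omega)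
    obtain ⟨W', rfl⟩ := Multiset.exists_cons_of_mem hw
    rw [Multiset.card_cons] at hWk
    have hWk' : W'.card = k := by omega
    have hw' := hW w (Multiset.mem_cons_self w W')
    have hW' : ∀ v ∈ W', ContDiff ℝ ∞ v ∧ ∀ z ∈ K' ∪ tsupport χ, hess v z ∈ gam n m ∧ |v z| ≤ M :=
      fun v hv => hW v (Multiset.mem_cons_of_mem hv)
    have hWs : ∀ v ∈ W', ContDiff ℝ ∞ v := fun v hv => (hW' v hv).1
    have hint : Continuous fun z => χ z *
        tauE n (beta n ^ (n - (W'.card + 1)) * hprod (w ::ₘ W') z) :=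
      hχs.continuous.mul (continuous_tauE_hprod (contDiff_mem_cons hw'.1 hWs) _)
    have h1 : mass K (w ::ₘ W') ≤ smoothCurrent (n - (W'.card + 1)) (w ::ₘ W') (zeroForm χ) := by
      rw [smoothCurrent_zeroForm, mass, Multiset.card_cons]
      have e1 : ∫ z in K, tauE n (beta n ^ (n - (W'.card + 1)) * hprod (w ::ₘ W') z) =
          ∫ z in K, χ z * tauE n (beta n ^ (n - (W'.card + 1)) * hprod (w ::ₘ W') z) :=
        setIntegral_congr_fun hK.measurableSet fun z hz => by simp only [hχ1 z hz, one_mul]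
      rw [e1]
      refine setIntegral_le_integral (hint.integrable_of_hasCompactSupport hχc.mul_right)
        (Eventually.of_forall fun z => ?_)
      by_cases hz : z ∈ tsupport χ
      · have := tauE_hprod_nonneg hmn (W := w ::ₘ W') (z := z) (by rw [Multiset.card_cons]; omega)
          fun v hv => ((hW v hv).2 z (Or.inr hz)).1
        rw [Multiset.card_cons] at this
        exact mul_nonneg (hχ01 z).1 this
      · simp [image_eq_zero_of_notMem_tsupport hz]
    have h2 := smoothCurrent_cons hWs (n - (W'.card + 1)) hzs hzc hw'.1
    have hsub : tsupport (fun z => w z • ddc (zeroForm χ) z) ⊆ tsupport χ := by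
      rw [← tsupport_zeroForm χ]
      exact (tsupport_smul_subset_right _ _).trans (tsupport_ddc_subset _)
    have h3 := hbound m hmn W' hWs (by omega) (tsupport χ) hχc
      (fun v hv z hz => ((hW' v hv).2 z (Or.inr hz)).1) (fun z => w z • ddc (zeroForm χ) z)
      (hw'.1.continuous.smul hdc) hsub (max M 0 * B) fun z => by
        by_cases hz : z ∈ tsupport χ
        · rw [norm_smul, Real.norm_eq_abs]
          exact mul_le_mul ((hw'.2 z (Or.inr hz)).2.trans (le_max_left _ _)) (hB z) (norm_nonneg _)
            (le_max_right _ _)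
        · rw [image_eq_zero_of_notMem_tsupport (f := fun z => w z • ddc (zeroForm χ) z)
            fun h => hz (hsub h), norm_zero]
          positivity
    have h4 := hC W' hWk' fun v hv => ⟨(hW' v hv).1, fun z hz => (hW' v hv).2 z (Or.inl hz)⟩
    calc mass K (w ::ₘ W') ≤ _ := h1
      _ = _ := h2
      _ ≤ _ := le_abs_self _
      _ ≤ _ := h3
      _ ≤ _ := mul_le_mul_of_nonneg_left h4 (by positivity)

/-- Chern-Levine-Nirenberg inequality. -/
theorem exists_smoothCurrent_bound {m : ℕ} (hmn : m ≤ n) {D : Set (Cn n)} (hD : IsOpen D)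
    (k p : ℕ) (hk : k + p ≤ m) {K : Set (Cn n)} (hK : IsCompact K) (hKD : K ⊆ D) :
    ∃ K' : Set (Cn n), IsCompact K' ∧ K' ⊆ D ∧ ∀ M : ℝ, ∃ C : ℝ, 0 ≤ C ∧
      ∀ W : Multiset (Cn n → ℝ),
      W.card = k →
      (∀ w ∈ W, ContDiff ℝ ∞ w ∧ ∀ z ∈ K', hess w z ∈ gam n m ∧ |w z| ≤ M) →
      ∀ ψ : Form n (2 * p), Continuous ψ → tsupport ψ ⊆ K → ∀ b : ℝ, (∀ z, ‖ψ z‖ ≤ b) →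
        |smoothCurrent (n - (k + p)) W ψ| ≤ C * b := by
  obtain ⟨K', hK'c, hK'D, hC⟩ := exists_mass_le hmn hD k (by omega) hK hKD
  obtain ⟨C₁, hC₁, hbound⟩ := exists_abs_smoothCurrent_le n p
  refine ⟨K' ∪ K, hK'c.union hK, union_subset hK'D hKD, fun M => ?_⟩
  obtain ⟨C, hC⟩ := hC M
  refine ⟨C₁ * max C 0, by positivity, fun W hWk hW ψ hψ hψK b hb => ?_⟩
  have hb0 : 0 ≤ b := (norm_nonneg _).trans (hb 0)
  have h1 := hbound m hmn W (fun w hw => (hW w hw).1) (by omega) K hK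
    (fun w hw z hz => ((hW w hw).2 z (Or.inr hz)).1) ψ hψ hψK b hb
  have h2 := hC W hWk fun w hw => ⟨(hW w hw).1, fun z hz => (hW w hw).2 z (Or.inl hz)⟩
  rw [hWk] at h1
  refine h1.trans ((mul_le_mul_of_nonneg_left (h2.trans (le_max_left C 0))
    (mul_nonneg hC₁ hb0)).trans_eq ?_)
  ring

end Mass

/-! ### Existence of the currents -/

section Existence

open Filter Topology

variable {n : ℕ}

lemma Form.sub_eq {d : ℕ} (ψ η : Form n d) : ψ - η = ψ + (-1 : ℝ) • η :=
  (sub_eq_add_neg ψ η).trans (congrArg (ψ + ·) (neg_one_smul ℝ η).symm)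

lemma Covec.smul_sub_smul {d : ℕ} (a b : ℝ) (η : Covec n d) : a • η - b • η = (a - b) • η :=
  (sub_smul a b η).symm

lemma hat_add {d : ℕ} (η ξ : Covec n d) :
    hat (η + ξ).toAlternatingMap = hat η.toAlternatingMap + hat ξ.toAlternatingMap :=
  map_add hat η.toAlternatingMap ξ.toAlternatingMap

lemma IsTestForm.isContTestForm {d : ℕ} {D : Set (Cn n)} {ψ : Form n d} (h : IsTestForm D ψ) :
    IsContTestForm D ψ := ⟨h.1.continuous, h.2⟩

lemma IsContTestForm.add {d : ℕ} {D : Set (Cn n)} {ψ η : Form n d} (hψ : IsContTestForm D ψ)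
    (hη : IsContTestForm D η) : IsContTestForm D (ψ + η) :=
  ⟨hψ.1.add hη.1, hψ.2.1.add hη.2.1,
    (tsupport_add ψ η).trans (union_subset hψ.2.2 hη.2.2)⟩

lemma IsContTestForm.smul {d : ℕ} {D : Set (Cn n)} {ψ : Form n d} (c : ℝ)
    (hψ : IsContTestForm D ψ) : IsContTestForm D (c • ψ) :=
  ⟨hψ.1.const_smul c, hψ.2.1.smul_left (f := fun _ => c),
    (tsupport_smul_subset_right (fun _ => c) ψ).trans hψ.2.2⟩

lemma IsContTestForm.sub {d : ℕ} {D : Set (Cn n)} {ψ η : Form n d} (hψ : IsContTestForm D ψ)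
    (hη : IsContTestForm D η) : IsContTestForm D (ψ - η) := by
  have := hψ.add (hη.smul (-1))
  rwa [← Form.sub_eq] at this

lemma tsupport_sub_subset {d : ℕ} {ψ η : Form n d} {K : Set (Cn n)} (hψ : tsupport ψ ⊆ K)
    (hη : tsupport η ⊆ K) : tsupport (ψ - η) ⊆ K :=
  (tsupport_sub ψ η).trans (union_subset hψ hη)

lemma IsOrderZeroCurrent.map_sub {d : ℕ} {D : Set (Cn n)} {T : Form n d → ℝ}
    (hT : IsOrderZeroCurrent D T) {ψ η : Form n d} (hψ : IsContTestForm D ψ)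
    (hη : IsContTestForm D η) : T (ψ - η) = T ψ - T η := by
  have h1 := hT.map_add ψ ((-1 : ℝ) • η) hψ (hη.smul (-1))
  rw [hT.map_smul _ _ hη, ← Form.sub_eq] at h1
  rw [h1]
  ring

/-- The compact set `K` is fixed before `ε`, so that a single order-zero bound controls all the
approximation errors. -/
theorem exists_smooth_form_approx {d : ℕ} {D : Set (Cn n)} (hD : IsOpen D) {ψ : Form n d}
    (hψ : IsContTestForm D ψ) : ∃ K : Set (Cn n), IsCompact K ∧ K ⊆ D ∧ tsupport ψ ⊆ K ∧
      ∀ ε > 0, ∃ ψ' : Form n d, IsTestForm D ψ' ∧ tsupport ψ' ⊆ K ∧ ∀ z, ‖(ψ - ψ') z‖ ≤ ε := by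
  obtain ⟨ε₀, hε₀, hε₀D⟩ := hψ.2.1.exists_cthickening_subset_open hD hψ.2.2
  have hKc : IsCompact (cthickening ε₀ (tsupport ψ)) := hψ.2.1.isCompact.cthickening
  refine ⟨cthickening ε₀ (tsupport ψ), hKc, hε₀D,
    self_subset_cthickening _, fun ε hε => ?_⟩
  have hu := hψ.2.1.uniformContinuous_of_continuous hψ.1
  obtain ⟨ε₁, hε₁, h⟩ := Metric.uniformContinuous_iff.1 hu ε hε
  have hpos : 0 < min ε₀ ε₁ := lt_min hε₀ hε₁
  let φ : ContDiffBump (0 : Cn n) := ⟨min ε₀ ε₁ / 2, min ε₀ ε₁, half_pos hpos, half_lt_self hpos⟩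
  set ψ' : Form n d := convolution (φ.normed volume) ψ (ContinuousLinearMap.lsmul ℝ ℝ) volume
    with hψ'
  have hs : ContDiff ℝ ∞ ψ' := φ.hasCompactSupport_normed.contDiff_convolution_left (n := ⊤) _
    (φ.contDiff_normed (n := ⊤)) (hψ.1.locallyIntegrable)
  have hsub : tsupport ψ' ⊆ cthickening ε₀ (tsupport ψ) := by
    refine closure_minimal (fun z hz => ?_) hKc.isClosed
    obtain ⟨a, ha, c, hc, rfl⟩ := support_convolution_subset_swap _ hz
    rw [φ.support_normed_eq, mem_ball_zero_iff] at hc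
    refine mem_cthickening_of_dist_le _ a _ _ (subset_tsupport _ ha) ?_
    rw [dist_eq_norm, add_sub_cancel_left]
    exact hc.le.trans (min_le_left _ _)
  refine ⟨ψ', ⟨hs, hKc.of_isClosed_subset (isClosed_tsupport _) hsub, hsub.trans hε₀D⟩, hsub,
    fun z => ?_⟩
  have h1 := ContDiffBump.dist_normed_convolution_le (φ := φ) (μ := (volume : Measure (Cn n)))
    (g := ψ) (x₀ := z) (ε := ε) hψ.1.aestronglyMeasurable fun x hx => by
      have hx' : x ∈ ball z (min ε₀ ε₁) := hx
      exact (h (lt_of_lt_of_le hx' (min_le_right _ _))).le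
  rw [dist_comm, dist_eq_norm] at h1
  exact h1

lemma IsOrderZeroCurrent.eq_of_smooth {d : ℕ} {D : Set (Cn n)} (hD : IsOpen D)
    {T T' : Form n d → ℝ} (hT : IsOrderZeroCurrent D T) (hT' : IsOrderZeroCurrent D T')
    (h : ∀ ψ, IsTestForm D ψ → T ψ = T' ψ) {ψ : Form n d} (hψ : IsContTestForm D ψ) :
    T ψ = T' ψ := by
  obtain ⟨K, hK, hKD, hψK, happ⟩ := exists_smooth_form_approx hD hψ
  obtain ⟨C, hC⟩ := hT.bound K hK hKD
  obtain ⟨C', hC'⟩ := hT'.bound K hK hKD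
  have h1 : ∀ ε > 0, |T ψ - T' ψ| ≤ (C + C') * ε := by
    intro ε hε
    obtain ⟨ψ', hψ', hψ'K, hle⟩ := happ ε hε
    have e1 := hC _ (hψ.sub hψ'.isContTestForm) (tsupport_sub_subset hψK hψ'K) ε hle
    have e2 := hC' _ (hψ.sub hψ'.isContTestForm) (tsupport_sub_subset hψK hψ'K) ε hle
    rw [hT.map_sub hψ hψ'.isContTestForm] at e1
    rw [hT'.map_sub hψ hψ'.isContTestForm] at e2
    rw [h ψ' hψ'] at e1
    rw [abs_le] at *
    constructor <;> linarith
  have h2 : Tendsto (fun ε : ℝ => (C + C') * ε) (𝓝[>] 0) (𝓝 0) := by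
    have : Tendsto (fun ε : ℝ => (C + C') * ε) (𝓝 0) (𝓝 ((C + C') * 0)) :=
      (continuous_const.mul continuous_id).tendsto 0
    rw [mul_zero] at this
    exact this.mono_left nhdsWithin_le_nhds
  have h3 : |T ψ - T' ψ| ≤ 0 :=
    ge_of_tendsto h2 (eventually_nhdsWithin_of_forall fun ε hε => h1 ε hε)
  exact sub_eq_zero.1 (abs_nonpos_iff.1 h3)

/-- A Banach–Steinhaus argument: bounds that are uniform for large `j`, and convergence on the dense
class of smooth forms, give convergence on continuous forms. -/
theorem exists_isOrderZeroCurrent_of_tendsto {d : ℕ} {D : Set (Cn n)} (hD : IsOpen D)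
    {A : ℕ → Form n d → ℝ}
    (hadd : ∀ j ψ η, IsContTestForm D ψ → IsContTestForm D η → A j (ψ + η) = A j ψ + A j η)
    (hsmul : ∀ j (c : ℝ) ψ, IsContTestForm D ψ → A j (c • ψ) = c * A j ψ)
    (hbdd : ∀ K : Set (Cn n), IsCompact K → K ⊆ D → ∃ C : ℝ, ∀ᶠ j in atTop,
      ∀ ψ, IsContTestForm D ψ → tsupport ψ ⊆ K → ∀ b : ℝ, (∀ z, ‖ψ z‖ ≤ b) → |A j ψ| ≤ C * b)
    (hconv : ∀ ψ, IsTestForm D ψ → ∃ l, Tendsto (fun j => A j ψ) atTop (𝓝 l)) :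
    ∃ T, IsOrderZeroCurrent D T ∧
      ∀ ψ, IsContTestForm D ψ → Tendsto (fun j => A j ψ) atTop (𝓝 (T ψ)) := by
  have hsubA : ∀ j ψ η, IsContTestForm D ψ → IsContTestForm D η →
      A j (ψ - η) = A j ψ - A j η := by
    intro j ψ η hψ hη
    have h1 := hadd j ψ ((-1 : ℝ) • η) hψ (hη.smul (-1))
    rw [hsmul _ _ _ hη, ← Form.sub_eq] at h1
    rw [h1]
    ring
  have hlim : ∀ ψ, IsContTestForm D ψ → ∃ l, Tendsto (fun j => A j ψ) atTop (𝓝 l) := by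
    intro ψ hψ
    obtain ⟨K, hK, hKD, hψK, happ⟩ := exists_smooth_form_approx hD hψ
    obtain ⟨C, hC⟩ := hbdd K hK hKD
    refine cauchySeq_tendsto_of_complete (Metric.cauchySeq_iff'.2 fun ε hε => ?_)
    -- The two replacements of `ψ` by `ψ'` cost at most `ε / 4` each, leaving `ε / 2` for the Cauchy
    -- property at `ψ'`.
    obtain ⟨ψ', hψ', hψ'K, hle⟩ := happ (ε / (4 * (|C| + 1))) (by positivity)
    obtain ⟨l, hl⟩ := hconv ψ' hψ'
    obtain ⟨N', hN'⟩ := eventually_atTop.1 hC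
    have hCε : C * (ε / (4 * (|C| + 1))) ≤ ε / 4 := by
      rw [mul_div_assoc', div_le_iff₀ (by positivity)]
      nlinarith [le_abs_self C, abs_nonneg C]
    have hb : ∀ j ≥ N', |A j ψ - A j ψ'| ≤ ε / 4 := by
      intro j hj
      rw [← hsubA j _ _ hψ hψ'.isContTestForm]
      exact (hN' j hj _ (hψ.sub hψ'.isContTestForm) (tsupport_sub_subset hψK hψ'K) _ hle).trans hCε
    obtain ⟨N₂, hN₂⟩ := (Metric.cauchySeq_iff.1 hl.cauchySeq) (ε / 2) (half_pos hε)
    refine ⟨max N' N₂, fun j hj => ?_⟩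
    have e1 := hb j (le_trans (le_max_left _ _) hj)
    have e2 := hb (max N' N₂) (le_max_left _ _)
    have e3 := hN₂ j (le_trans (le_max_right _ _) hj) (max N' N₂) (le_max_right _ _)
    rw [Real.dist_eq, abs_lt] at *
    rw [abs_le] at e1 e2
    constructor <;> linarith
  choose! T hT using hlim
  refine ⟨T, ⟨fun ψ η hψ hη => ?_, fun c ψ hψ => ?_, fun K hK hKD => ?_⟩, hT⟩
  · refine tendsto_nhds_unique (hT _ (hψ.add hη)) (((hT _ hψ).add (hT _ hη)).congr fun j => ?_)
    rw [hadd j _ _ hψ hη]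
  · refine tendsto_nhds_unique (hT _ (hψ.smul c)) (((hT _ hψ).const_mul c).congr fun j => ?_)
    rw [hsmul j _ _ hψ]
  · obtain ⟨C, hC⟩ := hbdd K hK hKD
    refine ⟨C, fun ψ hψ hψK b hb => le_of_tendsto (hT ψ hψ).abs ?_⟩
    filter_upwards [hC] with j hj
    exact hj ψ hψ hψK b hb

lemma smoothCurrent_add {W : Multiset (Cn n → ℝ)} (hW : ∀ w ∈ W, ContDiff ℝ ∞ w) (q : ℕ) {d : ℕ}
    {D : Set (Cn n)} {ψ η : Form n d} (hψ : IsContTestForm D ψ) (hη : IsContTestForm D η) :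
    smoothCurrent q W (ψ + η) = smoothCurrent q W ψ + smoothCurrent q W η := by
  unfold smoothCurrent
  rw [← integral_add (integrable_smoothCurrent hW q hψ.1 hψ.2.1)
    (integrable_smoothCurrent hW q hη.1 hη.2.1)]
  refine integral_congr_ae (Eventually.of_forall fun z => ?_)
  simp only [Pi.add_apply]
  rw [hat_add, mul_add, map_add]

lemma smoothCurrent_smul (W : Multiset (Cn n → ℝ)) (q : ℕ) {d : ℕ} (c : ℝ) (ψ : Form n d) :
    smoothCurrent q W (c • ψ) = c * smoothCurrent q W ψ := by
  unfold smoothCurrent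
  rw [← integral_const_mul]
  refine integral_congr_ae (Eventually.of_forall fun z => ?_)
  simp only [Pi.smul_apply]
  rw [hat_smul, mul_smul_comm, map_smul, smul_eq_mul]

lemma smoothCurrent_sub {W : Multiset (Cn n → ℝ)} (hW : ∀ w ∈ W, ContDiff ℝ ∞ w) (q : ℕ) {d : ℕ}
    {D : Set (Cn n)} {ψ η : Form n d} (hψ : IsContTestForm D ψ) (hη : IsContTestForm D η) :
    smoothCurrent q W (ψ - η) = smoothCurrent q W ψ - smoothCurrent q W η := by
  have h1 := smoothCurrent_add hW q hψ (hη.smul (-1))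
  rw [smoothCurrent_smul, ← Form.sub_eq] at h1
  rw [h1]
  ring

/-- The multiset of the `j`-th terms of `k` sequences of functions. -/
def terms {k : ℕ} (w : Fin k → ℕ → Cn n → ℝ) (j : ℕ) : Multiset (Cn n → ℝ) :=
  Finset.univ.val.map fun i => w i j

lemma card_terms {k : ℕ} (w : Fin k → ℕ → Cn n → ℝ) (j : ℕ) : (terms w j).card = k := by
  simp [terms]

lemma mem_terms {k : ℕ} {w : Fin k → ℕ → Cn n → ℝ} {j : ℕ} {v : Cn n → ℝ} :
    v ∈ terms w j ↔ ∃ i, w i j = v := by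
  simp [terms]

lemma terms_zero (w : Fin 0 → ℕ → Cn n → ℝ) (j : ℕ) : terms w j = 0 := rfl

lemma terms_succ {k : ℕ} (w : Fin (k + 1) → ℕ → Cn n → ℝ) (j : ℕ) :
    terms w j = w (Fin.last k) j ::ₘ terms (Fin.init w) j := by
  rw [terms, Fin.univ_castSuccEmb, Finset.cons_val, Multiset.map_cons, Finset.map_val,
    Multiset.map_map]
  rfl

lemma terms_succ' {k : ℕ} (w : Fin (k + 1) → ℕ → Cn n → ℝ) (j : ℕ) :
    terms w j = w 0 j ::ₘ terms (Fin.tail w) j := by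
  rw [terms, Fin.univ_succ, Finset.cons_val, Multiset.map_cons, Finset.map_val,
    Multiset.map_map]
  rfl

lemma contDiff_terms {m k : ℕ} {D : Set (Cn n)} {u : Fin k → Cn n → ℝ}
    {w : Fin k → ℕ → Cn n → ℝ} (h : ∀ i, IsSmoothApprox m D (u i) (w i)) (j : ℕ) :
    ∀ v ∈ terms w j, ContDiff ℝ ∞ v := by
  intro v hv
  obtain ⟨i, rfl⟩ := mem_terms.1 hv
  exact (h i).1 j

/-- Eventually the approximations are `m`-subharmonic on `K`, and bounded by `M + 1` if the
limits are bounded by `M`. -/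
lemma eventually_terms {m k : ℕ} {D : Set (Cn n)} {u : Fin k → Cn n → ℝ}
    {w : Fin k → ℕ → Cn n → ℝ} (h : ∀ i, IsSmoothApprox m D (u i) (w i)) {K : Set (Cn n)}
    (hK : IsCompact K) (hKD : K ⊆ D) {M : ℝ} (hM : ∀ i, ∀ z ∈ K, |u i z| ≤ M) :
    ∀ᶠ j in atTop, ∀ v ∈ terms w j, ContDiff ℝ ∞ v ∧
      ∀ z ∈ K, hess v z ∈ gam n m ∧ |v z| ≤ M + 1 := by
  have h1 : ∀ᶠ j in atTop, ∀ i, ∀ z ∈ K, hess (w i j) z ∈ gam n m :=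
    eventually_all.2 fun i => ((h i).2 K hK hKD).1
  have h2 : ∀ᶠ j in atTop, ∀ i, ∀ z ∈ K, |w i j z - u i z| ≤ 1 :=
    eventually_all.2 fun i => ((h i).2 K hK hKD).2 1 one_pos
  filter_upwards [h1, h2] with j hj1 hj2 v hv
  obtain ⟨i, rfl⟩ := mem_terms.1 hv
  refine ⟨(h i).1 j, fun z hz => ⟨hj1 i z hz, ?_⟩⟩
  have e1 := hj2 i z hz
  have e2 := hM i z hz
  rw [abs_le] at *
  constructor <;> linarith

lemma exists_common_bound {k : ℕ} {u : Fin k → Cn n → ℝ} {K : Set (Cn n)} (hK : IsCompact K)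
    (hu : ∀ i, ContinuousOn (u i) K) : ∃ M : ℝ, ∀ i, ∀ z ∈ K, |u i z| ≤ M := by
  choose M hM using fun i => hK.exists_bound_of_continuousOn (hu i)
  refine ⟨∑ i, |M i|, fun i z hz => (hM i z hz).trans ((le_abs_self _).trans ?_)⟩
  exact Finset.single_le_sum (f := fun i => |M i|) (fun _ _ => abs_nonneg _) (Finset.mem_univ i)

lemma eventually_abs_smoothCurrent_le {m k p : ℕ} (hmn : m ≤ n) (hkp : k + p ≤ m) {D : Set (Cn n)}
    (hD : IsOpen D) {u : Fin k → Cn n → ℝ} (hu : ∀ i, ContinuousOn (u i) D)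
    {w : Fin k → ℕ → Cn n → ℝ} (h : ∀ i, IsSmoothApprox m D (u i) (w i)) {K : Set (Cn n)}
    (hK : IsCompact K) (hKD : K ⊆ D) : ∃ C : ℝ, 0 ≤ C ∧ ∀ᶠ j in atTop,
      ∀ ψ : Form n (2 * p), Continuous ψ → tsupport ψ ⊆ K → ∀ b : ℝ, (∀ z, ‖ψ z‖ ≤ b) →
        |smoothCurrent (n - (k + p)) (terms w j) ψ| ≤ C * b := by
  obtain ⟨K', hK'c, hK'D, hC⟩ := exists_smoothCurrent_bound hmn hD k p hkp hK hKD
  obtain ⟨M, hM⟩ := exists_common_bound hK'c fun i => (hu i).mono hK'D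
  obtain ⟨C, hC0, hC⟩ := hC (M + 1)
  refine ⟨C, hC0, ?_⟩
  filter_upwards [eventually_terms h hK'c hK'D hM] with j hj
  exact hC _ (card_terms w j) hj

lemma IsContTestForm.continuousOn_smul {d : ℕ} {D : Set (Cn n)} (hD : IsOpen D) {u : Cn n → ℝ}
    (hu : ContinuousOn u D) {ψ : Form n d} (hψ : IsContTestForm D ψ) :
    IsContTestForm D fun z => u z • ψ z := by
  refine ⟨?_, hψ.2.1.of_isClosed_subset (isClosed_tsupport _) (tsupport_smul_subset_right u ψ),
    (tsupport_smul_subset_right u ψ).trans hψ.2.2⟩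
  refine continuous_iff_continuousAt.2 fun z => ?_
  by_cases hz : z ∈ D
  · have h1 : ContinuousAt u z := hu.continuousAt (hD.mem_nhds hz)
    have h2 : ContinuousAt ψ z := hψ.1.continuousAt
    exact h1.smul h2
  · have h0 : (fun z => u z • ψ z) =ᶠ[𝓝 z] fun _ => 0 := by
      filter_upwards [notMem_tsupport_iff_eventuallyEq.1 fun h => hz (hψ.2.2 h)] with y hy
      rw [hy, Pi.zero_apply, smul_zero]
    exact continuousAt_const.congr h0.symm

lemma IsTestForm.ddc {d : ℕ} {D : Set (Cn n)} {ψ : Form n d} (hψ : IsTestForm D ψ) :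
    IsTestForm D (ddc ψ) :=
  ⟨contDiff_ddc hψ.1, hasCompactSupport_ddc hψ.2.1, (tsupport_ddc_subset ψ).trans hψ.2.2⟩

lemma smoothCurrent_zero_eq {p : ℕ} {D : Set (Cn n)} {ψ : Form n (2 * p)}
    (hψ : tsupport ψ ⊆ D) : smoothCurrent (n - p) 0 ψ =
      ∫ z in D, topCoeff (wedge (betaPow (n - p) z) (ψ z).toAlternatingMap) := by
  have h1 : ∀ z, topCoeff (wedge (betaPow (n - p) z) (ψ z).toAlternatingMap) =
      tau n (evVal n (beta n ^ (n - p) * hprod 0 z) * hat (ψ z).toAlternatingMap) := by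
    intro z
    rw [hprod_zero, mul_one, tau_eq_topCoeff (Rep_wedge (Rep_betaPow (n - p) z) (hat_mem_Rep _))]
  rw [setIntegral_eq_integral_of_forall_compl_eq_zero fun z hz => ?_]
  · simp only [h1]
    rfl
  · have h0 : ψ z = 0 := image_eq_zero_of_notMem_tsupport fun h => hz (hψ h)
    have h2 : hat (0 : Covec n (2 * p)).toAlternatingMap = 0 := map_zero hat
    rw [h1, h0, h2, mul_zero, map_zero]

/-- If `v j → v` and `A j → S`, then `A j (v j ψ) → S (v ψ)`. -/
lemma tendsto_smoothCurrent_smul {m k p : ℕ} (hmn : m ≤ n) (hkp : k + p ≤ m) {D : Set (Cn n)}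
    (hD : IsOpen D) {u : Fin k → Cn n → ℝ} (hu : ∀ i, ContinuousOn (u i) D)
    {w : Fin k → ℕ → Cn n → ℝ} (h : ∀ i, IsSmoothApprox m D (u i) (w i))
    {S : Form n (2 * p) → ℝ}
    (hS : ∀ ψ, IsContTestForm D ψ →
      Tendsto (fun j => smoothCurrent (n - (k + p)) (terms w j) ψ) atTop (𝓝 (S ψ)))
    {v : ℕ → Cn n → ℝ} (hv : ∀ j, Continuous (v j)) {v₀ : Cn n → ℝ} (hv₀ : ContinuousOn v₀ D)
    (hvv : ∀ K : Set (Cn n), IsCompact K → K ⊆ D →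
      ∀ δ > 0, ∀ᶠ j in atTop, ∀ z ∈ K, |v j z - v₀ z| ≤ δ)
    {ψ : Form n (2 * p)} (hψ : IsContTestForm D ψ) :
    Tendsto (fun j => smoothCurrent (n - (k + p)) (terms w j) fun z => v j z • ψ z) atTop
      (𝓝 (S fun z => v₀ z • ψ z)) := by
  obtain ⟨C, hC0, hC⟩ := eventually_abs_smoothCurrent_le hmn hkp hD hu h hψ.2.1 hψ.2.2
  obtain ⟨B, hB⟩ := hψ.2.1.exists_bound_of_continuous hψ.1
  have hB0 : 0 ≤ B := (norm_nonneg _).trans (hB 0)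
  have ht0 := hψ.continuousOn_smul hD hv₀
  have htj := fun j => hψ.continuousOn_smul hD (hv j).continuousOn
  have h1 : Tendsto (fun j => smoothCurrent (n - (k + p)) (terms w j) (fun z => v j z • ψ z) -
      smoothCurrent (n - (k + p)) (terms w j) fun z => v₀ z • ψ z) atTop (𝓝 0) := by
    rw [Metric.tendsto_atTop']
    intro ε hε
    have hev := hvv _ hψ.2.1 hψ.2.2 (ε / (2 * (C * B + 1))) (by positivity)
    obtain ⟨N, hN⟩ := eventually_atTop.1 (hC.and hev)
    refine ⟨N, fun j hj => ?_⟩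
    obtain ⟨e1, e2⟩ := hN j hj.le
    rw [Real.dist_eq, sub_zero, ← smoothCurrent_sub (contDiff_terms h j) _ (htj j) ht0]
    have e3 := e1 ((fun z => v j z • ψ z) - fun z => v₀ z • ψ z)
      ((htj j).sub ht0).1
      (tsupport_sub_subset (tsupport_smul_subset_right _ _) (tsupport_smul_subset_right _ _))
      (ε / (2 * (C * B + 1)) * B) fun z => by
        rw [Pi.sub_apply, Covec.smul_sub_smul, norm_smul, Real.norm_eq_abs]
        by_cases hz : z ∈ tsupport ψ
        · exact mul_le_mul (e2 z hz) (hB z) (norm_nonneg _) (by positivity)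
        · rw [image_eq_zero_of_notMem_tsupport hz, norm_zero, mul_zero]
          positivity
    refine e3.trans_lt ?_
    have : C * (ε / (2 * (C * B + 1)) * B) = ε * (C * B) / (2 * (C * B + 1)) := by ring
    rw [this, div_lt_iff₀ (by positivity)]
    nlinarith [mul_nonneg hC0 hB0]
  have h2 := h1.add (hS _ ht0)
  rw [zero_add] at h2
  exact h2.congr fun j => by ring

/-- Convergence is proved for every current satisfying the recursive definition and every smooth
approximation. The current is therefore unique on continuous test forms and does not depend on the
order of the functions. -/
theorem hessianCurrent_exists_and_tendsto {m : ℕ} (hmn : m ≤ n) {D : Set (Cn n)}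
    (hD : IsOpen D) (k : ℕ) : ∀ p, k + p ≤ m → ∀ u : Fin k → Cn n → ℝ,
      (∀ i, ContinuousOn (u i) D) → ∀ w : Fin k → ℕ → Cn n → ℝ,
      (∀ i, IsSmoothApprox m D (u i) (w i)) →
      (∃ T, IsHessianCurrent D k u p T) ∧ ∀ T, IsHessianCurrent D k u p T →
        IsOrderZeroCurrent D T ∧ ∀ ψ, IsContTestForm D ψ →
          Tendsto (fun j => smoothCurrent (n - (k + p)) (terms w j) ψ) atTop (𝓝 (T ψ)) := by
  induction k with
  | zero =>
    intro p hp u hu w hw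
    refine ⟨⟨smoothCurrent (n - p) 0, ⟨?_, ?_, ?_⟩, ?_⟩, fun T hT => ⟨hT.1, fun ψ hψ => ?_⟩⟩
    · exact fun ψ η hψ hη => smoothCurrent_add (by simp) _ hψ hη
    · exact fun c ψ _ => smoothCurrent_smul _ _ c ψ
    · intro K hK hKD
      obtain ⟨C, -, hC⟩ := eventually_abs_smoothCurrent_le hmn hp hD hu hw hK hKD
      obtain ⟨j, hj⟩ := hC.exists
      refine ⟨C, fun ψ hψ hψK b hb => ?_⟩
      have := hj ψ hψ.1 hψK b hb
      rwa [zero_add, terms_zero] at this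
    · exact fun ψ hψ => smoothCurrent_zero_eq hψ.2.2
    · rw [hT.2 ψ hψ, ← smoothCurrent_zero_eq hψ.2.2, zero_add]
      simp only [terms_zero]
      exact tendsto_const_nhds
  | succ k ih =>
    intro p hp u hu w hw
    obtain ⟨⟨S₀, hS₀⟩, ihT⟩ := ih (p + 1) (by omega) (Fin.init u) (fun i => hu _) (Fin.init w)
      fun i => hw _
    have hlim : ∀ S, IsHessianCurrent D k (Fin.init u) (p + 1) S → ∀ ψ : Form n (2 * p),
        IsTestForm D ψ → Tendsto (fun j => smoothCurrent (n - (k + 1 + p)) (terms w j) ψ) atTop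
          (𝓝 (S fun z => u (Fin.last k) z • ddc ψ z)) := by
      intro S hS ψ hψ
      have h1 := tendsto_smoothCurrent_smul (p := p + 1) hmn (by omega) hD (u := Fin.init u)
        (fun i => hu _) (w := Fin.init w) (fun i => hw _) (ihT S hS).2
        (fun j => ((hw (Fin.last k)).1 j).continuous) (hu (Fin.last k))
        (fun K hK hKD => ((hw (Fin.last k)).2 K hK hKD).2) hψ.ddc.isContTestForm
      refine h1.congr fun j => ?_
      rw [terms_succ, smoothCurrent_cons (contDiff_terms (w := Fin.init w) (u := Fin.init u) (fun i => hw _) j) _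
        hψ.1 hψ.2.1 ((hw (Fin.last k)).1 j), show n - (k + 1 + p) = n - (k + (p + 1)) by omega]
    obtain ⟨T₀, hT₀, hT₀lim⟩ := exists_isOrderZeroCurrent_of_tendsto hD
      (A := fun j => smoothCurrent (n - (k + 1 + p)) (terms w j) (d := 2 * p))
      (fun j ψ η hψ hη => smoothCurrent_add (contDiff_terms hw j) _ hψ hη)
      (fun j c ψ _ => smoothCurrent_smul _ _ c ψ)
      (fun K hK hKD => by
        obtain ⟨C, -, hC⟩ := eventually_abs_smoothCurrent_le hmn hp hD hu hw hK hKD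
        exact ⟨C, hC.mono fun j hj ψ hψ => hj ψ hψ.1⟩)
      fun ψ hψ => ⟨_, hlim S₀ hS₀ ψ hψ⟩
    refine ⟨⟨T₀, S₀, hS₀, hT₀, fun ψ hψ => ?_⟩, ?_⟩
    · exact tendsto_nhds_unique (hT₀lim ψ hψ.isContTestForm) (hlim S₀ hS₀ ψ hψ)
    · rintro T ⟨S, hS, hT, hTS⟩
      refine ⟨hT, fun ψ hψ => ?_⟩
      -- The recursion prescribes `T` on smooth forms only; order zero and density extend the
      -- agreement with the limit `T₀` to continuous forms.
      rw [hT.eq_of_smooth hD hT₀ (fun η hη => ?_) hψ]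
      · exact hT₀lim ψ hψ
      · rw [hTS η hη]
        exact tendsto_nhds_unique (hlim S hS η hη) (hT₀lim η hη.isContTestForm)

end Existence

/-! ### Positivity, gradient currents and weak bounds -/

section Positivity

open Filter Topology ExteriorAlgebra

variable {n : ℕ}

lemma Rep_ofSubsingleton (v : Cn n) (f : Cn n →ₗ[ℝ] ℝ) (h : ∀ u, f u = inner ℝ v u) :
    (ι ℝ v, AlternatingMap.ofSubsingleton ℝ (Cn n) ℝ (0 : Fin 1) f) ∈ Rep n 1 := by
  have h1 := ιMulti_mem_Rep (n := n) (d := 1) fun _ => v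
  rw [ιMulti_succ_apply, ιMulti_zero_apply, mul_one] at h1
  convert h1 using 2
  ext u
  rw [mono_apply]
  simp [h]

/-- Riesz representation: if `α = ⟨v, ·⟩`, then `Re α` and `Im α` are the real covectors of `v` and
`J v`. -/
lemma exists_Rep_elemPos (α : Cn n →ₗ[ℂ] ℂ) :
    ∃ v : Cn n, (evVal n (elem v), elemPos α) ∈ Rep n 2 := by
  obtain ⟨v, hv⟩ : ∃ v : Cn n, ∀ u, inner ℂ v u = α u :=
    ⟨(InnerProductSpace.toDual ℂ (Cn n)).symm (LinearMap.toContinuousLinearMap α),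
      fun u => InnerProductSpace.toDual_symm_apply⟩
  refine ⟨v, Rep_wedge (Rep_ofSubsingleton v _ fun u => ?_)
    (Rep_ofSubsingleton (mulI n v) _ fun u => ?_)⟩
  · rw [inner_real_eq_re, hv]
    rfl
  · rw [inner_mulI_left_eq_im, hv]
    rfl

/-- Elementary positive forms lie in `gam n m`, so the value is a nonnegative multiple of a mixed
product of at most `m` elements of the cone. -/
lemma tau_mul_hat_nonneg {m p : ℕ} (hmn : m ≤ n) (s : Multiset (Ev n)) (hs : s.card + p ≤ m)
    (h : ∀ a ∈ s, a ∈ gam n m) {α : Fin p → Cn n →ₗ[ℂ] ℂ} {c : ℝ} (hc : 0 ≤ c)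
    {η : Covec n (2 * p)} (hη : η.toAlternatingMap = c • wedgeProd p fun j => elemPos (α j)) :
    0 ≤ tau n (evVal n (beta n ^ (n - (s.card + p)) * s.prod) * hat η.toAlternatingMap) := by
  choose v hv using fun j => exists_Rep_elemPos (α j)
  have h1 := Rep_smul c (Rep_wedgeProd p (fun j => elem (v j)) _ hv)
  have h2 : evVal n (beta n ^ (n - (s.card + p)) * s.prod) ∈
      homog n (2 * (n - (s.card + p)) + 2 * s.card) := by
    rw [map_mul]
    exact mul_mem_homog (pow_mem_homog beta_mem_homog _)
      (multiset_prod_mem_homog s fun a ha => Herm_mem_homog (h a ha).1)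
  rw [← hη] at h1
  rw [tau_congr h2 (hat_mem_Rep _) h1, mul_smul_comm, map_smul, smul_eq_mul, ← map_mul]
  refine mul_nonneg hc ?_
  have h3 := tauE_mixed_nonneg hmn (s + Finset.univ.val.map fun j => elem (v j))
    (by simpa using hs) fun a ha => by
      rcases Multiset.mem_add.1 ha with ha | ha
      · exact h a ha
      · obtain ⟨j, -, rfl⟩ := Multiset.mem_map.1 ha
        exact elem_mem_gam hmn _
  rw [Multiset.prod_add, Multiset.card_add, Multiset.card_map, Finset.card_val, Finset.card_univ,
    Fintype.card_fin, ← mul_assoc] at h3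
  exact h3

lemma hess_sq {w : Cn n → ℝ} (hw : ContDiff ℝ ∞ w) (z : Cn n) :
    hess (fun y => w y ^ 2) z = (2 * w z) • hess w z + (1 / 2 : ℝ) • elem (gradVec w z) := by
  have hd : deriv (fun x : ℝ => x ^ 2) = fun x => 2 * x := by
    funext x
    simp
  have h := hess_comp hw (χ := fun x => x ^ 2) (contDiff_id.pow 2) z
  rw [h, hd]
  have : deriv (fun x : ℝ => 2 * x) (w z) = 2 := by
    rw [deriv_const_mul _ differentiableAt_id]
    simp
  rw [this]
  norm_num

/-- Pointwise, `(1/2) ddᶜ(w²) - w ddᶜw = dw ∧ dᶜw`, which is `(1/4) elem (∇w)` and hence elementary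
positive up to a factor. -/
lemma smoothCurrent_grad {W : Multiset (Cn n → ℝ)} (hW : ∀ w ∈ W, ContDiff ℝ ∞ w) (q : ℕ)
    {d : ℕ} {D : Set (Cn n)} {ψ : Form n d} (hψ : IsContTestForm D ψ) {w : Cn n → ℝ}
    (hw : ContDiff ℝ ∞ w) :
    (1 / 2) * smoothCurrent q ((fun y => w y ^ 2) ::ₘ W) ψ -
      smoothCurrent q (w ::ₘ W) (fun z => w z • ψ z) =
    ∫ z, 1 / 4 * tau n (evVal n (beta n ^ q * (elem (gradVec w z) * hprod W z)) *
      hat (ψ z).toAlternatingMap) := by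
  have hw2 : ContDiff ℝ ∞ fun y => w y ^ 2 := hw.pow 2
  have hc1 : HasCompactSupport fun z => w z • ψ z :=
    hψ.2.1.of_isClosed_subset (isClosed_tsupport _) (tsupport_smul_subset_right w ψ)
  rw [smoothCurrent, smoothCurrent, ← integral_const_mul, ← integral_sub
    ((integrable_smoothCurrent (contDiff_mem_cons hw2 hW) q hψ.1 hψ.2.1).const_mul _)
    (integrable_smoothCurrent (ψ := fun z => w z • ψ z) (contDiff_mem_cons hw hW) q
      (hw.continuous.smul hψ.1) hc1)]
  refine integral_congr_ae (Eventually.of_forall fun z => ?_)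
  simp only [hprod_cons, hess_sq hw, hat_smul]
  generalize hat (ψ z).toAlternatingMap = x
  rw [mul_smul_comm, map_smul, add_mul, mul_add, map_add, add_mul, map_add, smul_mul_assoc,
    smul_mul_assoc, mul_smul_comm, mul_smul_comm, map_smul, map_smul, smul_mul_assoc,
    smul_mul_assoc, map_smul, map_smul]
  simp only [smul_eq_mul]
  ring

variable {m : ℕ} {D : Set (Cn n)}

lemma IsHessianCurrent.nonneg_of_elemPos (hmn : m ≤ n) (hD : IsOpen D) {k p : ℕ}
    (hkp : k + p ≤ m) {u : Fin k → Cn n → ℝ} (hu : ∀ i, ContinuousOn (u i) D)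
    {w : Fin k → ℕ → Cn n → ℝ} (hw : ∀ i, IsSmoothApprox m D (u i) (w i))
    {T : Form n (2 * p) → ℝ} (hT : IsHessianCurrent D k u p T) {α : Fin p → Cn n →ₗ[ℂ] ℂ}
    {φ : Cn n → ℝ} {ψ : Form n (2 * p)} (hψ : IsContTestForm D ψ) (hφ : ∀ z, 0 ≤ φ z)
    (hψφ : ∀ z, (ψ z).toAlternatingMap = φ z • wedgeProd p fun j => elemPos (α j)) :
    0 ≤ T ψ := by
  have h := ((hessianCurrent_exists_and_tendsto hmn hD k p hkp u hu w hw).2 T hT).2 ψ hψ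
  obtain ⟨M, hM⟩ := exists_common_bound hψ.2.1 fun i => (hu i).mono hψ.2.2
  refine ge_of_tendsto h ?_
  filter_upwards [eventually_terms hw hψ.2.1 hψ.2.2 hM] with j hj
  refine integral_nonneg fun z => ?_
  by_cases hz : z ∈ tsupport ψ
  · have := tau_mul_hat_nonneg hmn ((terms w j).map fun v => hess v z)
      (by rwa [Multiset.card_map, card_terms]) (fun a ha => by
        obtain ⟨v, hv, rfl⟩ := Multiset.mem_map.1 ha
        exact ((hj v hv).2 z hz).1) (hφ z) (hψφ z)
    rwa [Multiset.card_map, card_terms] at this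
  · have h2 : hat (0 : Covec n (2 * p)).toAlternatingMap = 0 := map_zero hat
    rw [Pi.zero_apply, image_eq_zero_of_notMem_tsupport hz, h2, mul_zero, map_zero]

/-- In the gradient current `u 0` is added last, whereas the recursion would add it first; the tuple
is rotated accordingly. The smooth currents see only the multiset of potentials, so their limits do
not change. -/
lemma isHessianCurrent_snoc {k p : ℕ} {u : Fin (k + 1) → Cn n → ℝ}
    {S : Form n (2 * (p + 1)) → ℝ} {T : Form n (2 * p) → ℝ}
    (hS : IsHessianCurrent D k (Fin.tail u) (p + 1) S) (hT : IsDdcWedge D (u 0) S T) :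
    IsHessianCurrent D (k + 1) (Fin.snoc (Fin.tail u) (u 0) : Fin (k + 1) → Cn n → ℝ) p T := by
  refine ⟨S, ?_, ?_⟩
  · rwa [Fin.init_snoc]
  · rwa [Fin.snoc_last]

lemma terms_snoc {k : ℕ} (w : Fin (k + 1) → ℕ → Cn n → ℝ) (j : ℕ) :
    terms (Fin.snoc (Fin.tail w) (w 0) : Fin (k + 1) → ℕ → Cn n → ℝ) j = terms w j := by
  rw [terms_succ, terms_succ', Fin.init_snoc, Fin.snoc_last]

lemma forall_snoc {k : ℕ} {X : Type*} {P : X → Prop} {u : Fin (k + 1) → X} (h : ∀ i, P (u i)) :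
    ∀ i, P ((Fin.snoc (Fin.tail u) (u 0) : Fin (k + 1) → X) i) := by
  intro i
  induction i using Fin.lastCases with
  | last => rw [Fin.snoc_last]; exact h 0
  | cast i => rw [Fin.snoc_castSucc]; exact h i.succ

lemma isSmoothApprox_snoc {k : ℕ} {u : Fin (k + 1) → Cn n → ℝ}
    {w : Fin (k + 1) → ℕ → Cn n → ℝ} (hw : ∀ i, IsSmoothApprox m D (u i) (w i)) :
    ∀ i, IsSmoothApprox m D ((Fin.snoc (Fin.tail u) (u 0) : Fin (k + 1) → Cn n → ℝ) i)
      ((Fin.snoc (Fin.tail w) (w 0) : Fin (k + 1) → ℕ → Cn n → ℝ) i) := by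
  intro i
  induction i using Fin.lastCases with
  | last => rw [Fin.snoc_last, Fin.snoc_last]; exact hw 0
  | cast i => rw [Fin.snoc_castSucc, Fin.snoc_castSucc]; exact hw i.succ

theorem exists_ddcWedge (hmn : m ≤ n) (hD : IsOpen D) {k p : ℕ}
    (hkp : k + 1 + p ≤ m) {u : Fin (k + 1) → Cn n → ℝ} (hu : ∀ i, ContinuousOn (u i) D)
    {w : Fin (k + 1) → ℕ → Cn n → ℝ} (hw : ∀ i, IsSmoothApprox m D (u i) (w i)) :
    ∃ S T, IsHessianCurrent D k (Fin.tail u) (p + 1) S ∧ IsDdcWedge D (u 0) S T := by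
  obtain ⟨⟨T, S, hS, hT⟩, -⟩ := hessianCurrent_exists_and_tendsto hmn hD (k + 1) p hkp
    (Fin.snoc (Fin.tail u) (u 0) : Fin (k + 1) → Cn n → ℝ)
    (forall_snoc (P := fun v => ContinuousOn v D) hu) _ (isSmoothApprox_snoc hw)
  rw [Fin.init_snoc] at hS
  rw [Fin.snoc_last] at hT
  exact ⟨S, T, hS, hT⟩

lemma sq_approx {u : Cn n → ℝ} {w : ℕ → Cn n → ℝ} (hu : ContinuousOn u D)
    (h : IsSmoothApprox m D u w) (K : Set (Cn n)) (hK : IsCompact K) (hKD : K ⊆ D) (δ : ℝ)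
    (hδ : 0 < δ) : ∀ᶠ j in atTop, ∀ z ∈ K, |w j z ^ 2 - u z ^ 2| ≤ δ := by
  obtain ⟨M, hM⟩ := hK.exists_bound_of_continuousOn (hu.mono hKD)
  have h1 := (h.2 K hK hKD).2 (min 1 (δ / (2 * |M| + 1))) (by positivity)
  filter_upwards [h1] with j hj z hz
  have e1 := hj z hz
  have e2 : |u z| ≤ |M| := (hM z hz).trans (le_abs_self M)
  have e3 : |w j z + u z| ≤ 2 * |M| + 1 := by
    have : w j z + u z = (w j z - u z) + 2 * u z := by ring
    rw [this]
    refine (abs_add_le _ _).trans ?_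
    rw [abs_mul, abs_two]
    linarith [e1.trans (min_le_left _ _)]
  rw [sq_sub_sq, abs_mul]
  calc |w j z + u z| * |w j z - u z| ≤ (2 * |M| + 1) * (δ / (2 * |M| + 1)) :=
        mul_le_mul e3 (e1.trans (min_le_right _ _)) (abs_nonneg _) (by positivity)
    _ = δ := mul_div_cancel₀ _ (by positivity)

/-- Both terms of the definition are limits with varying coefficients, `w_j² → u²` and `w_j → u`;
for each `j` their difference is the smooth gradient integral. -/
theorem tendsto_gradient (hmn : m ≤ n) (hD : IsOpen D) {k p : ℕ}
    (hkp : k + 1 + p ≤ m) {u : Fin (k + 1) → Cn n → ℝ} (hu : ∀ i, ContinuousOn (u i) D)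
    {w : Fin (k + 1) → ℕ → Cn n → ℝ} (hw : ∀ i, IsSmoothApprox m D (u i) (w i))
    {S : Form n (2 * (p + 1)) → ℝ} {T : Form n (2 * p) → ℝ}
    (hS : IsHessianCurrent D k (Fin.tail u) (p + 1) S) (hT : IsDdcWedge D (u 0) S T)
    {ψ : Form n (2 * p)} (hψ : IsTestForm D ψ) :
    Tendsto (fun j => ∫ z, 1 / 4 * tau n (evVal n (beta n ^ (n - (k + 1 + p)) *
        (elem (gradVec (w 0 j) z) * hprod (terms (Fin.tail w) j) z)) *
        hat (ψ z).toAlternatingMap)) atTop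
      (𝓝 ((1 / 2) * S (fun z => (u 0 z) ^ 2 • ddc ψ z) - T (fun z => u 0 z • ψ z))) := by
  have hT' := ((hessianCurrent_exists_and_tendsto hmn hD (k + 1) p hkp _
    (forall_snoc (P := fun v => ContinuousOn v D) hu) _ (isSmoothApprox_snoc hw)).2 T
    (isHessianCurrent_snoc hS hT)).2
  have hS' := ((hessianCurrent_exists_and_tendsto hmn hD k (p + 1) (by omega) (Fin.tail u)
    (fun i => hu i.succ) (Fin.tail w) (fun i => hw i.succ)).2 S hS).2
  simp only [terms_snoc] at hT'
  have h1 := tendsto_smoothCurrent_smul hmn hkp hD hu hw hT'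
    (fun j => ((hw 0).1 j).continuous) (hu 0)
    (fun K hK hKD => ((hw 0).2 K hK hKD).2) hψ.isContTestForm
  have h2 := tendsto_smoothCurrent_smul (p := p + 1) hmn (by omega) hD (u := Fin.tail u)
    (fun i => hu i.succ) (w := Fin.tail w) (fun i => hw i.succ) hS'
    (v := fun j z => w 0 j z ^ 2) (v₀ := fun z => u 0 z ^ 2)
    (fun j => ((hw 0).1 j).continuous.pow 2) ((hu 0).pow 2) (sq_approx (hu 0) (hw 0))
    hψ.ddc.isContTestForm
  refine ((h2.const_mul (1 / 2)).sub h1).congr fun j => ?_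
  have hW := contDiff_terms (w := Fin.tail w) (u := Fin.tail u) (fun i => hw i.succ) j
  rw [← smoothCurrent_grad hW _ hψ.isContTestForm ((hw 0).1 j), terms_succ',
    smoothCurrent_cons (ψ := ψ) hW _ hψ.1 hψ.2.1 (((hw 0).1 j).pow 2),
    show n - (k + 1 + p) = n - (k + (p + 1)) by omega]

theorem isPositiveCurrent_gradient (hmn : m ≤ n) (hD : IsOpen D) {k p : ℕ}
    (hkp : k + 1 + p ≤ m) {u : Fin (k + 1) → Cn n → ℝ} (hu : ∀ i, ContinuousOn (u i) D)
    {w : Fin (k + 1) → ℕ → Cn n → ℝ} (hw : ∀ i, IsSmoothApprox m D (u i) (w i))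
    {S : Form n (2 * (p + 1)) → ℝ} {T : Form n (2 * p) → ℝ}
    (hS : IsHessianCurrent D k (Fin.tail u) (p + 1) S) (hT : IsDdcWedge D (u 0) S T) :
    IsPositiveCurrent D fun ψ =>
      (1 / 2) * S (fun z => (u 0 z) ^ 2 • ddc ψ z) - T (fun z => u 0 z • ψ z) := by
  intro α φ ψ hψ hφ hψφ
  have h := tendsto_gradient hmn hD hkp hu hw hS hT hψ
  obtain ⟨M, hM⟩ := exists_common_bound hψ.2.1 fun i => (hu i).mono hψ.2.2
  refine ge_of_tendsto h ?_
  filter_upwards [eventually_terms hw hψ.2.1 hψ.2.2 hM] with j hj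
  refine integral_nonneg fun z => ?_
  by_cases hz : z ∈ tsupport ψ
  · refine mul_nonneg (by norm_num) ?_
    have := tau_mul_hat_nonneg hmn
      (elem (gradVec (w 0 j) z) ::ₘ (terms (Fin.tail w) j).map fun v => hess v z)
      (by rw [Multiset.card_cons, Multiset.card_map, card_terms]; exact hkp) (fun a ha => by
        rcases Multiset.mem_cons.1 ha with rfl | ha
        · exact elem_mem_gam hmn _
        · obtain ⟨v, hv, rfl⟩ := Multiset.mem_map.1 ha
          exact ((hj v (by rw [terms_succ']; exact Multiset.mem_cons_of_mem hv)).2 z hz).1)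
      (hφ z) (hψφ z)
    rwa [Multiset.card_cons, Multiset.card_map, card_terms, Multiset.prod_cons] at this
  · have h2 : hat (0 : Covec n (2 * p)).toAlternatingMap = 0 := map_zero hat
    rw [Pi.zero_apply, image_eq_zero_of_notMem_tsupport hz, h2, mul_zero, map_zero, mul_zero]

/-- The constant is the one for smooth potentials bounded by `M + 1`, fixed before `u`. How late the
approximants satisfy that bound depends on `u`, but this is harmless in the limit. -/
theorem exists_hessianCurrent_bound (hm : 1 ≤ m) (hmn : m ≤ n) (hD : IsOpen D) (M : ℝ) {k p : ℕ}
    (hkp : k + p ≤ m) {K : Set (Cn n)} (hK : IsCompact K) (hKD : K ⊆ D) :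
    ∃ C : ℝ, 0 ≤ C ∧ ∀ u : Fin k → Cn n → ℝ, (∀ i, IsBoundedContMSubharmonic m D M (u i)) →
      ∀ T : Form n (2 * p) → ℝ, IsHessianCurrent D k u p T → ∀ ψ, IsContTestForm D ψ →
        tsupport ψ ⊆ K → ∀ b : ℝ, (∀ z, ‖ψ z‖ ≤ b) → |T ψ| ≤ C * b := by
  obtain ⟨K', hK'c, hK'D, hC⟩ := exists_smoothCurrent_bound hmn hD k p hkp hK hKD
  obtain ⟨C, hC0, hC⟩ := hC (M + 1)
  refine ⟨C, hC0, fun u hu T hT ψ hψ hψK b hb => ?_⟩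
  choose w hw using fun i => exists_isSmoothApprox hm hmn hD (hu i).1
  have h := ((hessianCurrent_exists_and_tendsto hmn hD k p hkp u (fun i => (hu i).1.2) w hw).2
    T hT).2 ψ hψ
  refine le_of_tendsto h.abs ?_
  filter_upwards [eventually_terms hw hK'c hK'D fun i z hz => (hu i).2 z (hK'D hz)] with j hj
  exact hC _ (card_terms w j) hj ψ hψ.1 hψK b hb

lemma norm_smul_le_of_tsupport {d : ℕ} {ψ : Form n d} (hψ : tsupport ψ ⊆ D) {u : Cn n → ℝ}
    {M B : ℝ} (hu : ∀ z ∈ D, |u z| ≤ M) (hB : ∀ z, ‖ψ z‖ ≤ B) (z : Cn n) :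
    ‖u z • ψ z‖ ≤ |M| * B := by
  have hB0 : 0 ≤ B := (norm_nonneg _).trans (hB z)
  by_cases hz : z ∈ tsupport ψ
  · rw [norm_smul, Real.norm_eq_abs]
    exact mul_le_mul ((hu z (hψ hz)).trans (le_abs_self M)) (hB z) (norm_nonneg _) (abs_nonneg _)
  · rw [image_eq_zero_of_notMem_tsupport hz, smul_zero, norm_zero]
    positivity

theorem currents_on_open_set (hmn : m ≤ n) {k : ℕ} (hkm : k + 1 ≤ m) (hD : IsOpen D) (M : ℝ) :
    (∀ u : Fin (k + 1) → Cn n → ℝ, (∀ i, IsBoundedContMSubharmonic m D M (u i)) →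
        (∃ T, IsHessianCurrent D (k + 1) u (m - (k + 1)) T ∧ IsPositiveCurrent D T) ∧
        (∃ G, IsGradientHessianCurrent D k u (m - (k + 1)) G ∧ IsPositiveCurrent D G)) ∧
      (∀ ψ : Form n (2 * (m - (k + 1))), IsTestForm D ψ → ∃ C : ℝ,
        ∀ u : Fin (k + 1) → Cn n → ℝ, (∀ i, IsBoundedContMSubharmonic m D M (u i)) →
          (∀ T, IsHessianCurrent D (k + 1) u (m - (k + 1)) T → |T ψ| ≤ C) ∧
          (∀ G, IsGradientHessianCurrent D k u (m - (k + 1)) G → |G ψ| ≤ C)) := by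
  have hm : 1 ≤ m := by omega
  have hkp : k + 1 + (m - (k + 1)) ≤ m := by omega
  have hkp' : k + (m - (k + 1) + 1) ≤ m := by omega
  refine ⟨fun u hu => ?_, fun ψ hψ => ?_⟩
  · have huc : ∀ i, ContinuousOn (u i) D := fun i => (hu i).1.2
    choose w hw using fun i => exists_isSmoothApprox hm hmn hD (hu i).1
    obtain ⟨T, hT⟩ := (hessianCurrent_exists_and_tendsto hmn hD (k + 1) _ hkp u huc w hw).1
    obtain ⟨S, T', hS, hT'⟩ := exists_ddcWedge hmn hD hkp huc hw
    exact ⟨⟨T, hT, fun α φ ψ hψ hφ h => hT.nonneg_of_elemPos hmn hD hkp huc hw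
        hψ.isContTestForm hφ h⟩,
      ⟨_, ⟨S, T', hS, hT', fun ψ _ => rfl⟩, isPositiveCurrent_gradient hmn hD hkp huc hw hS hT'⟩⟩
  · obtain ⟨C₁, hC₁, h₁⟩ := exists_hessianCurrent_bound hm hmn hD M hkp hψ.2.1 hψ.2.2
    obtain ⟨C₂, hC₂, h₂⟩ := exists_hessianCurrent_bound hm hmn hD M hkp' hψ.2.1 hψ.2.2
    obtain ⟨B₁, hB₁⟩ := hψ.2.1.exists_bound_of_continuous hψ.1.continuous
    obtain ⟨B₂, hB₂⟩ := hψ.ddc.2.1.exists_bound_of_continuous hψ.ddc.1.continuous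
    have hB₁0 : 0 ≤ B₁ := (norm_nonneg _).trans (hB₁ 0)
    have hB₂0 : 0 ≤ B₂ := (norm_nonneg _).trans (hB₂ 0)
    -- The summands bound in turn `T ψ`, then `(1/2) S (u² ddᶜ ψ)` and `T (u ψ)` for the gradient
    -- current; their sum serves both families.
    refine ⟨C₁ * B₁ + (1 / 2 * (C₂ * (|M ^ 2| * B₂)) + C₁ * (|M| * B₁)), fun u hu =>
      ⟨fun T hT => ?_, ?_⟩⟩
    · refine (h₁ u hu T hT ψ hψ.isContTestForm subset_rfl B₁ hB₁).trans ?_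
      exact le_add_of_nonneg_right (by positivity)
    · rintro G ⟨S, T, hS, hT, hG⟩
      rw [hG ψ hψ]
      have e1 := h₁ _ (forall_snoc (P := IsBoundedContMSubharmonic m D M) hu) T
        (isHessianCurrent_snoc hS hT) _ (hψ.isContTestForm.continuousOn_smul hD (hu 0).1.2)
        (tsupport_smul_subset_right _ _) _
        (norm_smul_le_of_tsupport hψ.2.2 (hu 0).2 hB₁)
      have e2 := h₂ (Fin.tail u) (fun i => hu i.succ) S hS _
        (hψ.ddc.isContTestForm.continuousOn_smul hD ((hu 0).1.2.pow 2))
        ((tsupport_smul_subset_right _ _).trans (tsupport_ddc_subset ψ)) _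
        (norm_smul_le_of_tsupport hψ.ddc.2.2 (M := M ^ 2) (fun z hz => by
          rw [Pi.pow_apply, abs_pow]
          exact pow_le_pow_left₀ (abs_nonneg _) ((hu 0).2 z hz) 2) hB₂)
      have e3 : 0 ≤ C₁ * B₁ := by positivity
      simp only [Pi.pow_apply] at e2
      rw [abs_le] at *
      constructor <;> linarith

end Positivity

/-! ### Hessian measures -/

section HessianMeasure

open Filter Topology
open scoped CompactlySupported

variable {n : ℕ}

/-- Extension by zero. -/
def extendZero {D : Set (Cn n)} (f : D → ℝ) : Cn n → ℝ := Function.extend Subtype.val f 0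

lemma extendZero_coe {D : Set (Cn n)} (f : D → ℝ) (z : D) : extendZero f z = f z :=
  Subtype.val_injective.extend_apply f 0 z

lemma extendZero_of_notMem {D : Set (Cn n)} (f : D → ℝ) {z : Cn n} (hz : z ∉ D) :
    extendZero f z = 0 :=
  Function.extend_apply' _ _ _ fun ⟨y, hy⟩ => hz (hy ▸ y.2)

lemma tsupport_extendZero {D : Set (Cn n)} {f : D → ℝ} (hf : HasCompactSupport f) :
    tsupport (extendZero f) ⊆ Subtype.val '' tsupport f := by
  refine closure_minimal (fun z hz => ?_) (hf.isCompact.image continuous_subtype_val).isClosed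
  by_cases hzD : z ∈ D
  · refine ⟨⟨z, hzD⟩, subset_tsupport f ?_, rfl⟩
    rw [Function.mem_support] at hz ⊢
    have h : f ⟨z, hzD⟩ = extendZero f z := (extendZero_coe f ⟨z, hzD⟩).symm
    rwa [h]
  · exact absurd (extendZero_of_notMem f hzD) hz

lemma continuous_extendZero {D : Set (Cn n)} (hD : IsOpen D) {f : D → ℝ} (hf : Continuous f)
    (hc : HasCompactSupport f) : Continuous (extendZero f) := by
  refine continuous_iff_continuousAt.2 fun z => ?_
  by_cases hz : z ∈ D
  · have h := hD.isOpenEmbedding_subtypeVal.continuousAt_iff (g := extendZero f) (x := ⟨z, hz⟩)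
    refine h.1 ?_
    have : extendZero f ∘ Subtype.val = f := funext fun y => extendZero_coe f y
    rw [this]
    exact hf.continuousAt
  · have h0 : extendZero f =ᶠ[𝓝 z] 0 := notMem_tsupport_iff_eventuallyEq.1 fun h => by
      obtain ⟨y, -, rfl⟩ := tsupport_extendZero hc h
      exact hz y.2
    exact (continuousAt_const (y := (0 : ℝ))).congr h0.symm

lemma isContTestForm_zeroForm {D : Set (Cn n)} {φ : Cn n → ℝ} (h1 : Continuous φ)
    (h2 : HasCompactSupport φ) (h3 : tsupport φ ⊆ D) : IsContTestForm D (zeroForm φ) := by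
  refine ⟨?_, ?_, ?_⟩
  · exact contDiff_zero.1 (contDiff_zeroForm (contDiff_zero.2 h1))
  · rw [HasCompactSupport, tsupport_zeroForm]
    exact h2
  · rwa [tsupport_zeroForm]

lemma zeroForm_add (f g : Cn n → ℝ) : zeroForm (f + g) = zeroForm f + zeroForm g := rfl

lemma zeroForm_smul (c : ℝ) (f : Cn n → ℝ) : zeroForm (c • f) = c • zeroForm f := rfl

/-- The Riesz–Markov theorem on the locally compact space `D`, followed by push-forward under the
inclusion. Measures on `ℂⁿ` obtained in this way are finite on compact subsets of `D` only. -/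
theorem exists_measure_of_nonneg {D : Set (Cn n)} (hD : IsOpen D) {T : Form n 0 → ℝ}
    (hT : IsOrderZeroCurrent D T)
    (hpos : ∀ φ : Cn n → ℝ, IsContTestForm D (zeroForm φ) → (∀ z, 0 ≤ φ z) → 0 ≤ T (zeroForm φ)) :
    ∃ μ : Measure (Cn n), (∀ K : Set (Cn n), IsCompact K → K ⊆ D → μ K < ⊤) ∧
      ∀ φ : Cn n → ℝ, Continuous φ → HasCompactSupport φ → tsupport φ ⊆ D →
        T (zeroForm φ) = ∫ z, φ z ∂μ := by
  have : LocallyCompactSpace D := hD.locallyCompactSpace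
  have htest : ∀ f : C_c(D, ℝ), IsContTestForm D (zeroForm (extendZero f)) := fun f =>
    isContTestForm_zeroForm (continuous_extendZero hD f.continuous f.hasCompactSupport)
      ((f.hasCompactSupport.isCompact.image continuous_subtype_val).of_isClosed_subset
        (isClosed_tsupport _) (tsupport_extendZero f.hasCompactSupport))
      ((tsupport_extendZero f.hasCompactSupport).trans (Subtype.coe_image_subset D _))
  let Λ : C_c(D, ℝ) →ₚ[ℝ] ℝ := PositiveLinearMap.mk₀
    { toFun := fun f => T (zeroForm (extendZero f))
      map_add' := fun f g => by
        rw [← hT.map_add _ _ (htest f) (htest g), ← zeroForm_add]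
        congr 2
        funext z
        by_cases hz : z ∈ D
        · have h := fun F : D → ℝ => extendZero_coe F ⟨z, hz⟩
          simp only at h
          simp [h]
        · simp [extendZero_of_notMem _ hz]
      map_smul' := fun c f => by
        rw [RingHom.id_apply, smul_eq_mul, ← hT.map_smul _ _ (htest f), ← zeroForm_smul]
        congr 2
        funext z
        by_cases hz : z ∈ D
        · have h := fun F : D → ℝ => extendZero_coe F ⟨z, hz⟩
          simp only at h
          simp [h]
        · simp [extendZero_of_notMem _ hz] }
    fun f hf => hpos _ (htest f) fun z => by
      by_cases hz : z ∈ D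
      · rw [show z = ((⟨z, hz⟩ : D) : Cn n) from rfl, extendZero_coe]
        exact hf ⟨z, hz⟩
      · rw [extendZero_of_notMem _ hz]
  have hemb : MeasurableEmbedding (Subtype.val : D → Cn n) :=
    MeasurableEmbedding.subtype_coe hD.measurableSet
  refine ⟨(RealRMK.rieszMeasure Λ).map Subtype.val, fun K hK hKD => ?_, fun φ h1 h2 h3 => ?_⟩
  · rw [hemb.map_apply]
    have hK' : IsCompact (Subtype.val ⁻¹' K : Set D) :=
      Subtype.isCompact_iff.2 (by rwa [Subtype.image_preimage_coe, inter_eq_right.2 hKD])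
    exact hK'.measure_lt_top
  · rw [hemb.integral_map]
    have hcs : HasCompactSupport fun z : D => φ z := by
      refine HasCompactSupport.intro (K := Subtype.val ⁻¹' tsupport φ) ?_ fun z hz =>
        image_eq_zero_of_notMem_tsupport hz
      exact Subtype.isCompact_iff.2 (by rwa [Subtype.image_preimage_coe, inter_eq_right.2 h3])
    let f : C_c(D, ℝ) := ⟨⟨fun z => φ z, h1.comp continuous_subtype_val⟩, hcs⟩
    have h := RealRMK.integral_rieszMeasure Λ f
    have hext : extendZero f = φ := by
      funext z
      by_cases hz : z ∈ D
      · exact extendZero_coe f ⟨z, hz⟩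
      · rw [extendZero_of_notMem _ hz, image_eq_zero_of_notMem_tsupport fun h => hz (h3 h)]
    have hΛ : Λ f = T (zeroForm (extendZero f)) := rfl
    rw [hΛ, hext] at h
    exact h.symm

lemma zeroForm_eq_smul_wedgeProd (φ : Cn n → ℝ) (α : Fin 0 → Cn n →ₗ[ℂ] ℂ) (z : Cn n) :
    (zeroForm φ z).toAlternatingMap = φ z • wedgeProd 0 fun j => elemPos (α j) := by
  ext v
  simp [zeroForm, wedgeProd]

theorem exists_isHessianMeasure {m : ℕ} (hm : 1 ≤ m) (hmn : m ≤ n) {D : Set (Cn n)}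
    (hD : IsOpen D) {k : ℕ} (hk : k ≤ m) {u : Fin k → Cn n → ℝ}
    (hu : ∀ i, IsContMSubharmonic m D (u i)) : ∃ μ : Measure (Cn n), IsHessianMeasure D k u μ := by
  choose w hw using fun i => exists_isSmoothApprox hm hmn hD (hu i)
  have huc : ∀ i, ContinuousOn (u i) D := fun i => (hu i).2
  have hk0 : k + 0 ≤ m := hk
  obtain ⟨⟨T, hT⟩, h⟩ := hessianCurrent_exists_and_tendsto hmn hD k 0 hk0 u huc w hw
  obtain ⟨μ, h1, h2⟩ := exists_measure_of_nonneg hD (T := T) (h T hT).1 fun φ hφ hpos =>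
    hT.nonneg_of_elemPos hmn hD hk0 huc hw (α := fun _ => 0) hφ hpos
      (zeroForm_eq_smul_wedgeProd φ _)
  exact ⟨μ, h1, T, hT, h2⟩

lemma IsHessianMeasure.tendsto_integral {m : ℕ} (hmn : m ≤ n) {D : Set (Cn n)}
    (hD : IsOpen D) {k : ℕ} (hk : k ≤ m) {u : Fin k → Cn n → ℝ}
    (hu : ∀ i, ContinuousOn (u i) D) {w : Fin k → ℕ → Cn n → ℝ}
    (hw : ∀ i, IsSmoothApprox m D (u i) (w i)) {μ : Measure (Cn n)}
    (hμ : IsHessianMeasure D k u μ) {φ : Cn n → ℝ} (h1 : Continuous φ)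
    (h2 : HasCompactSupport φ) (h3 : tsupport φ ⊆ D) :
    Tendsto (fun j => ∫ z, φ z * tauE n (beta n ^ (n - k) * hprod (terms w j) z)) atTop
      (𝓝 (∫ z, φ z ∂μ)) := by
  obtain ⟨-, T, hT, hTμ⟩ := hμ
  rw [← hTμ φ h1 h2 h3]
  refine (((hessianCurrent_exists_and_tendsto hmn hD k 0 hk u hu w hw).2 T hT).2 _
    (isContTestForm_zeroForm h1 h2 h3)).congr fun j => ?_
  exact smoothCurrent_zeroForm _ _ _

/-! ### The integral inequality -/

lemma pd_sub_const {f : Cn n → ℝ} (c : ℝ) (v : Cn n) : pd v (fun y => f y - c) = pd v f := by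
  funext z
  unfold pd
  rw [fderiv_sub_const]

lemma hess_sub_const (f : Cn n → ℝ) (c : ℝ) (z : Cn n) :
    hess (fun y => f y - c) z = hess f z := by
  simp only [hess, pd_sub_const]

lemma hess_const_sub_norm_sq (r : ℝ) (z : Cn n) :
    hess (fun y : Cn n => r - ‖y‖ ^ 2) z = -beta n := by
  have h1 : ∀ v, pd v (fun y : Cn n => r - ‖y‖ ^ 2) = fun y => -pd v (fun y => ‖y‖ ^ 2) y := by
    intro v
    funext y
    unfold pd
    rw [fderiv_const_sub]
    rfl
  rw [← hess_norm_sq z, hess, hess]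
  simp only [h1, pd_neg', neg_smul, Finset.sum_neg_distrib, smul_neg]

/-- The data of a smooth convex function vanishing on the negative half line. -/
structure IsConvexCutoff (χ : ℝ → ℝ) : Prop where
  smooth : ContDiff ℝ ∞ χ
  zero : ∀ s ≤ 0, χ s = 0
  deriv_nonneg : ∀ s, 0 ≤ deriv χ s
  deriv_deriv_nonneg : ∀ s, 0 ≤ deriv (deriv χ) s

lemma IsConvexCutoff.deriv_zero {χ : ℝ → ℝ} (h : IsConvexCutoff χ) {s : ℝ} (hs : s < 0) :
    deriv χ s = 0 := by
  have : χ =ᶠ[𝓝 s] fun _ => 0 := by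
    filter_upwards [Iio_mem_nhds hs] with t ht
    exact h.zero t (le_of_lt ht)
  rw [this.deriv_eq, deriv_const]

lemma contDiff_const_sub_norm_sq (r : ℝ) : ContDiff ℝ ∞ fun z : Cn n => r - ‖z‖ ^ 2 :=
  contDiff_const.sub (contDiff_norm_sq ℝ)

lemma isCompact_sublevel (r : ℝ) : IsCompact {z : Cn n | ‖z‖ ^ 2 ≤ r} := by
  refine (isCompact_closedBall (0 : Cn n) (max r 1)).of_isClosed_subset
    (isClosed_le (by fun_prop) continuous_const) fun z hz => ?_
  rw [mem_closedBall_zero_iff]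
  by_contra! h
  have h1 : 1 < ‖z‖ := (le_max_right _ _).trans_lt h
  have h2 : r < ‖z‖ := (le_max_left _ _).trans_lt h
  have h3 : ‖z‖ ^ 2 ≤ r := hz
  nlinarith

lemma tsupport_subset_sublevel {χ : ℝ → ℝ} (h : ∀ s < 0, χ s = 0) (r : ℝ) :
    tsupport (fun z : Cn n => χ (r - ‖z‖ ^ 2)) ⊆ {z | ‖z‖ ^ 2 ≤ r} := by
  refine closure_minimal (fun z hz => ?_) (isCompact_sublevel r).isClosed
  by_contra h'
  exact hz (h _ (by simpa using h'))

/-- With `f = χ(r - |z|²)`, Green's identity moves `ddᶜ` from `w - c` to `f`, and `ddᶜf` is `-χ' β`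
plus `χ''/4` times an elementary form. As `w - c ≤ 0`, the convexity term only lowers the integral,
and `c - w ≤ A` bounds the other one. -/
theorem integral_cutoff_le {m : ℕ} (hmn : m ≤ n) {W : Multiset (Cn n → ℝ)}
    (hW : ∀ v ∈ W, ContDiff ℝ ∞ v) (hcard : W.card + 1 ≤ m) {w : Cn n → ℝ}
    (hw : ContDiff ℝ ∞ w) (r : ℝ)
    (hgam : ∀ v ∈ W, ∀ z : Cn n, ‖z‖ ^ 2 ≤ r → hess v z ∈ gam n m) {χ : ℝ → ℝ}
    (hχ : IsConvexCutoff χ) {c A : ℝ} (hcA : ∀ z : Cn n, ‖z‖ ^ 2 ≤ r → w z ≤ c ∧ c - w z ≤ A) :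
    ∫ z, χ (r - ‖z‖ ^ 2) * tauE n (beta n ^ (n - (W.card + 1)) * hprod (w ::ₘ W) z) ≤
      A * ∫ z, deriv χ (r - ‖z‖ ^ 2) * tauE n (beta n ^ (n - W.card) * hprod W z) := by
  set f : Cn n → ℝ := fun z => χ (r - ‖z‖ ^ 2) with hf
  set x : Lam n := evVal n (beta n ^ (n - (W.card + 1))) with hx
  have hρ := contDiff_const_sub_norm_sq (n := n) r
  have hfs : ContDiff ℝ ∞ f := hχ.smooth.comp hρ
  have hsub : tsupport f ⊆ {z | ‖z‖ ^ 2 ≤ r} :=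
    tsupport_subset_sublevel (fun s hs => hχ.zero s hs.le) r
  have hfc : HasCompactSupport f := (isCompact_sublevel r).of_isClosed_subset
    (isClosed_tsupport _) hsub
  have hsub' : tsupport (fun z : Cn n => deriv χ (r - ‖z‖ ^ 2)) ⊆ {z | ‖z‖ ^ 2 ≤ r} :=
    tsupport_subset_sublevel (fun s hs => hχ.deriv_zero hs) r
  have hfc' : HasCompactSupport fun z : Cn n => deriv χ (r - ‖z‖ ^ 2) :=
    (isCompact_sublevel r).of_isClosed_subset (isClosed_tsupport _) hsub'
  have hτ : ∀ Y, tauL x Y = tauE n (beta n ^ (n - (W.card + 1)) * Y) := fun Y => by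
    rw [tauL_apply, hx, ← map_mul, mul_comm, tauE_apply]
  have hpow : beta n ^ (n - W.card) = beta n ^ (n - (W.card + 1)) * beta n := by
    rw [← pow_succ]
    congr 1
    omega
  have hg : ContDiff ℝ ∞ fun z => w z - c := hw.sub contDiff_const
  have h1 := integral_hess_symm hW x hfs hfc hg
  simp only [hess_sub_const] at h1
  have h2 : ∫ z, f z * tauE n (beta n ^ (n - (W.card + 1)) * hprod (w ::ₘ W) z) =
      ∫ z, (w z - c) * tauL x (hess f z * hprod W z) := by
    rw [h1]
    simp only [hτ, hprod_cons]
  rw [h2, ← integral_const_mul]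
  refine integral_mono (integrable_mul_hess hW x hfs hfc hg) ?_ fun z => ?_
  · refine Integrable.const_mul ?_ _
    exact (((contDiff_deriv hχ.smooth).continuous.comp hρ.continuous).mul
      (continuous_tauE_hprod hW _)).integrable_of_hasCompactSupport hfc'.mul_right
  · simp only
    by_cases hz : ‖z‖ ^ 2 ≤ r
    · obtain ⟨hc, hA⟩ := hcA z hz
      have e1 : 0 ≤ tauE n (beta n ^ (n - W.card) * hprod W z) :=
        tauE_hprod_nonneg hmn (by omega) fun v hv => hgam v hv z hz
      have e2 : 0 ≤ tauE n (beta n ^ (n - (W.card + 1)) *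
          (elem (gradVec (fun y : Cn n => r - ‖y‖ ^ 2) z) * hprod W z)) := by
        have := tauE_mixed_nonneg hmn
          (elem (gradVec (fun y : Cn n => r - ‖y‖ ^ 2) z) ::ₘ W.map fun v => hess v z)
          (by rwa [Multiset.card_cons, Multiset.card_map]) (fun a ha => by
            rcases Multiset.mem_cons.1 ha with rfl | ha
            · exact elem_mem_gam hmn _
            · obtain ⟨v, hv, rfl⟩ := Multiset.mem_map.1 ha
              exact hgam v hv z hz)
        rwa [Multiset.card_cons, Multiset.card_map, Multiset.prod_cons] at this
      have e3 : tauL x (hess f z * hprod W z) =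
          -(deriv χ (r - ‖z‖ ^ 2) * tauE n (beta n ^ (n - W.card) * hprod W z)) +
          1 / 4 * deriv (deriv χ) (r - ‖z‖ ^ 2) * tauE n (beta n ^ (n - (W.card + 1)) *
            (elem (gradVec (fun y : Cn n => r - ‖y‖ ^ 2) z) * hprod W z)) := by
        rw [hτ, hess_comp hρ hχ.smooth, hess_const_sub_norm_sq, add_mul, mul_add, map_add, hpow,
          smul_mul_assoc, smul_mul_assoc, mul_smul_comm, mul_smul_comm, map_smul, map_smul,
          neg_mul, mul_neg, map_neg, mul_assoc (beta n ^ _)]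
        simp only [smul_eq_mul]
        ring
      have e4 := hχ.deriv_nonneg (r - ‖z‖ ^ 2)
      have e5 := hχ.deriv_deriv_nonneg (r - ‖z‖ ^ 2)
      have e6 := mul_nonneg e4 e1
      have e7 := mul_nonneg e5 e2
      rw [e3]
      generalize tauE n (beta n ^ (n - W.card) * hprod W z) = X at *
      generalize tauE n (beta n ^ (n - (W.card + 1)) *
        (elem (gradVec (fun y : Cn n => r - ‖y‖ ^ 2) z) * hprod W z)) = Y at *
      have e8 := mul_le_mul_of_nonneg_right hA e6
      have e9 := mul_nonneg (sub_nonneg.2 hc) e7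
      nlinarith
    · rw [hess_eq_zero_of_notMem fun h => hz (hsub h), zero_mul, map_zero, mul_zero,
        image_eq_zero_of_notMem_tsupport (f := fun z : Cn n => deriv χ (r - ‖z‖ ^ 2))
          fun h => hz (hsub' h), zero_mul, mul_zero]

/-- The primitive of a smooth step rising from `0` to `1` on `[0, ε]`: a smooth convex approximation
of the positive part. -/
lemma exists_convexCutoff {ε : ℝ} (hε : 0 < ε) :
    ∃ χ : ℝ → ℝ, IsConvexCutoff χ ∧ (∀ s, deriv χ s ≤ 1) ∧ (∀ s, 0 ≤ s → s - ε ≤ χ s) ∧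
      ∀ s, 0 ≤ χ s := by
  set g : ℝ → ℝ := fun x => Real.smoothTransition (x / ε) with hg
  have hgs : ContDiff ℝ ∞ g := (Real.smoothTransition.contDiff (n := ⊤)).comp
    (contDiff_id.div_const ε)
  have hgm : Monotone g := fun a b hab =>
    Real.smoothTransition.monotone (div_le_div_of_nonneg_right hab hε.le)
  set χ : ℝ → ℝ := fun s => ∫ x in (0 : ℝ)..s, g x with hχ
  have hd : ∀ s, HasDerivAt χ (g s) s := fun s =>
    intervalIntegral.integral_hasDerivAt_right (hgs.continuous.intervalIntegrable _ _)
      (hgs.continuous.stronglyMeasurableAtFilter _ _) hgs.continuous.continuousAt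
  have hderiv : deriv χ = g := funext fun s => (hd s).deriv
  have h0 : ∀ s, 0 ≤ g s := fun s => Real.smoothTransition.nonneg _
  have hzero : ∀ s ≤ 0, χ s = 0 := by
    intro s hs
    rw [hχ]
    simp only
    rw [intervalIntegral.integral_congr (g := fun _ => (0 : ℝ)), intervalIntegral.integral_zero]
    intro x hx
    rw [uIcc_of_ge hs] at hx
    exact Real.smoothTransition.zero_of_nonpos (div_nonpos_of_nonpos_of_nonneg hx.2 hε.le)
  have hmono : Monotone χ := monotone_of_deriv_nonneg (fun s => (hd s).differentiableAt)
    fun s => by rw [hderiv]; exact h0 s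
  have hnn : ∀ s, 0 ≤ χ s := fun s => by
    rcases le_total s 0 with hs | hs
    · rw [hzero s hs]
    · rw [← hzero 0 le_rfl]
      exact hmono hs
  refine ⟨χ, ⟨contDiff_infty_iff_deriv.2 ⟨fun s => (hd s).differentiableAt, by rwa [hderiv]⟩,
    hzero, fun s => by rw [hderiv]; exact h0 s, fun s => by rw [hderiv]; exact hgm.deriv_nonneg⟩,
    fun s => by rw [hderiv]; exact Real.smoothTransition.le_one _, fun s hs => ?_, hnn⟩
  rcases le_total s ε with h | h
  · linarith [hnn s]
  · have h1 : χ s = χ ε + ∫ x in ε..s, g x :=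
      (intervalIntegral.integral_add_adjacent_intervals (hgs.continuous.intervalIntegrable _ _)
        (hgs.continuous.intervalIntegrable _ _)).symm
    have h2 : ∫ x in ε..s, g x = s - ε := by
      rw [intervalIntegral.integral_congr (g := fun _ => (1 : ℝ)), intervalIntegral.integral_const,
        smul_eq_mul, mul_one]
      intro x hx
      rw [uIcc_of_le h] at hx
      exact Real.smoothTransition.one_of_one_le ((one_le_div hε).2 hx.1)
    rw [h1, h2]
    linarith [hnn ε]

end HessianMeasure

/-! ### Passage to the limit in the integral inequality -/

section Inequality

open Filter Topology

variable {n : ℕ}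

lemma sublevel_subset_ball {r : ℝ} (hr : r < 1) :
    {z : Cn n | ‖z‖ ^ 2 ≤ r} ⊆ ball (0 : Cn n) 1 := by
  intro z hz
  rw [mem_ball_zero_iff]
  have h : ‖z‖ ^ 2 ≤ r := hz
  nlinarith [norm_nonneg z]

theorem integral_cutoff_measure_le {m k : ℕ} (hmn : m ≤ n) (hkm : k + 1 ≤ m)
    {D : Set (Cn n)} (hD : IsOpen D) {u : Fin (k + 1) → Cn n → ℝ}
    (hu : ∀ i, IsContMSubharmonic m D (u i)) {μ ν : Measure (Cn n)}
    (hμ : IsHessianMeasure D (k + 1) u μ) (hν : IsHessianMeasure D k (Fin.tail u) ν) {r : ℝ}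
    (hrD : {z : Cn n | ‖z‖ ^ 2 ≤ r} ⊆ D) {χ : ℝ → ℝ} (hχ : IsConvexCutoff χ) {a b : ℝ}
    (hab : ∀ z : Cn n, ‖z‖ ^ 2 ≤ r → b ≤ u 0 z ∧ u 0 z ≤ a) :
    ∫ z, χ (r - ‖z‖ ^ 2) ∂μ ≤ (a - b) * ∫ z, deriv χ (r - ‖z‖ ^ 2) ∂ν := by
  choose w hw using fun i => exists_isSmoothApprox (by omega) hmn hD (hu i)
  have huc : ∀ i, ContinuousOn (u i) D := fun i => (hu i).2
  have hρ := contDiff_const_sub_norm_sq (n := n) r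
  have hK := isCompact_sublevel (n := n) r
  have hsub : tsupport (fun z : Cn n => χ (r - ‖z‖ ^ 2)) ⊆ {z | ‖z‖ ^ 2 ≤ r} :=
    tsupport_subset_sublevel (fun s hs => hχ.zero s hs.le) r
  have hsub' : tsupport (fun z : Cn n => deriv χ (r - ‖z‖ ^ 2)) ⊆ {z | ‖z‖ ^ 2 ≤ r} :=
    tsupport_subset_sublevel (fun s hs => hχ.deriv_zero hs) r
  have h1 := hμ.tendsto_integral hmn hD hkm huc hw (hχ.smooth.comp hρ).continuous
    (hK.of_isClosed_subset (isClosed_tsupport _) hsub) (hsub.trans hrD)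
  have h2 := hν.tendsto_integral hmn hD (by omega) (u := Fin.tail u) (fun i => huc i.succ)
    (w := Fin.tail w) (fun i => hw i.succ) ((contDiff_deriv hχ.smooth).comp hρ).continuous
    (hK.of_isClosed_subset (isClosed_tsupport _) hsub') (hsub'.trans hrD)
  obtain ⟨M, hM⟩ := exists_common_bound hK fun i => (huc i).mono hrD
  -- Approximants within `δ` of `u 0` are at most `a + δ` and at least `b - δ`, whence the loss `2
  -- δ`.
  have h3 : ∀ δ > 0, ∫ z, χ (r - ‖z‖ ^ 2) ∂μ ≤
      (a - b + 2 * δ) * ∫ z, deriv χ (r - ‖z‖ ^ 2) ∂ν := by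
    intro δ hδ
    refine le_of_tendsto_of_tendsto h1 (h2.const_mul _) ?_
    filter_upwards [eventually_terms hw hK hrD hM, ((hw 0).2 _ hK hrD).2 δ hδ] with j hj hj0
    have h4 := integral_cutoff_le hmn (W := terms (Fin.tail w) j)
      (contDiff_terms (u := Fin.tail u) (w := Fin.tail w) (fun i => hw i.succ) j)
      (by rw [card_terms]; exact hkm) ((hw 0).1 j) r
      (fun v hv z hz => ((hj v (by
        rw [terms_succ']
        exact Multiset.mem_cons_of_mem hv)).2 z hz).1) hχ (c := a + δ) (A := a - b + 2 * δ)
      fun z hz => by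
        have e1 := hj0 z hz
        have e2 := hab z hz
        rw [abs_le] at e1
        constructor <;> linarith
    rw [card_terms, ← terms_succ'] at h4
    exact h4
  have h5 : Tendsto (fun δ : ℝ => (a - b + 2 * δ) * ∫ z, deriv χ (r - ‖z‖ ^ 2) ∂ν) (𝓝[>] 0)
      (𝓝 ((a - b + 2 * 0) * ∫ z, deriv χ (r - ‖z‖ ^ 2) ∂ν)) := by
    refine Tendsto.mono_left ?_ nhdsWithin_le_nhds
    exact Continuous.tendsto (by fun_prop) 0
  rw [mul_zero, add_zero] at h5
  exact ge_of_tendsto h5 (eventually_nhdsWithin_of_forall fun δ hδ => h3 δ hδ)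

/-- The cutoffs satisfy `s - ε ≤ χ(s)` for `s ≥ 0` and `χ' ≤ 1`. The error `ε μ(K)` vanishes as `ε →
0` because `μ` is finite on the compact sublevel set `K`. -/
theorem integral_sub_norm_sq_le {m k : ℕ} (hmn : m ≤ n) (hkm : k + 1 ≤ m)
    {D : Set (Cn n)} (hD : IsOpen D) {u : Fin (k + 1) → Cn n → ℝ}
    (hu : ∀ i, IsContMSubharmonic m D (u i)) {μ ν : Measure (Cn n)}
    (hμ : IsHessianMeasure D (k + 1) u μ) (hν : IsHessianMeasure D k (Fin.tail u) ν) {r : ℝ}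
    (hrD : {z : Cn n | ‖z‖ ^ 2 ≤ r} ⊆ D) {a b : ℝ} (hab0 : b ≤ a)
    (hab : ∀ z : Cn n, ‖z‖ ^ 2 ≤ r → b ≤ u 0 z ∧ u 0 z ≤ a) :
    ∫ z in {z : Cn n | ‖z‖ ^ 2 ≤ r}, (r - ‖z‖ ^ 2) ∂μ ≤
      (a - b) * ν.real {z : Cn n | ‖z‖ ^ 2 ≤ r} := by
  set K := {z : Cn n | ‖z‖ ^ 2 ≤ r} with hKdef
  have hK : IsCompact K := isCompact_sublevel r
  have hμK : μ K < ⊤ := hμ.1 K hK hrD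
  have hνK : ν K < ⊤ := hν.1 K hK hrD
  have hρ := (contDiff_const_sub_norm_sq (n := n) r).continuous
  have : IsFiniteMeasure (μ.restrict K) := ⟨by rwa [Measure.restrict_apply_univ]⟩
  have : IsFiniteMeasure (ν.restrict K) := ⟨by rwa [Measure.restrict_apply_univ]⟩
  have hbdd : ∀ {κ : Measure (Cn n)} [IsFiniteMeasure (κ.restrict K)] {g : Cn n → ℝ},
      Continuous g → IntegrableOn g K κ := by
    intro κ _ g hg
    obtain ⟨B, hB⟩ := hK.exists_bound_of_continuousOn hg.continuousOn
    exact Integrable.of_bound hg.aestronglyMeasurable B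
      ((ae_restrict_iff' hK.measurableSet).2 (Eventually.of_forall hB))
  have h1 : ∀ ε > 0, ∫ z in K, (r - ‖z‖ ^ 2) ∂μ ≤ (a - b) * ν.real K + ε * μ.real K := by
    intro ε hε
    obtain ⟨χ, hχ, hχ1, hχ2, hχ3⟩ := exists_convexCutoff hε
    have h2 := integral_cutoff_measure_le hmn hkm hD hu hμ hν hrD hχ hab
    have hχc : Continuous fun z : Cn n => χ (r - ‖z‖ ^ 2) := hχ.smooth.continuous.comp hρ
    have hχc' : Continuous fun z : Cn n => deriv χ (r - ‖z‖ ^ 2) :=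
      (contDiff_deriv hχ.smooth).continuous.comp hρ
    have e1 : ∫ z in K, χ (r - ‖z‖ ^ 2) ∂μ = ∫ z, χ (r - ‖z‖ ^ 2) ∂μ :=
      setIntegral_eq_integral_of_forall_compl_eq_zero fun z hz =>
        hχ.zero _ (by
          have : r < ‖z‖ ^ 2 := not_le.1 hz
          linarith)
    have e2 : ∫ z in K, deriv χ (r - ‖z‖ ^ 2) ∂ν = ∫ z, deriv χ (r - ‖z‖ ^ 2) ∂ν :=
      setIntegral_eq_integral_of_forall_compl_eq_zero fun z hz =>
        hχ.deriv_zero (by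
          have : r < ‖z‖ ^ 2 := not_le.1 hz
          linarith)
    have e3 : ∫ z in K, deriv χ (r - ‖z‖ ^ 2) ∂ν ≤ ν.real K := by
      calc ∫ z in K, deriv χ (r - ‖z‖ ^ 2) ∂ν ≤ ∫ _ in K, (1 : ℝ) ∂ν :=
            integral_mono (hbdd hχc') (integrable_const _) fun z => hχ1 _
        _ = ν.real K := by simp
    have e4 : ∫ z in K, (r - ‖z‖ ^ 2) ∂μ ≤ ∫ z in K, (χ (r - ‖z‖ ^ 2) + ε) ∂μ := by
      refine setIntegral_mono_on (hbdd hρ) (hbdd (hχc.add continuous_const)) hK.measurableSet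
        fun z hz => ?_
      have : ‖z‖ ^ 2 ≤ r := hz
      linarith [hχ2 (r - ‖z‖ ^ 2) (by linarith)]
    have e5 : ∫ z in K, (χ (r - ‖z‖ ^ 2) + ε) ∂μ = ∫ z in K, χ (r - ‖z‖ ^ 2) ∂μ + ε * μ.real K := by
      rw [integral_add (hbdd hχc) (integrable_const _)]
      simp [mul_comm]
    have e6 := mul_le_mul_of_nonneg_left (e2 ▸ e3) (sub_nonneg.2 hab0)
    linarith
  have h5 : Tendsto (fun ε : ℝ => (a - b) * ν.real K + ε * μ.real K) (𝓝[>] 0)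
      (𝓝 ((a - b) * ν.real K + 0 * μ.real K)) := by
    refine Tendsto.mono_left ?_ nhdsWithin_le_nhds
    exact Continuous.tendsto (by fun_prop) 0
  rw [zero_mul, add_zero] at h5
  exact ge_of_tendsto h5 (eventually_nhdsWithin_of_forall fun δ hδ => h1 δ hδ)

/-- By Tonelli, each `z` is counted for the parameters `t` in `[‖z‖², r]`, a set of length `r -
‖z‖²`. -/
lemma lintegral_measure_sublevel_le (μ : Measure (Cn n)) (r : ℝ)
    (hμ : μ {z : Cn n | ‖z‖ ^ 2 ≤ r} < ⊤) :
    ∫⁻ t in Ioc (0 : ℝ) r, μ {z | ‖z‖ ^ 2 ≤ t} ≤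
      ENNReal.ofReal (∫ z in {z : Cn n | ‖z‖ ^ 2 ≤ r}, (r - ‖z‖ ^ 2) ∂μ) := by
  set K := {z : Cn n | ‖z‖ ^ 2 ≤ r} with hKdef
  have hK : IsCompact K := isCompact_sublevel r
  have : IsFiniteMeasure (μ.restrict K) := ⟨by rwa [Measure.restrict_apply_univ]⟩
  have hmeas : MeasurableSet {q : ℝ × Cn n | ‖q.2‖ ^ 2 ≤ q.1} :=
    (isClosed_le (by fun_prop) (by fun_prop)).measurableSet
  have h1 : ∀ t ∈ Ioc (0 : ℝ) r, μ {z | ‖z‖ ^ 2 ≤ t} =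
      ∫⁻ z in K, {q : ℝ × Cn n | ‖q.2‖ ^ 2 ≤ q.1}.indicator (fun _ => (1 : ENNReal)) (t, z) ∂μ := by
    intro t ht
    have e1 : ∀ z, {q : ℝ × Cn n | ‖q.2‖ ^ 2 ≤ q.1}.indicator (fun _ => (1 : ENNReal)) (t, z) =
        {z : Cn n | ‖z‖ ^ 2 ≤ t}.indicator (fun _ => (1 : ENNReal)) z := fun z => rfl
    simp only [e1]
    rw [lintegral_indicator (isCompact_sublevel t).measurableSet, lintegral_one,
      Measure.restrict_apply_univ, Measure.restrict_apply (isCompact_sublevel t).measurableSet]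
    congr 1
    exact (inter_eq_left.2 fun z (hz : ‖z‖ ^ 2 ≤ t) => hz.trans ht.2).symm
  rw [setLIntegral_congr_fun measurableSet_Ioc h1]
  rw [lintegral_lintegral_swap (f := fun t z => {q : ℝ × Cn n | ‖q.2‖ ^ 2 ≤ q.1}.indicator
    (fun _ => (1 : ENNReal)) (t, z)) (measurable_const.indicator hmeas).aemeasurable]
  have hint : IntegrableOn (fun z : Cn n => r - ‖z‖ ^ 2) K μ := by
    have hρ := (contDiff_const_sub_norm_sq (n := n) r).continuous
    obtain ⟨B, hB⟩ := hK.exists_bound_of_continuousOn hρ.continuousOn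
    exact Integrable.of_bound hρ.aestronglyMeasurable B
      ((ae_restrict_iff' hK.measurableSet).2 (Eventually.of_forall hB))
  rw [ofReal_integral_eq_lintegral_ofReal hint
    ((ae_restrict_iff' hK.measurableSet).2 (Eventually.of_forall fun z hz => sub_nonneg.2 hz))]
  refine lintegral_mono fun z => ?_
  have e1 : ∀ t, {q : ℝ × Cn n | ‖q.2‖ ^ 2 ≤ q.1}.indicator (fun _ => (1 : ENNReal)) (t, z) =
      (Ici (‖z‖ ^ 2)).indicator (fun _ => (1 : ENNReal)) t := fun t => rfl
  simp only [e1]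
  rw [lintegral_indicator measurableSet_Ici, lintegral_one, Measure.restrict_apply_univ,
    Measure.restrict_apply measurableSet_Ici, ← Real.volume_Icc]
  exact measure_mono fun t ht => ⟨ht.1, ht.2.2⟩

theorem lintegral_measure_sublevel_le_osc {m k : ℕ} (hmn : m ≤ n) (hkm : k + 1 ≤ m)
    {u : Fin (k + 1) → Cn n → ℝ}
    (hu : ∀ i, IsContMSubharmonic m (ball (0 : Cn n) 1) (u i)) {μ ν : Measure (Cn n)}
    (hμ : IsHessianMeasure (ball (0 : Cn n) 1) (k + 1) u μ)
    (hν : IsHessianMeasure (ball (0 : Cn n) 1) k (Fin.tail u) ν) {r : ℝ} (hr : r < 1) :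
    ∫⁻ t in Ioc (0 : ℝ) r, μ {z | ‖z‖ ^ 2 ≤ t} ≤
      ((⨆ z ∈ ball (0 : Cn n) 1, (u 0 z : EReal)) -
        (⨅ z ∈ ball (0 : Cn n) 1, (u 0 z : EReal))).toENNReal * ν {z | ‖z‖ ^ 2 ≤ r} := by
  -- For `r ≤ 0` the integral is over the empty set. For `r > 0` the extrema are taken on the
  -- compact sublevel set, where they are finite, and only afterwards compared with the possibly
  -- infinite supremum and infimum over the ball.
  rcases le_or_gt r 0 with hr0 | hr0
  · rw [Ioc_eq_empty (not_lt.2 hr0), Measure.restrict_empty, lintegral_zero_measure]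
    exact zero_le
  have hK := isCompact_sublevel (n := n) r
  have hKB := sublevel_subset_ball (n := n) hr
  have hne : {z : Cn n | ‖z‖ ^ 2 ≤ r}.Nonempty := ⟨0, by simpa using hr0.le⟩
  have huc : ContinuousOn (u 0) {z : Cn n | ‖z‖ ^ 2 ≤ r} := (hu 0).2.mono hKB
  obtain ⟨x, hx, hxmax⟩ := hK.exists_isMaxOn hne huc
  obtain ⟨y, hy, hymin⟩ := hK.exists_isMinOn hne huc
  have h1 := integral_sub_norm_sq_le hmn hkm isOpen_ball hu hμ hν hKB (a := u 0 x) (b := u 0 y)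
    (hymin hx) fun z hz => ⟨hymin hz, hxmax hz⟩
  have h2 : ENNReal.ofReal (u 0 x - u 0 y) ≤
      ((⨆ z ∈ ball (0 : Cn n) 1, (u 0 z : EReal)) -
        (⨅ z ∈ ball (0 : Cn n) 1, (u 0 z : EReal))).toENNReal := by
    have e1 : ((u 0 x - u 0 y : ℝ) : EReal) ≤ (⨆ z ∈ ball (0 : Cn n) 1, (u 0 z : EReal)) -
        (⨅ z ∈ ball (0 : Cn n) 1, (u 0 z : EReal)) := by
      rw [EReal.coe_sub]
      exact EReal.sub_le_sub (le_iSup₂_of_le x (hKB hx) le_rfl) (iInf₂_le_of_le y (hKB hy) le_rfl)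
    have e2 := EReal.toENNReal_le_toENNReal e1
    rwa [EReal.toENNReal_of_ne_top (EReal.coe_ne_top _), EReal.toReal_coe] at e2
  refine (lintegral_measure_sublevel_le μ r (hμ.1 _ hK hKB)).trans
    ((ENNReal.ofReal_le_ofReal h1).trans ?_)
  rw [ENNReal.ofReal_mul (sub_nonneg.2 (hymin hx)), ofReal_measureReal (hν.1 _ hK hKB).ne]
  exact mul_le_mul_left h2 _

end Inequality

end HessianCurrents

end

/-! ### The main theorem -/

open HessianCurrents in
theorem theorem1 (n m k : ℕ) (hmn : m ≤ n) (hkm : k + 1 ≤ m) :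
    -- the integral inequality on the unit ball, for `k + 1` functions
    (∀ u : Fin (k + 1) → Cn n → ℝ, (∀ i, IsContMSubharmonic m (ball (0 : Cn n) 1) (u i)) →
      (∃ μ : Measure (Cn n), IsHessianMeasure (ball (0 : Cn n) 1) (k + 1) u μ) ∧
      (∃ ν : Measure (Cn n), IsHessianMeasure (ball (0 : Cn n) 1) k (Fin.tail u) ν) ∧
      ∀ μ ν : Measure (Cn n), IsHessianMeasure (ball (0 : Cn n) 1) (k + 1) u μ →
        IsHessianMeasure (ball (0 : Cn n) 1) k (Fin.tail u) ν →
        ∀ r : ℝ, r < 1 →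
          ∫⁻ t in Ioc (0 : ℝ) r, μ {z | ‖z‖ ^ 2 ≤ t} ≤
            ((⨆ z ∈ ball (0 : Cn n) 1, (u 0 z : EReal)) -
              (⨅ z ∈ ball (0 : Cn n) 1, (u 0 z : EReal))).toENNReal * ν {z | ‖z‖ ^ 2 ≤ r}) ∧
    -- existence, positivity and weak boundedness of the two families of currents, on an arbitrary open set
    (∀ D : Set (Cn n), IsOpen D → ∀ M : ℝ,
      (∀ u : Fin (k + 1) → Cn n → ℝ, (∀ i, IsBoundedContMSubharmonic m D M (u i)) →
        (∃ T, IsHessianCurrent D (k + 1) u (m - (k + 1)) T ∧ IsPositiveCurrent D T) ∧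
        (∃ G, IsGradientHessianCurrent D k u (m - (k + 1)) G ∧ IsPositiveCurrent D G)) ∧
      (∀ ψ : Form n (2 * (m - (k + 1))), IsTestForm D ψ → ∃ C : ℝ,
        ∀ u : Fin (k + 1) → Cn n → ℝ, (∀ i, IsBoundedContMSubharmonic m D M (u i)) →
          (∀ T, IsHessianCurrent D (k + 1) u (m - (k + 1)) T → |T ψ| ≤ C) ∧
          (∀ G, IsGradientHessianCurrent D k u (m - (k + 1)) G → |G ψ| ≤ C))) := by
  have hm : 1 ≤ m := by omega
  refine ⟨fun u hu => ⟨?_, ?_, fun μ ν hμ hν r hr => ?_⟩, fun D hD M => ?_⟩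
  · exact exists_isHessianMeasure hm hmn isOpen_ball hkm hu
  · exact exists_isHessianMeasure hm hmn isOpen_ball (by omega) fun i => hu i.succ
  · exact lintegral_measure_sublevel_le_osc hmn hkm hu hμ hν hr
  · exact currents_on_open_set hmn hkm hD M
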